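/- **Setting.** Let $(\Omega,\mathscr F,m)$ be a probability space and $\sigma:\Omega\to\Omega$ an invertible (bimeasurable) ergodic $m$-preserving map. Let $M$ be a complete metric space with Borel $\sigma$-algebra $\mathscr B$, and let $\omega\mapsto J_\omega\subseteq M$ be a closed random set (each $J_\omega$ is closed and $\omega\mapsto d(x,J_\omega)$ is measurable for each $x\in M$). Put $\mathcal J=\{(\omega,x):x\in J_\omega\}$ with the trace of $\mathscr F\otimes\mathscr B$. Let $T_\omega:J_\omega\to J_{\sigma\omega}$ be maps, $T(\omega,x)=(\sigma\omega,T_\omega x)$, $T^n_\omega=T_{\sigma^{n-1}\omega}\circ\dots\circ T_\omega$. Let $\varphi:\mathcal J\to\mathbb R$ be a potential, $g_\omega=e^{\varphi(\omega,\cdot)}$, and let $(\mathcal B_\omega,\|\cdot\|_{\mathcal B_\omega})$ be Banach spaces of complex-valued functions on $J_\omega$ containing $\mathbf 1$ and $g_\omega$, such that $$\mathcal L_{\omega,0}f(x)=\sum_{T_\omega y=x}f(y)g_\omega(y)$$ converges absolutely for $f\in\mathcal B_\omega$, $x\in J_{\sigma\omega}$, and defines an operator $\mathcal B_\omega\to\mathcal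 B_{\sigma\omega}$. * (M1) $T:\mathcal J\to\mathcal J$ is measurable. (M2) If $f:\mathcal J\to\mathbb C$ is measurable with $f_\omega:=f(\omega,\cdot)\in\mathcal B_\omega$ for all $\omega$, then $(\omega,x)\mapsto\mathcal L_{\sigma^{-1}\omega,0}f_{\sigma^{-1}\omega}(x)$ is measurable on $\mathcal J$. * (CCM) There are Borel measures $\nu_{\omega,0}$ on $J_\omega$, depending measurably on $\omega$, which for $m$-a.e. $\omega$ are probability measures without atoms with $\mathcal B_\omega\subseteq L^1(\nu_{\omega,0})$, and measurable $\lambda_0:\Omega\to\mathbb R\setminus\{0\}$, $\phi_0:\mathcal J\to(0,\infty)$ with $\phi_{\omega,0}:=\phi_0(\omega,\cdot)\in\mathcal B_\omega$, such that for a.e. $\omega$: $\mathcal L_{\omega,0}\phi_{\omega,0}=\lambda_{\omega,0}\phi_{\sigma\omega,0}$; $\nu_{\sigma\omega,0}(\mathcal L_{\omega,0}f)=\lambda_{\omega,0}\nu_{\omega,0}(f)$ for all $f\in\mathcal B_\omega$; $\lambda_{\omega,0}=\nu_{\sigma\omega,0}(\mathcal L_{\omega,0}\mathbf 1)$; moreover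 $\log\lambda_{\omega,0}\in L^1(m)$, and $\mu_{\omega,0}:=\phi_{\omega,0}\,\nu_{\omega,0}$ is a probability measure for a.e. $\omega$. * (A) Targets: $H_n\subseteq\mathcal J$ ($n\ge1$) are measurable and decreasing, $H_{n'}\subseteq H_n$ for $n'\ge n$. Write $H_{\omega,n}=\{x\in J_\omega:(\omega,x)\in H_n\}$ and $$S_{\omega,n,k}(x)=\sum_{j=0}^{k-1}\mathbf 1_{H_{\sigma^j\omega,n}}(T^j_\omega x).$$ * (B) $\mathbf 1_{H_{\omega,n}}\in\mathcal B_\omega$ for all $\omega$ and $n\ge1$, and there is $C>0$ with $\|\mathbf 1_{H_{\omega,n}}\|_{\mathcal B_\omega}\le C$ for a.e. $\omega$ and all $n\ge1$. In addition $f e^{isS_{\omega,n,k}}\in\mathcal B_\omega$ for all $f\in\mathcal B_\omega$, $n\ge1$, $k\ge0$, $s\in\mathbb R$ (so that $\mathcal L_{\omega,n,s}f:=\mathcal L_{\omega,0}(fe^{is\mathbf 1_{H_{\omega,n}}})$ maps $\mathcal B_\omega$ to $\mathcal B_{\sigma\omega}$ and $\mathcal L^k_{\omega,n,s}f=\mathcal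 L^k_{\omega,0}(fe^{isS_{\omega,n,k}})$ is meaningful in $\mathcal B_{\sigma^k\omega}$). Let $\|\cdot\|_{\infty,\omega}$ be the $\nu_{\omega,0}$-essential supremum norm, and $$\eta_{\omega,n}(s)=\sup_{\|\psi\|_{\mathcal B_\omega}\le1}\bigl|\nu_{\sigma\omega,0}\bigl((\mathcal L_{\omega,0}-\mathcal L_{\omega,n,s})\psi\bigr)\bigr|,$$ $$\hat q^{(k)}_{\omega,n}(s)=\frac{1-e^{is}}{\mu_{\omega,0}(H_{\omega,n})}\int_{H_{\omega',n}\cap T_{\omega'}^{-(k+1)}(H_{\omega,n})}e^{isS_{\sigma\omega',n,k}\circ T_{\omega'}}\,d\mu_{\omega',0},\qquad \omega'=\sigma^{-(k+1)}\omega .$$ For each $s\in\mathbb R$ and all sufficiently large $n$ (conditions that do not involve $n$ or $s$ being required once), assume: * (C1) $C_1^{-1}\le\mathcal L_{\omega,0}\mathbf 1\le C_1$ for a.e. $\omega$, for some constant $C_1\ge1$. * (C2) There are bounded functionals $\nu_{\omega,n,s}\in\mathcal B_\omega^*$, a measurable $\lambda_{n,s}:\Omega\to\mathbb C\setminus\{0\}$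 with $\log|\lambda_{\omega,n,s}|\in L^1(m)$, and a measurable $\phi_{n,s}:\mathcal J\to\mathbb C$ with $\phi_{\omega,n,s}\in\mathcal B_\omega$, such that for a.e. $\omega$: $\mathcal L_{\omega,n,s}\phi_{\omega,n,s}=\lambda_{\omega,n,s}\phi_{\sigma\omega,n,s}$, $\nu_{\sigma\omega,n,s}(\mathcal L_{\omega,n,s}f)=\lambda_{\omega,n,s}\nu_{\omega,n,s}(f)$ for $f\in\mathcal B_\omega$, and $\nu_{\omega,0}(\phi_{\omega,n,s})=1$. * (C3) There are linear operators $Q_{\omega,0},Q_{\omega,n,s}:\mathcal B_\omega\to\mathcal B_{\sigma\omega}$ such that for a.e. $\omega$ and all $f\in\mathcal B_\omega$: $\lambda_{\omega,0}^{-1}\mathcal L_{\omega,0}f=\nu_{\omega,0}(f)\phi_{\sigma\omega,0}+Q_{\omega,0}f$, $\lambda_{\omega,n,s}^{-1}\mathcal L_{\omega,n,s}f=\nu_{\omega,n,s}(f)\phi_{\sigma\omega,n,s}+Q_{\omega,n,s}f$, $Q_{\omega,0}\phi_{\omega,0}=0$, $\nu_{\sigma\omega,0}(Q_{\omega,0}f)=0$,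 $Q_{\omega,n,s}\phi_{\omega,n,s}=0$, $\nu_{\sigma\omega,n,s}(Q_{\omega,n,s}f)=0$. * (C4) There are $C>0$ and a summable sequence $\alpha(N)>0$, independent of $\omega$ and $n$, such that for a.e. $\omega$, all $N\ge1$ and $f\in\mathcal B_\omega$, $\|Q^N_{\omega,0}f\|_{\infty,\sigma^N\omega}$ and $\|Q^N_{\omega,n,s}f\|_{\infty,\sigma^N\omega}$ are at most $C\alpha(N)\|f\|_{\mathcal B_\omega}$, where $Q^N_\omega=Q_{\sigma^{N-1}\omega}\circ\dots\circ Q_\omega$. * (C5) There is $C_2\ge1$, independent of $\omega$ and $n$, with $\|\phi_{\omega,0}\|_{\mathcal B_\omega}\le C_2$ and $\|\phi_{\omega,n,s}\|_{\infty,\omega}\le C_2$ for a.e. $\omega$. * (C6) $\lim_{n\to\infty}\eta_{\omega,n}(s)=0$ for a.e. $\omega$. * (C7) There is $C_3\ge1$ with $\inf\phi_{\omega,0}\ge C_3^{-1}$ for a.e. $\omega$. * (C8) For a.e. $\omega$ the limit $\hat q^{(k)}_{\omega,0}(s):=\lim_{n\to\infty}\hat q^{(k)}_{\omega,n}(s)$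 exists for every $k\ge0$. * (S) For a given $t\in L^\infty(m)$ with $t>0$ there are $\xi_n\in L^\infty(m)$ and $W<\infty$ such that $\mu_{\omega,0}(H_{\omega,n})=(t_\omega+\xi_{\omega,n})/n$ and $|\xi_{\omega,n}|\le W$ for a.e. $\omega$ and all $n\ge1$, and $\xi_{\omega,n}\to0$ for a.e. $\omega$. (The constants and the threshold for $n$ in (C2)–(C5) may depend on $s$.) Put $\lambda^n_{\omega,0}=\prod_{j=0}^{n-1}\lambda_{\sigma^j\omega,0}$, $\lambda^n_{\omega,n,s}=\prod_{j=0}^{n-1}\lambda_{\sigma^j\omega,n,s}$, and $\theta_\omega(s)=1-\sum_{k=0}^\infty\hat q^{(k)}_{\omega,0}(s)$. **Theorem.** Under these assumptions, for every $s\in\mathbb R$ the series defining $\theta_\omega(s)$ converges absolutely for $m$-a.e. $\omega$, the function $\omega\mapsto t_\omega\theta_\omega(s)$ is $m$-integrable, and for $m$-a.e. $\omega$ $$\lim_{n\to\infty}\nu_{\omega,0}\bigl(e^{isS_{\omega,n,n}}\bigr)=\lim_{n\to\infty}\mu_{\omega,0}\bigl(e^{isS_{\omega,n,n}}\bigr)=\lim_{n\to\infty}\frac{\lambda^n_{\omega,n,s}}{\lambda^n_{\omega,0}}=\exp\Bigl(-(1-e^{is})\int_\Omega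 t_\omega\theta_\omega(s)\,dm(\omega)\Bigr).$$ Moreover there is a compound Poisson law $P$ on $\{0,1,2,\dots\}$ (the law of $\sum_{k=1}^N X_k$ with $N$ Poisson distributed and independent of the i.i.d. $\{0,1,2,\dots\}$-valued sequence $X_1,X_2,\dots$), not depending on $\omega$, whose characteristic function at every $s\in\mathbb R$ is the right-hand side above, and such that for $m$-a.e. $\omega$ the random variables $S_{\omega,n,n}$ converge in distribution to $P$ as $n\to\infty$, both under $\nu_{\omega,0}$ and under $\mu_{\omega,0}$. -/

import Mathlib

open MeasureTheory ProbabilityTheory Filter Topology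
open scoped ENNReal NNReal BoundedContinuousFunction

noncomputable section

/-- A Banach space of complex-valued functions on `X`: a linear space of functions with a complete
norm (the norm need not come from the values in any particular way). -/
structure FunctionBanachSpace (X : Type*) where
  carrier : Submodule ℂ (X → ℂ)
  nrm : Seminorm ℂ carrier
  eq_zero_of_nrm : ∀ f : carrier, nrm f = 0 → f = 0
  complete : ∀ u : ℕ → carrier,
    (∀ ε > 0, ∃ N, ∀ i ≥ N, ∀ j ≥ N, nrm (u i - u j) < ε) →
    ∃ f : carrier, Tendsto (fun i => nrm (u i - f)) atTop (𝓝 0)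

/-- The bundle `𝒥 = ⋃_ω {ω} × J ω ⊆ Ω × M`, with the trace of the product σ-algebra. -/
abbrev Bundle {Ω M : Type*} (J : Ω → Set M) : Type _ := {p : Ω × M // p.2 ∈ J p.1}

/-- The point `(ω, x)` of the bundle. -/
def Bundle.pt {Ω M : Type*} {J : Ω → Set M} (ω : Ω) (x : J ω) : Bundle J := ⟨(ω, x.1), x.2⟩

/-- The restriction `f_ω = f (ω, ·)` of a function on the bundle to the fibre over `ω`. -/
def Bundle.fib {Ω M E : Type*} {J : Ω → Set M} (f : Bundle J → E) (ω : Ω) : J ω → E :=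
  fun x => f (Bundle.pt ω x)

/-- The objects of a random system with random targets: an invertible base map `σ`, fibres `J ω`,
fibre maps `T ω : J ω → J (σ ω)`, a potential `pot` (the weight is `g = exp pot`), fibrewise Banach
spaces `B ω` of functions, fibre measures `ν ω` (with fibrewise eigenvalues `lam0` and
eigenfunctions `phi0`), and targets `H n ⊆ 𝒥`. -/
structure RandomSystem (Ω M : Type*) [MeasurableSpace Ω] [MeasurableSpace M] where
  σ : Ω ≃ᵐ Ω
  J : Ω → Set M
  T : ∀ ω, J ω → J (σ ω)
  pot : Bundle J → ℝ
  B : ∀ ω, FunctionBanachSpace (J ω)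
  ν : ∀ ω, Measure (J ω)
  lam0 : Ω → ℝ
  phi0 : Bundle J → ℝ
  H : ℕ → Set (Bundle J)

namespace RandomSystem

variable {Ω M : Type*} [MeasurableSpace Ω] [MeasurableSpace M] (R : RandomSystem Ω M)

/-- The skew product `(ω, x) ↦ (σ ω, T_ω x)`. -/
def skew (p : Bundle R.J) : Bundle R.J :=
  Bundle.pt (R.σ p.1.1) (R.T p.1.1 ⟨p.1.2, p.2⟩)

/-- The elements of the Banach space `B ω`. -/
abbrev Fn (ω : Ω) : Type _ := (R.B ω).carrier

/-- The eigenfunction `φ_{ω,0}` as a complex-valued function on the fibre. -/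
def phi0C (ω : Ω) : R.J ω → ℂ := fun x => ((Bundle.fib R.phi0 ω x : ℝ) : ℂ)

/-- The target `H_{ω,n}` in the fibre over `ω`. -/
def target (n : ℕ) (ω : Ω) : Set (R.J ω) := {x | Bundle.pt ω x ∈ R.H n}

open Classical in
/-- The number of visits `S_{ω,n,k}(x) = ∑_{j<k} 1_{H_{σ^j ω,n}}(T_ω^j x)` at the point
`p = (ω, x)`. -/
def visits (n k : ℕ) (p : Bundle R.J) : ℕ :=
  ∑ j ∈ Finset.range k, if R.skew^[j] p ∈ R.H n then 1 else 0

/-- `e^{i s S_{ω,n,k}}` as a function on the fibre over `ω`; for `k = 1` this is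
`e^{i s 1_{H_{ω,n}}}`. -/
def expVisits (n k : ℕ) (s : ℝ) (ω : Ω) : R.J ω → ℂ :=
  fun x => Complex.exp (Complex.I * s * (R.visits n k (Bundle.pt ω x) : ℂ))

/-- The transfer operator `L_{ω,0} f (x) = ∑_{T_ω y = x} f(y) g_{ω,0}(y)`. -/
def transfer (ω : Ω) (f : R.J ω → ℂ) : R.J (R.σ ω) → ℂ :=
  fun x => ∑' y : {y : R.J ω // R.T ω y = x}, f y * (Real.exp (R.pot (Bundle.pt ω y)) : ℂ)

/-- The global transfer operator `(L_0 f)_ω = L_{σ⁻¹ω,0} f_{σ⁻¹ω}`, written as a sum over the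
preimages under the (fibre preserving) skew product; see `fib_globalTransfer`. -/
def globalTransfer (f : Bundle R.J → ℂ) : Bundle R.J → ℂ :=
  fun p => ∑' q : {q : Bundle R.J // R.skew q = p}, f q * (Real.exp (R.pot q) : ℂ)

/-- The perturbed operator `L_{ω,n,s} f = L_{ω,0} (f e^{i s 1_{H_{ω,n}}})`. -/
def perturbed (n : ℕ) (s : ℝ) (ω : Ω) (f : R.J ω → ℂ) : R.J (R.σ ω) → ℂ :=
  R.transfer ω (fun x => f x * R.expVisits n 1 s ω x)

/-- The fibre measure `μ_{ω,0} = φ_{ω,0} ν_{ω,0}`. -/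
def μ (ω : Ω) : Measure (R.J ω) :=
  (R.ν ω).withDensity (fun x => ENNReal.ofReal (Bundle.fib R.phi0 ω x))

/-- `η_{ω,n}(s)`, the norm of the functional `ν_{σω,0} (L_{ω,0} - L_{ω,n,s})` on `B ω`. -/
def eta (n : ℕ) (s : ℝ) (ω : Ω) : ℝ≥0∞ :=
  ⨆ (f : R.Fn ω) (_ : (R.B ω).nrm f ≤ 1),
    ‖∫ x, (R.transfer ω f.1 x - R.perturbed n s ω f.1 x) ∂(R.ν (R.σ ω))‖ₑ

open Classical in
/-- With `ω' = σ^{-(k+1)} ω`, the quantity `q̂^{(k)}_{ω,n}(s)`, i.e. `(1 - e^{is}) / μ_ω(H_{ω,n})`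
times the `μ_{ω'}`-integral of `1_{H_{ω',n}} · e^{i s S_{σω',n,k} ∘ T_{ω'}} · 1_{H_{ω,n}} ∘ T_{ω'}^{k+1}`. -/
def qhat (n k : ℕ) (s : ℝ) (ω : Ω) : ℂ :=
  (1 - Complex.exp (Complex.I * s)) *
    (∫ x : R.J (R.σ.symm^[k + 1] ω),
      (if R.skew^[k + 1] (Bundle.pt _ x) ∈ R.H n then (1 : ℂ) else 0) *
      Complex.exp (Complex.I * s * (R.visits n k (R.skew (Bundle.pt _ x)) : ℂ)) *
      (if Bundle.pt _ x ∈ R.H n then (1 : ℂ) else 0) ∂(R.μ (R.σ.symm^[k + 1] ω))) /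
    ((R.μ ω).real (R.target n ω) : ℂ)

/-- The limit `q̂^{(k)}_{ω,0}(s)` (meaningful where the limit exists). -/
def qhat0 (k : ℕ) (s : ℝ) (ω : Ω) : ℂ :=
  limUnder atTop (fun n => R.qhat n k s ω)

/-- `θ_ω(s) = 1 - ∑_k q̂^{(k)}_{ω,0}(s)`. -/
def theta (s : ℝ) (ω : Ω) : ℂ := 1 - ∑' k, R.qhat0 k s ω

/-- The `N`-fold composition `Q_ω^N = Q_{σ^{N-1}ω} ∘ ⋯ ∘ Q_ω`. -/
def iter (Q : ∀ ω, R.Fn ω →ₗ[ℂ] R.Fn (R.σ ω)) : ∀ (N : ℕ) (ω : Ω), R.Fn ω → R.Fn (R.σ^[N] ω)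
  | 0, _, f => f
  | N + 1, ω, f => iter Q N (R.σ ω) (Q ω f)

/-- The global transfer operator restricts to the fibre operators. -/
theorem fib_globalTransfer (f : Bundle R.J → ℂ) (ω : Ω) :
    Bundle.fib (R.globalTransfer f) (R.σ ω) = R.transfer ω (Bundle.fib f ω) := by
  funext x
  let e : {y : R.J ω // R.T ω y = x} →
      {q : Bundle R.J // R.skew q = Bundle.pt (R.σ ω) x} :=
    fun y => ⟨Bundle.pt ω y.1, by
      have h := y.2
      change Bundle.pt (R.σ ω) (R.T ω y.1) = _
      rw [h]⟩
  have he : Function.Bijective e := by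
    constructor
    · intro y z hyz
      have h1 : Bundle.pt ω y.1 = Bundle.pt ω z.1 := congrArg Subtype.val hyz
      have h2 : ((y.1 : R.J ω) : M) = z.1 := congrArg (fun p : Bundle R.J => p.1.2) h1
      exact Subtype.ext (Subtype.ext h2)
    · rintro ⟨⟨⟨ω', y⟩, hy⟩, hq⟩
      have h1 : R.σ ω' = R.σ ω := congrArg (fun p : Bundle R.J => p.1.1) hq
      obtain rfl : ω' = ω := R.σ.injective h1
      have h2 : ((R.T ω' ⟨y, hy⟩ : R.J (R.σ ω')) : M) = x :=
        congrArg (fun p : Bundle R.J => p.1.2) hq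
      exact ⟨⟨⟨y, hy⟩, Subtype.ext h2⟩, rfl⟩
  exact ((Equiv.ofBijective e he).tsum_eq
    (fun q : {q : Bundle R.J // R.skew q = Bundle.pt (R.σ ω) x} =>
      f q * (Real.exp (R.pot q) : ℂ))).symm

end RandomSystem

/-- The objects attached to the perturbed operators `L_{ω,n,s}` (and the operators `Q_{ω,0}`):
multipliers `lam n s`, eigenfunctions `phi n s`, functionals `nu n s ω` on `B ω`, and remainder
operators. -/
structure SpectralData {Ω M : Type*} [MeasurableSpace Ω] [MeasurableSpace M]
    (R : RandomSystem Ω M) where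
  lam : ℕ → ℝ → Ω → ℂ
  phi : ℕ → ℝ → Bundle R.J → ℂ
  nu : ℕ → ℝ → ∀ ω, R.Fn ω →ₗ[ℂ] ℂ
  Q0 : ∀ ω, R.Fn ω →ₗ[ℂ] R.Fn (R.σ ω)
  Q : ℕ → ℝ → ∀ ω, R.Fn ω →ₗ[ℂ] R.Fn (R.σ ω)

/-- The standing assumptions on the unperturbed system: driving system, closed random set of
fibres, function spaces, (M1), (M2). -/
structure IsRandomDynamicalSystem {Ω M : Type*} [MeasurableSpace Ω] [MetricSpace M]
    [MeasurableSpace M] (m : Measure Ω) (R : RandomSystem Ω M) : Prop where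
  ergodic : Ergodic R.σ m
  isClosed_fibre : ∀ ω, IsClosed (R.J ω)
  measurable_fibre : ∀ x : M, Measurable fun ω => Metric.infEDist x (R.J ω)
  /-- (M1) -/
  M1 : Measurable R.skew
  one_mem : ∀ ω, (fun _ => (1 : ℂ)) ∈ (R.B ω).carrier
  weight_mem : ∀ ω, (fun x => (Real.exp (R.pot (Bundle.pt ω x)) : ℂ)) ∈ (R.B ω).carrier
  /-- `L_{ω,0} : B ω → B (σ ω)` is well defined. -/
  transfer_summable : ∀ ω, ∀ f ∈ (R.B ω).carrier, ∀ x : R.J (R.σ ω),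
    Summable fun y : {y : R.J ω // R.T ω y = x} =>
      f y * (Real.exp (R.pot (Bundle.pt ω y)) : ℂ)
  transfer_mem : ∀ ω, ∀ f ∈ (R.B ω).carrier, R.transfer ω f ∈ (R.B (R.σ ω)).carrier
  /-- (M2) -/
  M2 : ∀ f : Bundle R.J → ℂ, Measurable f → (∀ ω, Bundle.fib f ω ∈ (R.B ω).carrier) →
    Measurable (R.globalTransfer f)

/-- (CCM): `ν` is a random conformal probability measure with eigenvalues `lam0`, and `phi0` is a
positive eigenfunction, normalised so that `μ` is a random probability measure. -/
structure IsConformal {Ω M : Type*} [MeasurableSpace Ω] [MeasurableSpace M]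
    (m : Measure Ω) (R : RandomSystem Ω M) : Prop where
  measurable_ν : ∀ A : Set M, MeasurableSet A →
    Measurable fun ω => R.ν ω ((fun x : R.J ω => (x : M)) ⁻¹' A)
  isProbability : ∀ᵐ ω ∂m, IsProbabilityMeasure (R.ν ω)
  noAtoms : ∀ᵐ ω ∂m, ∀ x, R.ν ω {x} = 0
  integrable : ∀ᵐ ω ∂m, ∀ f ∈ (R.B ω).carrier, Integrable f (R.ν ω)
  measurable_lam0 : Measurable R.lam0
  lam0_ne_zero : ∀ ω, R.lam0 ω ≠ 0
  log_lam0 : Integrable (fun ω => Real.log (R.lam0 ω)) m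
  lam0_eq : ∀ᵐ ω ∂m, (R.lam0 ω : ℂ) = ∫ x, R.transfer ω (fun _ => 1) x ∂(R.ν (R.σ ω))
  measurable_phi0 : Measurable R.phi0
  phi0_pos : ∀ p, 0 < R.phi0 p
  phi0_mem : ∀ ω, R.phi0C ω ∈ (R.B ω).carrier
  eigenfunction : ∀ᵐ ω ∂m,
    R.transfer ω (R.phi0C ω) = fun x => (R.lam0 ω : ℂ) * R.phi0C (R.σ ω) x
  conformal : ∀ᵐ ω ∂m, ∀ f ∈ (R.B ω).carrier,
    ∫ x, R.transfer ω f x ∂(R.ν (R.σ ω)) = (R.lam0 ω : ℂ) * ∫ x, f x ∂(R.ν ω)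
  μ_isProbability : ∀ᵐ ω ∂m, IsProbabilityMeasure (R.μ ω)

/-- Measurable decreasing targets, (A) and (B), and the well-definedness of the iterated perturbed
operators `L_{ω,n,s}^k f = L_{ω,0}^k (e^{i s S_{ω,n,k}} f)` on `B ω`. -/
structure IsTargetFamily {Ω M : Type*} [MeasurableSpace Ω] [MeasurableSpace M]
    (m : Measure Ω) (R : RandomSystem Ω M) : Prop where
  measurable_H : ∀ n ≥ 1, MeasurableSet (R.H n)
  /-- (A) -/
  A : ∀ n n', 1 ≤ n → n ≤ n' → R.H n' ⊆ R.H n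
  /-- (B) -/
  indicator_mem : ∀ n ≥ 1, ∀ ω, (R.target n ω).indicator (fun _ => (1 : ℂ)) ∈ (R.B ω).carrier
  indicator_bound : ∃ C > 0, ∀ᵐ ω ∂m, ∀ n ≥ 1, ∀ f : R.Fn ω,
    f.1 = (R.target n ω).indicator (fun _ => (1 : ℂ)) → (R.B ω).nrm f ≤ C
  expVisits_mem : ∀ n ≥ 1, ∀ k s ω, ∀ f ∈ (R.B ω).carrier,
    (fun x => f x * R.expVisits n k s ω x) ∈ (R.B ω).carrier

/-- The conditions (C1)–(C7). The perturbed conditions are required for each `s` and all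
sufficiently large `n`; `‖·‖_{∞,ω}` is the `ν_{ω,0}`-essential supremum norm. -/
structure SatisfiesC1C7 {Ω M : Type*} [MeasurableSpace Ω] [MeasurableSpace M]
    (m : Measure Ω) (R : RandomSystem Ω M) (D : SpectralData R) : Prop where
  /-- (C1); `L_{ω,0} 1` is real valued. -/
  C1 : ∃ C₁ ≥ (1 : ℝ), ∀ᵐ ω ∂m, ∀ x,
    C₁⁻¹ ≤ (R.transfer ω (fun _ => 1) x).re ∧ (R.transfer ω (fun _ => 1) x).re ≤ C₁
  /-- (C2) -/
  C2_nu : ∀ s, ∀ᶠ n in atTop, ∀ᵐ ω ∂m, ∃ K : ℝ, ∀ f, ‖D.nu n s ω f‖ ≤ K * (R.B ω).nrm f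
  C2_lam : ∀ s, ∀ᶠ n in atTop, Measurable (D.lam n s) ∧ (∀ ω, D.lam n s ω ≠ 0) ∧
    Integrable (fun ω => Real.log ‖D.lam n s ω‖) m
  C2_phi : ∀ s, ∀ᶠ n in atTop, Measurable (D.phi n s) ∧
    ∀ ω, Bundle.fib (D.phi n s) ω ∈ (R.B ω).carrier
  C2_eigenfunction : ∀ s, ∀ᶠ n in atTop, ∀ᵐ ω ∂m,
    R.perturbed n s ω (Bundle.fib (D.phi n s) ω) =
      fun x => D.lam n s ω * Bundle.fib (D.phi n s) (R.σ ω) x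
  C2_eigenfunctional : ∀ s, ∀ᶠ n in atTop, ∀ᵐ ω ∂m, ∀ (f : R.Fn ω) (h : R.Fn (R.σ ω)),
    h.1 = R.perturbed n s ω f.1 → D.nu n s (R.σ ω) h = D.lam n s ω * D.nu n s ω f
  C2_normalised : ∀ s, ∀ᶠ n in atTop, ∀ᵐ ω ∂m, ∫ x, Bundle.fib (D.phi n s) ω x ∂(R.ν ω) = 1
  /-- (C3) -/
  C3_unperturbed : ∀ᵐ ω ∂m, ∀ (f : R.Fn ω) (x : R.J (R.σ ω)),
    (R.lam0 ω : ℂ)⁻¹ * R.transfer ω f.1 x =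
      (∫ y, f.1 y ∂(R.ν ω)) * R.phi0C (R.σ ω) x + (D.Q0 ω f).1 x
  C3_perturbed : ∀ s, ∀ᶠ n in atTop, ∀ᵐ ω ∂m, ∀ (f : R.Fn ω) (x : R.J (R.σ ω)),
    (D.lam n s ω)⁻¹ * R.perturbed n s ω f.1 x =
      D.nu n s ω f * Bundle.fib (D.phi n s) (R.σ ω) x + (D.Q n s ω f).1 x
  C3_unperturbed_kernel : ∀ᵐ ω ∂m, ∀ f : R.Fn ω,
    (f.1 = R.phi0C ω → D.Q0 ω f = 0) ∧ ∫ x, (D.Q0 ω f).1 x ∂(R.ν (R.σ ω)) = 0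
  C3_perturbed_kernel : ∀ s, ∀ᶠ n in atTop, ∀ᵐ ω ∂m, ∀ f : R.Fn ω,
    (f.1 = Bundle.fib (D.phi n s) ω → D.Q n s ω f = 0) ∧ D.nu n s (R.σ ω) (D.Q n s ω f) = 0
  /-- (C4) -/
  C4 : ∀ s, ∃ C > (0 : ℝ), ∃ α : ℕ → ℝ, (∀ N, 0 < α N) ∧ Summable α ∧
    (∀ᵐ ω ∂m, ∀ N ≥ 1, ∀ f : R.Fn ω,
      ∀ᵐ x ∂(R.ν (R.σ^[N] ω)), ‖(R.iter D.Q0 N ω f).1 x‖ ≤ C * α N * (R.B ω).nrm f) ∧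
    (∀ᶠ n in atTop, ∀ᵐ ω ∂m, ∀ N ≥ 1, ∀ f : R.Fn ω,
      ∀ᵐ x ∂(R.ν (R.σ^[N] ω)), ‖(R.iter (D.Q n s) N ω f).1 x‖ ≤ C * α N * (R.B ω).nrm f)
  /-- (C5) -/
  C5 : ∀ s, ∃ C₂ ≥ (1 : ℝ),
    (∀ᵐ ω ∂m, ∀ f : R.Fn ω, f.1 = R.phi0C ω → (R.B ω).nrm f ≤ C₂) ∧
    (∀ᶠ n in atTop, ∀ᵐ ω ∂m, ∀ᵐ x ∂(R.ν ω), ‖Bundle.fib (D.phi n s) ω x‖ ≤ C₂)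
  /-- (C6) -/
  C6 : ∀ s, ∀ᵐ ω ∂m, Tendsto (fun n => R.eta n s ω) atTop (𝓝 0)
  /-- (C7) -/
  C7 : ∃ C₃ ≥ (1 : ℝ), ∀ᵐ ω ∂m, ∀ x, C₃⁻¹ ≤ Bundle.fib R.phi0 ω x

/-- A random perturbed system: (M1), (M2), (CCM), (A), (B), (C1)–(C7). -/
structure IsRandomPerturbedSystem {Ω M : Type*} [MeasurableSpace Ω] [MetricSpace M]
    [MeasurableSpace M] (m : Measure Ω) (R : RandomSystem Ω M) (D : SpectralData R) : Prop where
  dynamics : IsRandomDynamicalSystem m R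
  conformal : IsConformal m R
  targets : IsTargetFamily m R
  spectral : SatisfiesC1C7 m R D

/-- (C8): the limits `q̂^{(k)}_{ω,0}(s)` exist. -/
def SatisfiesC8 {Ω M : Type*} [MeasurableSpace Ω] [MeasurableSpace M]
    (m : Measure Ω) (R : RandomSystem Ω M) : Prop :=
  ∀ s : ℝ, ∀ᵐ ω ∂m, ∀ k : ℕ, ∃ q : ℂ, Tendsto (fun n => R.qhat n k s ω) atTop (𝓝 q)

/-- (S): the scaling of the targets with scaling function `t`. -/
structure SatisfiesScaling {Ω M : Type*} [MeasurableSpace Ω] [MeasurableSpace M]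
    (m : Measure Ω) (R : RandomSystem Ω M) (t : Ω → ℝ) : Prop where
  memLp_t : MemLp t ∞ m
  t_pos : ∀ᵐ ω ∂m, 0 < t ω
  scaling : ∃ (ξ : ℕ → Ω → ℝ) (W : ℝ),
    (∀ n ≥ 1, MemLp (ξ n) ∞ m) ∧
    (∀ᵐ ω ∂m, ∀ n ≥ 1, (R.μ ω).real (R.target n ω) = (t ω + ξ n ω) / n) ∧
    (∀ᵐ ω ∂m, Tendsto (fun n => ξ n ω) atTop (𝓝 0)) ∧
    (∀ᵐ ω ∂m, ∀ n ≥ 1, |ξ n ω| ≤ W)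

/-- The law on `ℕ` of `∑_{k=1}^N X_k` with `N` Poisson distributed, `X_1, X_2, …` i.i.d. with values
in `ℕ`, and `N` independent of the sequence. -/
def IsCompoundPoisson (P : Measure ℕ) : Prop :=
  ∃ (Γ : Type) (_ : MeasurableSpace Γ) (Pr : Measure Γ) (r : ℝ≥0) (N : Γ → ℕ) (X : ℕ → Γ → ℕ),
    IsProbabilityMeasure Pr ∧ 0 < r ∧
    Measurable N ∧ Pr.map N = poissonMeasure r ∧
    (∀ i, Measurable (X i)) ∧ (∀ i, IdentDistrib (X i) (X 0) Pr Pr) ∧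
    iIndepFun X Pr ∧ IndepFun N (fun γ i => X i γ) Pr ∧
    P = Pr.map (fun γ => ∑ k ∈ Finset.range (N γ), X k γ)

end

/-! Conformality turns a fibre integral of `f e^{isS_N} (v ∘ T^N)` into an integral of an iterated
perturbed operator, and (C3) then splits it exactly (`twisted_eq`): it is `λ^N_{n,s} / λ^N_0` times
the sum of `ν_{n,s}(f) ν_0(φ_{n,s} v)` and a remainder governed by `α(N)`. For `v = 1` and `N = n`
the remainder disappears in the limit, and `ν_{n,s}(f) → 1` for `f = 1` and `f = φ_0`
(`tendsto_nu`), so all three limits reduce to that of the product of the ratios `λ_{n,s} / λ_0`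
along the orbit.

One such ratio is `1 - (1 - e^{is}) a_n / n`, where `a_n` (`scaledMass`) is `n` times the integral
of `1_{H_n} φ_{n,s}`, a bounded quantity. To find its limit, start from `φ_0` over `σ^{-N} ω`: the
splitting with `v = 1_{H_n}` shows that for large `n` the number `a_n(ω)` is within `O(α(N))` of `n
∫ e^{isS_N} 1_{H_n} ∘ T^N dμ` (`delayedMass`). Expanding `e^{isS_N}` over the visits before time `N`
and using invariance of `μ`, this equals `n μ_ω(H_n) (1 - ∑_{k<N} q̂^{(k)}_n)`. Letting `n → ∞` and
then `N → ∞` yields `a_n → t θ`; comparing consecutive `N` yields the absolute convergence of the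
series. Since the functions averaged along the orbit vary with `n`, Birkhoff's theorem is replaced
by Maker's, and a product of factors `1 - b/n` becomes an exponential.

Continuity of the exponent in `s` is not available in advance, so the limit law is found
differently. Telescoping forwards, `(n/M) ∫ (1 - e^{isS_{n,M}}) dμ` tends to the exponent when `n →
∞` first and `M → ∞` afterwards. Each such quantity has the form `∑ ρ(k) (1 - e^{isk})` with `ρ` of
uniformly bounded mean, so compactness exhibits the exponent in this form too, simultaneously on any
countable set of parameters; continuity of these sums extends it to all `s`. The associated compound
Poisson law is the limit, since bounded means give tightness and characteristic functions at
rational parameters identify laws on `ℕ`. -/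

/-! ### Pointwise ergodic theorems -/

section Birkhoff

variable {α : Type*} {T : α → α} {f : α → ℝ}

/-- The running maximum `max_{1 ≤ k ≤ n + 1} ∑_{j < k} f (T^j x)` of the Birkhoff sums. -/
def birkhoffMax (T : α → α) (f : α → ℝ) : ℕ → α → ℝ
  | 0, x => f x
  | n + 1, x => f x + max 0 (birkhoffMax T f n (T x))

theorem birkhoffMax_mono (x : α) : Monotone fun n => birkhoffMax T f n x := by
  refine monotone_nat_of_le_succ fun n => ?_
  induction n generalizing x with
  | zero => simp [birkhoffMax]
  | succ n ih =>
    simp only [birkhoffMax]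
    gcongr
    exact ih (T x)

theorem birkhoffSum_le_birkhoffMax (n : ℕ) (x : α) :
    birkhoffSum T f (n + 1) x ≤ birkhoffMax T f n x := by
  induction n generalizing x with
  | zero => simp [birkhoffMax]
  | succ n ih =>
    rw [birkhoffSum_succ']
    simp only [birkhoffMax]
    gcongr
    exact (ih (T x)).trans (le_max_right _ _)

variable [MeasurableSpace α] {μ : Measure α}

theorem measurable_birkhoffMax (hT : Measurable T) (hf : Measurable f) (n : ℕ) :
    Measurable (birkhoffMax T f n) := by
  induction n with
  | zero => exact hf
  | succ n ih => exact hf.add (measurable_const.max (ih.comp hT))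

theorem integrable_birkhoffMax (hT : MeasurePreserving T μ μ) (hf : Integrable f μ) (n : ℕ) :
    Integrable (birkhoffMax T f n) μ := by
  induction n with
  | zero => exact hf
  | succ n ih =>
    refine hf.add ?_
    have := (hT.integrable_comp_of_integrable ih).pos_part
    simpa [max_comm, Function.comp_def] using this

/-- The set where the running maxima `M_n` are unbounded is invariant, hence null or of full
measure. In the latter case `f + max 0 (-M_n ∘ T) = M_{n+1} - M_n ∘ T` has nonnegative integral by
monotonicity and converges to `f`, which contradicts the negative mean. -/
theorem Ergodic.ae_bddAbove_birkhoffMax [IsProbabilityMeasure μ] (hT : Ergodic T μ)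
    (hfm : Measurable f) (hf : Integrable f μ) (hneg : ∫ x, f x ∂μ < 0) :
    ∀ᵐ x ∂μ, ∃ K : ℕ, ∀ n, birkhoffMax T f n x ≤ K := by
  set A : Set α := {x | ∀ K : ℕ, ∃ n, (K : ℝ) < birkhoffMax T f n x} with hA
  have hM := fun n => measurable_birkhoffMax hT.measurable hfm n
  have hAm : MeasurableSet A := by
    have : A = ⋂ K : ℕ, ⋃ n, {x | (K : ℝ) < birkhoffMax T f n x} := by
      ext; simp [hA]
    rw [this]
    exact MeasurableSet.iInter fun K => MeasurableSet.iUnion fun n =>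
      measurableSet_lt measurable_const (hM n)
  have hinv : T ⁻¹' A = A := by
    ext x
    simp only [Set.mem_preimage, hA, Set.mem_ofPred_eq]
    constructor
    · intro h K
      obtain ⟨L, hL⟩ := exists_nat_gt (K - f x)
      obtain ⟨n, hn⟩ := h L
      refine ⟨n + 1, ?_⟩
      simp only [birkhoffMax]
      have := le_max_right 0 (birkhoffMax T f n (T x))
      linarith
    · intro h K
      obtain ⟨L, hL⟩ := exists_nat_gt (K + f x)
      obtain ⟨n, hn⟩ := h L
      have hn' := hn.trans_le (birkhoffMax_mono x (Nat.le_succ n))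
      simp only [birkhoffMax] at hn'
      refine ⟨n, ?_⟩
      have h1 : (K : ℝ) < max 0 (birkhoffMax T f n (T x)) := by linarith
      rcases lt_max_iff.1 h1 with h2 | h2
      · exact absurd h2 (not_lt.2 (Nat.cast_nonneg K))
      · exact h2
  rcases hT.ae_mem_or_ae_notMem hAm hinv with h | h
  · exfalso
    have hint := fun n => integrable_birkhoffMax hT.toMeasurePreserving hf n
    have hintT := fun n => hT.toMeasurePreserving.integrable_comp_of_integrable (hint n)
    have hnonneg : ∀ n, 0 ≤ ∫ x, (f x + max 0 (-birkhoffMax T f n (T x))) ∂μ := by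
      intro n
      have h1 : ∀ x, f x + max 0 (-birkhoffMax T f n (T x)) =
          birkhoffMax T f (n + 1) x - (birkhoffMax T f n ∘ T) x := by
        intro x
        simp only [birkhoffMax, Function.comp]
        rcases le_total 0 (birkhoffMax T f n (T x)) with h0 | h0
        · rw [max_eq_left (by linarith), max_eq_right h0]; ring
        · rw [max_eq_right (by linarith), max_eq_left h0]; ring
      simp_rw [h1]
      have h2 := integral_map (μ := μ) hT.measurable.aemeasurable
        (f := birkhoffMax T f n) (hM n).aestronglyMeasurable
      rw [hT.map_eq] at h2
      rw [integral_sub (hint _) (hintT n), Function.comp_def, ← h2]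
      rw [sub_nonneg]
      exact integral_mono (hint n) (hint (n + 1)) fun x => birkhoffMax_mono x (Nat.le_succ n)
    have hlim : Tendsto (fun n => ∫ x, (f x + max 0 (-birkhoffMax T f n (T x))) ∂μ) atTop
        (𝓝 (∫ x, f x ∂μ)) := by
      -- The maxima increase from `M_0 = f`, so the negative part of `M_n ∘ T` is at most `|f ∘ T|`.
      refine tendsto_integral_of_dominated_convergence (fun x => |f x| + |f (T x)|) ?_ ?_ ?_ ?_
      · intro n
        exact (hfm.add (measurable_const.max ((hM n).comp hT.measurable).neg)).aestronglyMeasurable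
      · exact hf.abs.add (hT.toMeasurePreserving.integrable_comp_of_integrable hf).abs
      · intro n
        filter_upwards with x
        rw [Real.norm_eq_abs]
        refine (abs_add_le _ _).trans (add_le_add le_rfl ?_)
        rw [abs_of_nonneg (le_max_left _ _)]
        refine max_le (abs_nonneg _) ?_
        have := birkhoffMax_mono (T := T) (f := f) (T x) (Nat.zero_le n)
        simp only [birkhoffMax] at this
        linarith [neg_abs_le (f (T x))]
      · filter_upwards [h] with x hx
        rw [← hinv] at hx
        obtain ⟨n, hn⟩ := hx 0
        refine tendsto_const_nhds.congr' ?_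
        filter_upwards [eventually_ge_atTop n] with k hk
        have := birkhoffMax_mono (T := T) (f := f) (T x) hk
        rw [max_eq_left (by simp at hn this; linarith), add_zero]
    exact absurd (ge_of_tendsto' hlim hnonneg) (not_le.2 hneg)
  · filter_upwards [h] with x hx
    simp only [hA, Set.mem_ofPred_eq, not_forall, not_exists, not_lt] at hx
    exact hx

/-- For `d` strictly between the mean and `c`, the function `f - d` has negative mean, so its
Birkhoff sums are bounded above and the averages of `f` exceed `d` by at most `O(1/n)`. -/
theorem Ergodic.ae_eventually_birkhoffAverage_lt [IsProbabilityMeasure μ] (hT : Ergodic T μ)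
    (hfm : Measurable f) (hf : Integrable f μ) {c : ℝ} (hc : ∫ x, f x ∂μ < c) :
    ∀ᵐ x ∂μ, ∀ᶠ n : ℕ in atTop, (∑ j ∈ Finset.range n, f (T^[j] x)) / n < c := by
  obtain ⟨d, hd, hdc⟩ := exists_between hc
  have h := hT.ae_bddAbove_birkhoffMax (f := fun x => f x - d) (hfm.sub_const d)
    (hf.sub (integrable_const d)) (by rw [integral_sub hf (integrable_const d)]; simpa using hd)
  filter_upwards [h] with x hx
  obtain ⟨K, hK⟩ := hx
  obtain ⟨N, hN⟩ := exists_nat_gt ((K : ℝ) / (c - d))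
  filter_upwards [eventually_ge_atTop (N + 1)] with n hn
  obtain ⟨k, rfl⟩ : ∃ k, n = k + 1 := ⟨n - 1, by omega⟩
  have h1 := (birkhoffSum_le_birkhoffMax (T := T) (f := fun x => f x - d) k x).trans (hK k)
  simp only [birkhoffSum, Finset.sum_sub_distrib, Finset.sum_const, Finset.card_range,
    nsmul_eq_mul] at h1
  have hpos : (0 : ℝ) < ((k + 1 : ℕ) : ℝ) := by positivity
  rw [div_lt_iff₀ hpos]
  rw [div_lt_iff₀ (by linarith)] at hN
  have h2 : (N : ℝ) ≤ ((k + 1 : ℕ) : ℝ) := by exact_mod_cast (by omega : N ≤ k + 1)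
  nlinarith [mul_le_mul_of_nonneg_right h2 (by linarith : (0 : ℝ) ≤ c - d)]

/-- Birkhoff's pointwise ergodic theorem for an ergodic map of a probability space. -/
theorem Ergodic.ae_tendsto_birkhoffAverage_real [IsProbabilityMeasure μ] (hT : Ergodic T μ)
    (hfm : Measurable f) (hf : Integrable f μ) :
    ∀ᵐ x ∂μ, Tendsto (fun n : ℕ => (∑ j ∈ Finset.range n, f (T^[j] x)) / n) atTop
      (𝓝 (∫ x, f x ∂μ)) := by
  have h1 : ∀ᵐ x ∂μ, ∀ k : ℕ, ∀ᶠ n : ℕ in atTop,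
      (∑ j ∈ Finset.range n, f (T^[j] x)) / n < ∫ x, f x ∂μ + 1 / ((k : ℝ) + 1) :=
    ae_all_iff.2 fun k => hT.ae_eventually_birkhoffAverage_lt hfm hf
      (lt_add_of_pos_right _ Nat.one_div_pos_of_nat)
  have h2 : ∀ᵐ x ∂μ, ∀ k : ℕ, ∀ᶠ n : ℕ in atTop,
      (∑ j ∈ Finset.range n, -f (T^[j] x)) / n < ∫ x, -f x ∂μ + 1 / ((k : ℝ) + 1) :=
    ae_all_iff.2 fun k => hT.ae_eventually_birkhoffAverage_lt hfm.neg hf.neg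
      (lt_add_of_pos_right _ Nat.one_div_pos_of_nat)
  filter_upwards [h1, h2] with x hx1 hx2
  rw [Metric.tendsto_nhds]
  intro ε hε
  obtain ⟨k, hk⟩ := exists_nat_one_div_lt hε
  filter_upwards [hx1 k, hx2 k] with n hn1 hn2
  rw [integral_neg, Finset.sum_neg_distrib, neg_div] at hn2
  rw [Real.dist_eq, abs_lt]
  constructor <;> linarith

theorem MeasureTheory.MeasurePreserving.ae_forall_iterate (hT : MeasurePreserving T μ μ)
    {p : α → Prop} (hp : ∀ᵐ x ∂μ, p x) : ∀ᵐ x ∂μ, ∀ j : ℕ, p (T^[j] x) :=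
  ae_all_iff.2 fun j => (hT.iterate j).quasiMeasurePreserving.ae hp

theorem Ergodic.ae_tendsto_birkhoffAverage_complex [IsProbabilityMeasure μ] (hT : Ergodic T μ)
    {g : α → ℂ} (hg : Integrable g μ) :
    ∀ᵐ x ∂μ, Tendsto (fun n : ℕ => (∑ j ∈ Finset.range n, g (T^[j] x)) / n) atTop
      (𝓝 (∫ x, g x ∂μ)) := by
  set g' := hg.1.mk g with hg'
  have hmk : g =ᵐ[μ] g' := hg.1.ae_eq_mk
  have hg'm : Measurable g' := hg.1.stronglyMeasurable_mk.measurable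
  have hg'i : Integrable g' μ := hg.congr hmk
  filter_upwards [hT.toMeasurePreserving.ae_forall_iterate hmk,
    hT.ae_tendsto_birkhoffAverage_real (f := fun x => (g' x).re)
      (Complex.measurable_re.comp hg'm) hg'i.re,
    hT.ae_tendsto_birkhoffAverage_real (f := fun x => (g' x).im)
      (Complex.measurable_im.comp hg'm) hg'i.im] with x hx hre him
  have key : ∀ n : ℕ, (∑ j ∈ Finset.range n, g (T^[j] x)) / (n : ℂ) =
      (((∑ j ∈ Finset.range n, (g' (T^[j] x)).re) / n : ℝ) : ℂ) +
      (((∑ j ∈ Finset.range n, (g' (T^[j] x)).im) / n : ℝ) : ℂ) * Complex.I := by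
    intro n
    push_cast
    rw [div_mul_eq_mul_div, ← add_div, Finset.sum_mul, ← Finset.sum_add_distrib]
    congr 1
    refine Finset.sum_congr rfl fun j _ => ?_
    rw [hx j, Complex.re_add_im]
  simp_rw [key]
  rw [integral_congr_ae hmk, ← integral_re_add_im hg'i]
  exact ((Complex.continuous_ofReal.tendsto _).comp hre).add
    (((Complex.continuous_ofReal.tendsto _).comp him).mul_const _)

/-- Maker's ergodic theorem for uniformly bounded sequences: Birkhoff averages
`n⁻¹ ∑_{j < n} b_n (T^j x)` of functions `b_n → b`. -/
theorem Ergodic.ae_tendsto_average_of_tendsto [IsProbabilityMeasure μ] (hT : Ergodic T μ)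
    {b : ℕ → α → ℂ} {b' : α → ℂ} {C : ℝ} (hb : ∀ n, Measurable (b n))
    (hC : ∀ᵐ x ∂μ, ∀ n, ‖b n x‖ ≤ C)
    (hlim : ∀ᵐ x ∂μ, Tendsto (fun n => b n x) atTop (𝓝 (b' x))) :
    Integrable b' μ ∧
    ∀ᵐ x ∂μ, Tendsto (fun n : ℕ => (∑ j ∈ Finset.range n, b n (T^[j] x)) / n) atTop
      (𝓝 (∫ x, b' x ∂μ)) := by
  have hb'm : AEStronglyMeasurable b' μ :=
    aestronglyMeasurable_of_tendsto_ae atTop (fun n => (hb n).aestronglyMeasurable) hlim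
  have hb'C : ∀ᵐ x ∂μ, ‖b' x‖ ≤ C := by
    filter_upwards [hC, hlim] with x hx hl
    exact le_of_tendsto' hl.norm hx
  have hb'i : Integrable b' μ := (integrable_const C).mono' hb'm hb'C
  refine ⟨hb'i, ?_⟩
  set g := hb'm.mk b'
  have hmk : b' =ᵐ[μ] g := hb'm.ae_eq_mk
  have hlim' : ∀ᵐ x ∂μ, Tendsto (fun n => b n x) atTop (𝓝 (g x)) := by
    filter_upwards [hlim, hmk] with x hx h; rwa [← h]
  -- Egorov: convergence is uniform off small sets `E k`. Inside `E k` only the bound `C` is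
  -- available, but the orbit spends a proportion `μ (E k)` of its time there.
  have hE : ∀ k : ℕ, ∃ E, MeasurableSet E ∧ μ E ≤ ENNReal.ofReal (1 / ((k : ℝ) + 1)) ∧
      TendstoUniformlyOn b g atTop Eᶜ := fun k =>
    tendstoUniformlyOn_of_ae_tendsto' (fun n => (hb n).stronglyMeasurable)
      hb'm.stronglyMeasurable_mk hlim' Nat.one_div_pos_of_nat
  choose E hEm hEμ hEu using hE
  have hind : ∀ᵐ x ∂μ, ∀ k, Tendsto (fun n : ℕ => (∑ j ∈ Finset.range n,
      (E k).indicator (fun _ => (1 : ℝ)) (T^[j] x)) / n) atTop (𝓝 (μ.real (E k))) := by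
    refine ae_all_iff.2 fun k => ?_
    have := hT.ae_tendsto_birkhoffAverage_real (f := (E k).indicator fun _ => (1 : ℝ))
      (measurable_const.indicator (hEm k)) ((integrable_const 1).indicator (hEm k))
    rwa [integral_indicator (hEm k), setIntegral_const, smul_eq_mul, mul_one] at this
  filter_upwards [hind, hT.ae_tendsto_birkhoffAverage_complex hb'i,
    hT.toMeasurePreserving.ae_forall_iterate hC, hT.toMeasurePreserving.ae_forall_iterate hb'C,
    hT.toMeasurePreserving.ae_forall_iterate hmk] with x hx1 hx2 hx3 hx4 hx5
  have hC0 : 0 ≤ C := (norm_nonneg _).trans (hx3 0 0)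
  have hdiff : Tendsto (fun n : ℕ => (∑ j ∈ Finset.range n, b n (T^[j] x)) / (n : ℂ) -
      (∑ j ∈ Finset.range n, b' (T^[j] x)) / (n : ℂ)) atTop (𝓝 0) := by
    rw [Metric.tendsto_nhds]
    intro ε hε
    -- Each visit to `E k` costs at most `2 * C`; this choice keeps the total cost below `ε / 2` on
    -- average, and the `+ 1` covers `C = 0`.
    obtain ⟨k, hk⟩ := exists_nat_one_div_lt (show 0 < ε / (2 * (2 * C + 1)) by positivity)
    have hμE : μ.real (E k) < ε / (2 * (2 * C + 1)) := by
      refine lt_of_le_of_lt ?_ hk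
      exact ENNReal.toReal_le_of_le_ofReal (by positivity) (hEμ k)
    have hunif := Metric.tendstoUniformlyOn_iff.1 (hEu k) (ε / 2) (by positivity)
    filter_upwards [hunif, (hx1 k).eventually_lt_const hμE, eventually_gt_atTop 0]
      with n hn1 hn2 hn0
    have hn : (0 : ℝ) < n := by exact_mod_cast hn0
    rw [dist_zero_right, ← sub_div, ← Finset.sum_sub_distrib, norm_div, Complex.norm_natCast,
      div_lt_iff₀ hn]
    have hterm : ∀ j, ‖b n (T^[j] x) - b' (T^[j] x)‖ ≤
        ε / 2 + 2 * C * (E k).indicator (fun _ => (1 : ℝ)) (T^[j] x) := by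
      intro j
      by_cases hj : T^[j] x ∈ E k
      · rw [Set.indicator_of_mem hj]
        have := (norm_sub_le (b n (T^[j] x)) (b' (T^[j] x))).trans
          (add_le_add (hx3 j n) (hx4 j))
        linarith
      · rw [Set.indicator_of_notMem hj, hx5 j, norm_sub_rev, ← dist_eq_norm]
        linarith [(hn1 (T^[j] x) hj).le]
    calc ‖∑ j ∈ Finset.range n, (b n (T^[j] x) - b' (T^[j] x))‖
        ≤ ∑ j ∈ Finset.range n,
          (ε / 2 + 2 * C * (E k).indicator (fun _ => (1 : ℝ)) (T^[j] x)) :=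
        norm_sum_le_of_le _ fun j _ => hterm j
      _ = n * (ε / 2) + 2 * C * ∑ j ∈ Finset.range n,
          (E k).indicator (fun _ => (1 : ℝ)) (T^[j] x) := by
        rw [Finset.sum_add_distrib, ← Finset.mul_sum]; simp
      _ ≤ n * (ε / 2) + 2 * C * (ε / (2 * (2 * C + 1)) * n) := by
        rw [div_lt_iff₀ hn] at hn2
        gcongr
      _ < ε * n := by
        have : 2 * C * (ε / (2 * (2 * C + 1))) < ε / 2 := by
          rw [← mul_div_assoc, div_lt_div_iff₀ (by positivity) (by norm_num)]
          nlinarith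
        nlinarith
  simpa using hdiff.add hx2

end Birkhoff

/-! ### Products of perturbations of `1` -/

/-- Induction on the number of factors: each new factor multiplies the old error by at most `e^δ`
and adds the second-order error `|1 + z - e^z| ≤ δ²`. -/
theorem norm_prod_one_add_sub_exp_sum_le (z : ℕ → ℂ) {δ : ℝ} (hδ1 : δ ≤ 1) (k : ℕ)
    (hz : ∀ j < k, ‖z j‖ ≤ δ) (hδ : 0 ≤ δ) :
    ‖∏ j ∈ Finset.range k, (1 + z j) - Complex.exp (∑ j ∈ Finset.range k, z j)‖ ≤
      k * δ ^ 2 * Real.exp (k * δ) := by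
  induction k with
  | zero => simp
  | succ k ih =>
    have ih := ih fun j hj => hz j (by omega)
    have hzk := hz k (by omega)
    rw [Finset.prod_range_succ, Finset.sum_range_succ, Complex.exp_add]
    set P := ∏ j ∈ Finset.range k, (1 + z j)
    set S := ∑ j ∈ Finset.range k, z j with hS
    have hSn : ‖S‖ ≤ k * δ := by
      refine (norm_sum_le_of_le _ fun j hj => hz j ?_).trans (by simp)
      have := Finset.mem_range.1 hj; omega
    have h1 : ‖1 + z k‖ ≤ Real.exp δ := by
      refine (norm_add_le _ _).trans ?_
      rw [norm_one, add_comm]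
      exact (add_le_add hzk le_rfl).trans (Real.add_one_le_exp δ)
    have h2 : ‖(1 + z k) - Complex.exp (z k)‖ ≤ δ ^ 2 := by
      have := Complex.norm_exp_sub_one_sub_id_le (hzk.trans hδ1)
      rw [norm_sub_rev, ← sub_sub]
      exact this.trans (by gcongr)
    have h3 : ‖Complex.exp S‖ ≤ Real.exp (k * δ) :=
      (Complex.norm_exp_le_exp_norm S).trans (Real.exp_le_exp.2 hSn)
    have h4 : P * (1 + z k) - Complex.exp S * Complex.exp (z k) =
        (P - Complex.exp S) * (1 + z k) + Complex.exp S * ((1 + z k) - Complex.exp (z k)) := by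
      ring
    rw [h4]
    calc _ ≤ ‖P - Complex.exp S‖ * ‖1 + z k‖ +
          ‖Complex.exp S‖ * ‖(1 + z k) - Complex.exp (z k)‖ := by
          refine (norm_add_le _ _).trans ?_
          rw [norm_mul, norm_mul]
      _ ≤ (k * δ ^ 2 * Real.exp (k * δ)) * Real.exp δ + Real.exp (k * δ) * δ ^ 2 := by gcongr
      _ ≤ (k * δ ^ 2 * Real.exp (k * δ)) * Real.exp δ + Real.exp (k * δ) * δ ^ 2 * Real.exp δ := by
          exact add_le_add le_rfl
            (le_mul_of_one_le_right (by positivity) (Real.one_le_exp hδ))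
      _ = _ := by
          push_cast
          rw [add_mul (k : ℝ) 1 δ, one_mul, Real.exp_add]
          ring

/-- With `δ = |B| / n`, replacing `n` factors by exponentials costs `n δ² e^{nδ} = |B|² e^{|B|} /
n`. -/
theorem tendsto_prod_one_sub_div {b : ℕ → ℕ → ℂ} {B : ℝ} {a : ℂ}
    (hb : ∀ᶠ n in atTop, ∀ j, ‖b n j‖ ≤ B)
    (ha : Tendsto (fun n : ℕ => (∑ j ∈ Finset.range n, b n j) / n) atTop (𝓝 a)) :
    Tendsto (fun n : ℕ => ∏ j ∈ Finset.range n, (1 - b n j / n)) atTop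
      (𝓝 (Complex.exp (-a))) := by
  have hexp : Tendsto (fun n : ℕ => Complex.exp (∑ j ∈ Finset.range n, -(b n j / n))) atTop
      (𝓝 (Complex.exp (-a))) := by
    refine ((Complex.continuous_exp.tendsto _).comp ha.neg).congr fun n => ?_
    simp only [Function.comp, Finset.sum_neg_distrib, Finset.sum_div]
  have h0 : Tendsto (fun n : ℕ => |B| ^ 2 * Real.exp |B| * (1 / (n : ℝ))) atTop (𝓝 0) := by
    have := (tendsto_one_div_atTop_nhds_zero_nat (𝕜 := ℝ)).const_mul (|B| ^ 2 * Real.exp |B|)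
    rwa [mul_zero] at this
  have hdiff : Tendsto (fun n : ℕ => ∏ j ∈ Finset.range n, (1 - b n j / n) -
      Complex.exp (∑ j ∈ Finset.range n, -(b n j / n))) atTop (𝓝 0) := by
    refine squeeze_zero_norm' ?_ h0
    obtain ⟨N, hN⟩ := exists_nat_ge |B|
    filter_upwards [hb, eventually_ge_atTop (N + 1)] with n hn hnN
    have hn0 : (0 : ℝ) < n := by exact_mod_cast (by omega : 0 < n)
    have hnN' : (N : ℝ) ≤ n := by exact_mod_cast (by omega : N ≤ n)
    have := norm_prod_one_add_sub_exp_sum_le (fun j => -(b n j / n)) (δ := |B| / n)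
      (by rw [div_le_one hn0]; exact hN.trans hnN') n (fun j _ => by
        rw [norm_neg, norm_div, Complex.norm_natCast]
        gcongr
        exact (hn j).trans (le_abs_self B)) (by positivity)
    simp only [← sub_eq_add_neg] at this
    refine this.trans (le_of_eq ?_)
    field_simp
  simpa using hdiff.add hexp

/-! ### Mass functions on `ℕ` with bounded mean -/

/-- `ρ` is a nonnegative mass function on `ℕ` with `∑ (k + 1) ρ k ≤ K`. -/
structure BoundedMean (K : ℝ) (ρ : ℕ → ℝ) : Prop where
  nonneg : ∀ k, 0 ≤ ρ k
  sum_le : ∀ L, ∑ k ∈ Finset.range L, ((k : ℝ) + 1) * ρ k ≤ K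

namespace BoundedMean

variable {K : ℝ} {ρ : ℕ → ℝ} {E : Type*} [NormedAddCommGroup E] [NormedSpace ℝ E]

theorem const_nonneg (h : BoundedMean K ρ) : 0 ≤ K := by simpa using h.sum_le 0

/-- Markov's inequality: the tails are controlled by `K` alone, uniformly over the class. -/
theorem sum_Ico_le (h : BoundedMean K ρ) (L M : ℕ) :
    ∑ k ∈ Finset.Ico L M, ρ k ≤ K / (L + 1) := by
  rw [le_div_iff₀ (by positivity), Finset.sum_mul]
  refine le_trans ?_ (h.sum_le M)
  refine (Finset.sum_le_sum fun k hk => ?_).trans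
    (Finset.sum_le_sum_of_subset_of_nonneg (s := Finset.Ico L M) ?_ fun k _ _ => ?_)
  · have : (L : ℝ) ≤ k := by exact_mod_cast (Finset.mem_Ico.1 hk).1
    rw [mul_comm]
    exact mul_le_mul_of_nonneg_right (by linarith) (h.nonneg k)
  · intro k hk
    exact Finset.mem_range.2 (Finset.mem_Ico.1 hk).2
  · exact mul_nonneg (by positivity) (h.nonneg k)

theorem le (h : BoundedMean K ρ) (k : ℕ) : ρ k ≤ K := by
  have h1 := h.sum_Ico_le k (k + 1)
  rw [Nat.Ico_succ_singleton, Finset.sum_singleton] at h1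
  exact h1.trans (div_le_self h.const_nonneg (by linarith [Nat.cast_nonneg (α := ℝ) k]))

theorem summable (h : BoundedMean K ρ) : Summable ρ :=
  summable_of_sum_range_le h.nonneg fun L => by
    have := h.sum_Ico_le 0 L
    simpa using this

theorem summable_smul [CompleteSpace E] (h : BoundedMean K ρ) {g : ℕ → E} {B : ℝ} (hg : ∀ k, ‖g k‖ ≤ B) :
    Summable fun k => ρ k • g k := by
  refine Summable.of_norm_bounded (h.summable.mul_right B) fun k => ?_
  rw [norm_smul, Real.norm_of_nonneg (h.nonneg k)]
  exact mul_le_mul_of_nonneg_left (hg k) (h.nonneg k)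

theorem norm_tsum_sub_sum_le [CompleteSpace E] (h : BoundedMean K ρ) {g : ℕ → E} {B : ℝ} (hg : ∀ k, ‖g k‖ ≤ B)
    (L : ℕ) : ‖∑' k, ρ k • g k - ∑ k ∈ Finset.range L, ρ k • g k‖ ≤ B * (K / (L + 1)) := by
  have hB : 0 ≤ B := (norm_nonneg _).trans (hg 0)
  have hlim := ((h.summable_smul hg).hasSum.tendsto_sum_nat.sub_const
    (∑ k ∈ Finset.range L, ρ k • g k)).norm
  refine le_of_tendsto hlim ?_
  filter_upwards [eventually_ge_atTop L] with M hM
  rw [← Finset.sum_Ico_eq_sub _ hM]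
  calc _ ≤ ∑ k ∈ Finset.Ico L M, B * ρ k := norm_sum_le_of_le _ fun k _ => by
        rw [norm_smul, Real.norm_of_nonneg (h.nonneg k), mul_comm]
        exact mul_le_mul_of_nonneg_right (hg k) (h.nonneg k)
    _ ≤ _ := by
        rw [← Finset.mul_sum]
        exact mul_le_mul_of_nonneg_left (h.sum_Ico_le L M) hB

/-- The defining inequalities each involve finitely many values, so they pass to pointwise limits.
-/
theorem of_tendsto {ι : Type*} {F : Filter ι} [F.NeBot] {r : ι → ℕ → ℝ}
    (hr : ∀ᶠ i in F, BoundedMean K (r i)) (hlim : ∀ k, Tendsto (fun i => r i k) F (𝓝 (ρ k))) :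
    BoundedMean K ρ where
  nonneg k := ge_of_tendsto (hlim k) (hr.mono fun _ hi => hi.nonneg k)
  sum_le L := le_of_tendsto (tendsto_finsetSum _ fun k _ => (hlim k).const_mul _)
    (hr.mono fun _ hi => hi.sum_le L)

/-- The uniform tail bound prevents mass from escaping to infinity, so pointwise convergence of
masses suffices for bounded test functions. -/
theorem tendsto_tsum [CompleteSpace E] {ι : Type*} {F : Filter ι} [F.NeBot] {r : ι → ℕ → ℝ}
    (hr : ∀ᶠ i in F, BoundedMean K (r i)) (hlim : ∀ k, Tendsto (fun i => r i k) F (𝓝 (ρ k)))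
    {g : ℕ → E} {B : ℝ} (hg : ∀ k, ‖g k‖ ≤ B) :
    Tendsto (fun i => ∑' k, r i k • g k) F (𝓝 (∑' k, ρ k • g k)) := by
  have hρ := of_tendsto hr hlim
  rw [Metric.tendsto_nhds]
  intro ε hε
  have htail : Tendsto (fun L : ℕ => B * (K / ((L : ℝ) + 1))) atTop (𝓝 0) := by
    have := (tendsto_one_div_add_atTop_nhds_zero_nat (𝕜 := ℝ)).const_mul (B * K)
    rw [mul_zero] at this
    exact this.congr fun L => by ring
  obtain ⟨L, hL⟩ := (htail.eventually_lt_const (show 0 < ε / 3 by positivity)).exists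
  have hsum : Tendsto (fun i => ∑ k ∈ Finset.range L, r i k • g k) F
      (𝓝 (∑ k ∈ Finset.range L, ρ k • g k)) :=
    tendsto_finsetSum _ fun k _ => (hlim k).smul_const _
  filter_upwards [hr, Metric.tendsto_nhds.1 hsum (ε / 3) (by positivity)] with i hi his
  have h1 := hi.norm_tsum_sub_sum_le hg L
  have h2 := hρ.norm_tsum_sub_sum_le hg L
  rw [← dist_eq_norm] at h1 h2
  have h3 := dist_triangle4 (∑' k, r i k • g k) (∑ k ∈ Finset.range L, r i k • g k)
    (∑ k ∈ Finset.range L, ρ k • g k) (∑' k, ρ k • g k)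
  rw [dist_comm (∑ k ∈ Finset.range L, ρ k • g k)] at h3
  linarith

/-- Every mass lies in the compact interval `[0, K]`; an ultrafilter makes all coordinates converge
at once, replacing a diagonal extraction. -/
theorem exists_tendsto_ultrafilter {ι : Type*} (U : Ultrafilter ι) {r : ι → ℕ → ℝ}
    (hr : ∀ᶠ i in U, BoundedMean K (r i)) :
    ∃ ρ', BoundedMean K ρ' ∧ ∀ k, Tendsto (fun i => r i k) U (𝓝 (ρ' k)) := by
  have h : ∀ k, ∃ x, Tendsto (fun i => r i k) U (𝓝 x) := by
    intro k
    obtain ⟨x, -, hx⟩ := (isCompact_Icc (a := (0 : ℝ)) (b := K)).ultrafilter_le_nhds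
      (U.map fun i => r i k) (by
        rw [le_principal_iff]
        exact hr.mono fun i hi => ⟨hi.nonneg k, hi.le k⟩)
    exact ⟨x, hx⟩
  choose ρ' hρ' using h
  exact ⟨ρ', of_tendsto hr hρ', hρ'⟩

/-- The measure on `ℕ` with mass function `ρ`. -/
noncomputable def toMeasure (ρ : ℕ → ℝ) : Measure ℕ :=
  Measure.sum fun k => ENNReal.ofReal (ρ k) • Measure.dirac k

theorem isFiniteMeasure_toMeasure (h : BoundedMean K ρ) : IsFiniteMeasure (toMeasure ρ) := by
  refine ⟨?_⟩
  rw [toMeasure, Measure.sum_apply _ MeasurableSet.univ]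
  simp only [Measure.smul_apply, measure_univ, smul_eq_mul, mul_one]
  rw [← ENNReal.ofReal_tsum_of_nonneg h.nonneg h.summable]
  exact ENNReal.ofReal_lt_top

theorem integral_toMeasure (h : BoundedMean K ρ) [FiniteDimensional ℝ E] (g : ℕ → E) :
    ∫ k, g k ∂(toMeasure ρ) = ∑' k, ρ k • g k := by
  rw [toMeasure, integral_sum_dirac (by simp)]
  congr with k
  rw [ENNReal.toReal_ofReal (h.nonneg k)]

end BoundedMean

/-! ### Characteristic functions on `ℕ`: uniqueness, convergence and compactness. -/

theorem Complex.norm_exp_I_mul_real_mul_nat (s : ℝ) (k : ℕ) :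
    ‖Complex.exp (Complex.I * s * k)‖ = 1 := by
  rw [show Complex.I * s * k = ((s * k : ℝ) : ℂ) * Complex.I by push_cast; ring,
    Complex.norm_exp_ofReal_mul_I]

theorem Complex.norm_one_sub_exp_I_mul_real_mul_nat_le (s : ℝ) (k : ℕ) :
    ‖1 - Complex.exp (Complex.I * s * k)‖ ≤ 2 := by
  refine (norm_sub_le _ _).trans ?_
  rw [Complex.norm_exp_I_mul_real_mul_nat, norm_one]; norm_num

theorem continuous_integral_exp_nat (P : Measure ℕ) [IsFiniteMeasure P] :
    Continuous fun s : ℝ => ∫ z, Complex.exp (Complex.I * s * (z : ℂ)) ∂P := by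
  refine continuous_of_dominated (bound := fun _ => 1) (fun s => by fun_prop) (fun s => ?_)
    (integrable_const 1) ?_
  · filter_upwards with z
    rw [Complex.norm_exp_I_mul_real_mul_nat]
  · filter_upwards with z
    fun_prop

/-- A finite measure on `ℕ` is determined by its characteristic function on `ℚ`. -/
theorem Measure.ext_of_integral_exp_nat {P P' : Measure ℕ} [IsFiniteMeasure P]
    [IsFiniteMeasure P']
    (h : ∀ q : ℚ, ∫ z, Complex.exp (Complex.I * (q : ℝ) * (z : ℂ)) ∂P =
      ∫ z, Complex.exp (Complex.I * (q : ℝ) * (z : ℂ)) ∂P') : P = P' := by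
  have hall : (fun s : ℝ => ∫ z, Complex.exp (Complex.I * s * (z : ℂ)) ∂P) =
      fun s : ℝ => ∫ z, Complex.exp (Complex.I * s * (z : ℂ)) ∂P' :=
    Continuous.ext_on (Rat.denseRange_cast (𝕜 := ℝ)) (continuous_integral_exp_nat P)
      (continuous_integral_exp_nat P') (by rintro _ ⟨q, rfl⟩; exact h q)
  have hmap : P.map (Nat.cast : ℕ → ℝ) = P'.map (Nat.cast : ℕ → ℝ) := by
    refine Measure.ext_of_charFun (funext fun s => ?_)
    rw [charFun_apply_real, charFun_apply_real, integral_map .of_discrete (by fun_prop),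
      integral_map .of_discrete (by fun_prop)]
    refine Eq.trans ?_ ((congrFun hall s).trans ?_)
    all_goals
      refine integral_congr_ae (Eventually.of_forall fun z => ?_)
      simp only
      congr 1
      push_cast
      ring
  have hinj : Function.Injective (Nat.cast : ℕ → ℝ) := Nat.cast_injective
  refine Measure.ext_of_singleton fun k => ?_
  have hk : (Nat.cast : ℕ → ℝ) ⁻¹' {(k : ℝ)} = {k} := by ext; simp
  rw [← hk, ← Measure.map_apply .of_discrete (measurableSet_singleton _), hmap,
    Measure.map_apply .of_discrete (measurableSet_singleton _)]

/-- Tightness and convergence of the characteristic functions on `ℚ` give convergence in law. -/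
theorem tendsto_tsum_of_tendsto_exp {K : ℝ} {P : Measure ℕ} [IsFiniteMeasure P] {r : ℕ → ℕ → ℝ}
    (hr : ∀ᶠ n in atTop, BoundedMean K (r n))
    (h : ∀ q : ℚ, Tendsto (fun n => ∑' k, r n k • Complex.exp (Complex.I * (q : ℝ) * k)) atTop
      (𝓝 (∫ z, Complex.exp (Complex.I * (q : ℝ) * (z : ℂ)) ∂P)))
    {E : Type*} [NormedAddCommGroup E] [NormedSpace ℝ E] [FiniteDimensional ℝ E] {g : ℕ → E}
    {B : ℝ} (hg : ∀ k, ‖g k‖ ≤ B) :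
    Tendsto (fun n => ∑' k, r n k • g k) atTop (𝓝 (∫ z, g z ∂P)) := by
  have := FiniteDimensional.complete ℝ E
  rw [tendsto_iff_ultrafilter]
  intro U hU
  obtain ⟨ρ, hρ, hlim⟩ := BoundedMean.exists_tendsto_ultrafilter U (hU hr)
  have := hρ.isFiniteMeasure_toMeasure
  -- Every ultrafilter limit has the prescribed characteristic function on `ℚ`, so the limit law
  -- does not depend on the ultrafilter.
  have hP : P = BoundedMean.toMeasure ρ := by
    refine Measure.ext_of_integral_exp_nat fun q => ?_
    rw [hρ.integral_toMeasure]
    exact tendsto_nhds_unique ((h q).mono_left hU)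
      (BoundedMean.tendsto_tsum (hU hr) hlim
        fun k => (Complex.norm_exp_I_mul_real_mul_nat q k).le)
  rw [hP, hρ.integral_toMeasure]
  exact BoundedMean.tendsto_tsum (hU hr) hlim hg

theorem continuous_tsum_smul_one_sub_exp {K : ℝ} {ρ : ℕ → ℝ} (h : BoundedMean K ρ) :
    Continuous fun s : ℝ => ∑' k, ρ k • (1 - Complex.exp (Complex.I * s * k)) := by
  refine continuous_tsum (u := fun k => ρ k * 2) (fun k => by fun_prop)
    (h.summable.mul_right 2) fun k s => ?_
  rw [norm_smul, Real.norm_of_nonneg (h.nonneg k)]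
  exact mul_le_mul_of_nonneg_left (Complex.norm_one_sub_exp_I_mul_real_mul_nat_le s k)
    (h.nonneg k)

/-- Limits of exponents of compound Poisson laws with bounded means are such exponents. -/
theorem exists_boundedMean_of_tendsto {ι : Type*} {F : Filter ι} [F.NeBot] {K : ℝ}
    {r : ι → ℕ → ℝ} (hr : ∀ᶠ i in F, BoundedMean K (r i)) {D : Set ℝ} {c : ℝ → ℂ}
    (hc : ∀ s ∈ D, Tendsto (fun i => ∑' k, r i k • (1 - Complex.exp (Complex.I * s * k))) F
      (𝓝 (c s))) :
    ∃ ρ, BoundedMean K ρ ∧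
      ∀ s ∈ D, c s = ∑' k, ρ k • (1 - Complex.exp (Complex.I * s * k)) := by
  -- A single ultrafilter is fixed before `s`, so the same `ρ` serves every `s ∈ D`.
  have hU := Ultrafilter.of_le F
  obtain ⟨ρ, hρ, hlim⟩ := BoundedMean.exists_tendsto_ultrafilter (Ultrafilter.of F) (hU hr)
  exact ⟨ρ, hρ, fun s hs => tendsto_nhds_unique ((hc s hs).mono_left hU)
    (BoundedMean.tendsto_tsum (hU hr) hlim
      fun k => Complex.norm_one_sub_exp_I_mul_real_mul_nat_le s k)⟩

/-! ### Compound Poisson laws -/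

theorem integral_exp_sum_infinitePi (Q : Measure ℕ) [IsProbabilityMeasure Q] (s : ℝ) (N : ℕ) :
    ∫ x : ℕ → ℕ, Complex.exp (Complex.I * s * ((∑ k ∈ Finset.range N, x k : ℕ) : ℂ))
      ∂(Measure.infinitePi fun _ => Q) =
    (∫ z, Complex.exp (Complex.I * s * (z : ℂ)) ∂Q) ^ N := by
  have hind : iIndepFun (fun (i : ℕ) (x : ℕ → ℕ) => x i) (Measure.infinitePi fun _ => Q) :=
    iIndepFun_infinitePi (X := fun _ => id) fun _ => measurable_id
  have hind' := hind.precomp (g := fun i : Fin N => (i : ℕ)) Fin.val_injective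
  have h := iIndepFun.integral_fun_prod_comp (𝕜 := ℂ)
    (X := fun (i : Fin N) (x : ℕ → ℕ) => x i)
    (f := fun _ (z : ℕ) => Complex.exp (Complex.I * s * (z : ℂ))) hind'
    (fun i => (measurable_pi_apply _).aemeasurable) (fun i => .of_discrete)
  have h1 : ∀ i : ℕ, ∫ x : ℕ → ℕ, Complex.exp (Complex.I * s * (x i : ℂ))
      ∂(Measure.infinitePi fun _ => Q) = ∫ z, Complex.exp (Complex.I * s * (z : ℂ)) ∂Q := by
    intro i
    have hp := measurePreserving_eval_infinitePi (fun _ : ℕ => Q) i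
    have hm := integral_map (μ := Measure.infinitePi fun _ : ℕ => Q) hp.measurable.aemeasurable
      (f := fun z : ℕ => Complex.exp (Complex.I * s * (z : ℂ))) .of_discrete
    rw [hp.map_eq] at hm
    exact hm.symm
  simp only [h1, Finset.prod_const, Finset.card_univ, Fintype.card_fin] at h
  rw [← h]
  refine integral_congr_ae (Eventually.of_forall fun x => ?_)
  simp only
  rw [← Complex.exp_sum, Finset.sum_range]
  push_cast
  rw [Finset.mul_sum]

/-- The law is realised on the product of a Poisson space and an infinite product of the normalised
jump law; conditioning on `N` gives `∑ e^{-r} (r φ)^N / N! = e^{r(φ - 1)}`, where `φ` is the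
characteristic function of a jump. -/
theorem exists_isCompoundPoisson {K : ℝ} {ρ : ℕ → ℝ} (h : BoundedMean K ρ) :
    ∃ P : Measure ℕ, IsProbabilityMeasure P ∧ IsCompoundPoisson P ∧
      ∀ s : ℝ, ∫ z, Complex.exp (Complex.I * s * (z : ℂ)) ∂P =
        Complex.exp (-∑' k, ρ k • (1 - Complex.exp (Complex.I * s * k))) := by
  set δ : ℕ → ℝ := fun k => if k = 0 then 1 else 0 with hδ
  have hδs : HasSum δ 1 := by
    simpa [hδ] using hasSum_ite_eq (0 : ℕ) (1 : ℝ)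
  -- The extra unit of mass sits at `0`. It makes the rate positive even for `ρ = 0` and leaves the
  -- exponent unchanged, because `1 - e^{is·0} = 0`.
  set r : ℝ := ∑' k, ρ k + 1 with hr
  have hr0 : 0 < r := by have : 0 ≤ ∑' k, ρ k := tsum_nonneg h.nonneg; positivity
  set q : ℕ → ℝ := fun k => r⁻¹ * (ρ k + δ k) with hq
  have hδ0 : ∀ k, 0 ≤ δ k := fun k => by simp only [hδ]; split_ifs <;> norm_num
  have hq0 : ∀ k, 0 ≤ q k := fun k =>
    mul_nonneg (inv_nonneg.2 hr0.le) (add_nonneg (h.nonneg k) (hδ0 k))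
  have hqs : HasSum q 1 := by
    have := (h.summable.hasSum.add hδs).mul_left r⁻¹
    rwa [← hr, inv_mul_cancel₀ hr0.ne'] at this
  set Q : Measure ℕ := BoundedMean.toMeasure q with hQ
  have : IsProbabilityMeasure Q := hqs.isProbabilityMeasure_sum_dirac hq0
  have hQint : ∀ s : ℝ, (r : ℂ) * ∫ z, Complex.exp (Complex.I * s * (z : ℂ)) ∂Q - r =
      -∑' k, ρ k • (1 - Complex.exp (Complex.I * s * k)) := by
    intro s
    have h1 : ∫ z, Complex.exp (Complex.I * s * (z : ℂ)) ∂Q =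
        ∑' k, q k • Complex.exp (Complex.I * s * (k : ℂ)) := by
      rw [hQ, BoundedMean.toMeasure, integral_sum_dirac (by simp)]
      congr with k
      rw [ENNReal.toReal_ofReal (hq0 k)]
    have hs1 := h.summable_smul fun k => (Complex.norm_exp_I_mul_real_mul_nat s k).le
    have hs2 : HasSum (fun k => δ k • Complex.exp (Complex.I * s * (k : ℂ))) 1 := by
      have := hasSum_ite_eq (0 : ℕ) (1 : ℂ)
      refine this.congr_fun fun k => ?_
      by_cases hk : k = 0 <;> simp [hδ, hk]
    have hs3 : HasSum (fun k => ((ρ k : ℝ) : ℂ)) ((∑' k, ρ k : ℝ) : ℂ) :=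
      Complex.hasSum_ofReal.2 h.summable.hasSum
    have h2 : HasSum (fun k => q k • Complex.exp (Complex.I * s * (k : ℂ)))
        ((r : ℂ)⁻¹ * (∑' k, ρ k • Complex.exp (Complex.I * s * (k : ℂ)) + 1)) := by
      refine ((hs1.hasSum.add hs2).mul_left (r : ℂ)⁻¹).congr_fun fun k => ?_
      simp only [hq, Complex.real_smul]
      push_cast
      ring
    have h3 : HasSum (fun k => ρ k • (1 - Complex.exp (Complex.I * s * (k : ℂ))))
        (((∑' k, ρ k : ℝ) : ℂ) - ∑' k, ρ k • Complex.exp (Complex.I * s * (k : ℂ))) := by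
      refine (hs3.sub hs1.hasSum).congr_fun fun k => ?_
      simp only [Complex.real_smul]
      ring
    rw [h1, h2.tsum_eq, h3.tsum_eq, mul_inv_cancel_left₀ (by exact_mod_cast hr0.ne'), hr]
    push_cast
    ring
  set r' : ℝ≥0 := ⟨r, hr0.le⟩ with hr'
  have hrr : (r' : ℝ) = r := rfl
  set Pr : Measure (ℕ × (ℕ → ℕ)) := (poissonMeasure r').prod (Measure.infinitePi fun _ => Q)
    with hPr
  have hmeas : Measurable fun γ : ℕ × (ℕ → ℕ) => ∑ k ∈ Finset.range γ.1, γ.2 k :=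
    measurable_from_prod_countable_right fun N =>
      Finset.measurable_sum (Finset.range N) fun k _ => measurable_pi_apply k
  have hid : ∀ i, Pr.map (fun γ => γ.2 i) = Q := by
    intro i
    have h1 := (measurePreserving_eval_infinitePi (fun _ : ℕ => Q) i).comp
      (measurePreserving_snd (μ := poissonMeasure r') (ν := Measure.infinitePi fun _ : ℕ => Q))
    exact h1.map_eq
  have : IsProbabilityMeasure (Pr.map fun γ => ∑ k ∈ Finset.range γ.1, γ.2 k) :=
    Measure.isProbabilityMeasure_map hmeas.aemeasurable
  refine ⟨Pr.map fun γ => ∑ k ∈ Finset.range γ.1, γ.2 k, inferInstance, ?_, ?_⟩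
  · refine ⟨ℕ × (ℕ → ℕ), inferInstance, Pr, r', Prod.fst, fun i γ => γ.2 i, inferInstance, hr0,
      measurable_fst, measurePreserving_fst.map_eq, fun i => by fun_prop, fun i => ?_, ?_, ?_,
      rfl⟩
    · exact ⟨by fun_prop, by fun_prop, by rw [hid, hid]⟩
    · rw [iIndepFun_iff_map_fun_eq_infinitePi_map fun i => by fun_prop]
      simp_rw [hid]
      exact measurePreserving_snd.map_eq
    · exact indepFun_prod (X := id) (Y := id) measurable_id measurable_id
  · intro s
    rw [integral_map hmeas.aemeasurable .of_discrete, hPr, integral_prod]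
    · simp only
      rw [integral_congr_ae (Eventually.of_forall fun N => integral_exp_sum_infinitePi Q s N),
        integral_poissonMeasure]
      set φ := ∫ z, Complex.exp (Complex.I * s * (z : ℂ)) ∂Q with hφ
      have h1 : ∀ N : ℕ, (Real.exp (-r') * (r' : ℝ) ^ N / (N.factorial : ℝ)) • φ ^ N =
          Complex.exp (-r) * ((r * φ) ^ N / N.factorial) := by
        intro N
        rw [hrr, Complex.real_smul]
        push_cast
        ring
      simp_rw [h1]
      rw [tsum_mul_left, (NormedSpace.expSeries_div_hasSum_exp ((r : ℂ) * φ)).tsum_eq,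
        ← Complex.exp_eq_exp_ℂ, ← Complex.exp_add, ← hQint s]
      congr 1
      ring
    · refine (integrable_const (1 : ℝ)).mono' ?_ (Eventually.of_forall fun γ => ?_)
      · exact ((measurable_of_countable fun z : ℕ =>
          Complex.exp (Complex.I * s * (z : ℂ))).comp hmeas).aestronglyMeasurable
      · rw [Complex.norm_exp_I_mul_real_mul_nat]

/-! ### Laws of integer valued functions -/

section Law

variable {X : Type*} [MeasurableSpace X] {ν : Measure X} [IsFiniteMeasure ν] {S : X → ℕ}

theorem integral_comp_nat_eq_tsum (hS : Measurable S) {E : Type*} [NormedAddCommGroup E]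
    [NormedSpace ℝ E] [CompleteSpace E] {g : ℕ → E} {B : ℝ} (hg : ∀ k, ‖g k‖ ≤ B) :
    ∫ x, g (S x) ∂ν = ∑' k, ν.real (S ⁻¹' {k}) • g k := by
  rw [← integral_map (f := g) hS.aemeasurable .of_discrete, integral_countable]
  · congr with k
    rw [measureReal_def, measureReal_def, Measure.map_apply hS (measurableSet_singleton k)]
  · exact (integrable_const B).mono' .of_discrete (Eventually.of_forall hg)

theorem sum_range_mul_law_le (hS : Measurable S) (hSi : Integrable (fun x => (S x : ℝ)) ν)
    (L : ℕ) :
    ∑ k ∈ Finset.range L, (k : ℝ) * ν.real (S ⁻¹' {k}) ≤ ∫ x, (S x : ℝ) ∂ν := by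
  have h1 : ∀ k : ℕ, (k : ℝ) * ν.real (S ⁻¹' {k}) =
      ∫ x, (S ⁻¹' {k}).indicator (fun _ => (k : ℝ)) x ∂ν := fun k => by
    rw [integral_indicator (hS (measurableSet_singleton k)), setIntegral_const, smul_eq_mul,
      mul_comm]
  have hi : ∀ k : ℕ, Integrable ((S ⁻¹' {k}).indicator fun _ => (k : ℝ)) ν := fun k =>
    (integrable_const _).indicator (hS (measurableSet_singleton k))
  simp_rw [h1]
  rw [← integral_finsetSum _ fun k _ => hi k]
  refine integral_mono (integrable_finsetSum _ fun k _ => hi k) hSi fun x => ?_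
  by_cases hx : S x < L
  · rw [Finset.sum_eq_single_of_mem (S x) (Finset.mem_range.2 hx)]
    · simp
    · intro k _ hk
      exact Set.indicator_of_notMem (s := S ⁻¹' {k})
        (fun h => hk (Set.mem_singleton_iff.1 h).symm) _
  · rw [Finset.sum_eq_zero]
    · simp
    · intro k hk
      refine Set.indicator_of_notMem (s := S ⁻¹' {k}) (fun h => hx ?_) _
      rw [Set.mem_singleton_iff.1 h]
      exact Finset.mem_range.1 hk

/-- The weight `k + 1` splits into total mass plus mean. -/
theorem boundedMean_law (hS : Measurable S) (hSi : Integrable (fun x => (S x : ℝ)) ν) {K : ℝ}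
    (hK : ν.real Set.univ + ∫ x, (S x : ℝ) ∂ν ≤ K) :
    BoundedMean K fun k => ν.real (S ⁻¹' {k}) where
  nonneg k := measureReal_nonneg
  sum_le L := by
    refine le_trans ?_ hK
    simp_rw [add_mul, one_mul, Finset.sum_add_distrib]
    rw [add_comm]
    refine add_le_add ?_ (sum_range_mul_law_le hS hSi L)
    rw [← measureReal_biUnion_finset]
    · exact measureReal_mono (Set.subset_univ _)
    · intro i _ j _ hij
      exact Set.disjoint_left.2 fun x hx hy => hij (hx.symm.trans hy)
    · exact fun k _ => hS (measurableSet_singleton k)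

/-- The atom at `0` is discarded because `c` may be large; on `k ≥ 1` the weight `k + 1` is at most
`2 k`, so the scaled mean alone controls everything. -/
theorem boundedMean_scaled_law (hS : Measurable S) (hSi : Integrable (fun x => (S x : ℝ)) ν)
    {K c : ℝ} (hc : 0 ≤ c) (hK : 2 * (c * ∫ x, (S x : ℝ) ∂ν) ≤ K) :
    BoundedMean K fun k => if k = 0 then 0 else c * ν.real (S ⁻¹' {k}) where
  nonneg k := by
    split_ifs
    · exact le_rfl
    · exact mul_nonneg hc measureReal_nonneg
  sum_le L := by
    refine le_trans ?_ hK
    refine le_trans ?_ (mul_le_mul_of_nonneg_left (mul_le_mul_of_nonneg_left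
      (sum_range_mul_law_le hS hSi L) hc) zero_le_two)
    rw [Finset.mul_sum, Finset.mul_sum]
    refine Finset.sum_le_sum fun k _ => ?_
    have h0 : 0 ≤ c * ν.real (S ⁻¹' {k}) := mul_nonneg hc measureReal_nonneg
    split_ifs with hk
    · simp [hk]
    · have : (1 : ℝ) ≤ k := by exact_mod_cast Nat.one_le_iff_ne_zero.2 hk
      nlinarith

theorem tsum_scaled_law (hS : Measurable S) {c B : ℝ} {g : ℕ → ℂ} (hg : ∀ k, ‖g k‖ ≤ B)
    (hg0 : g 0 = 0) :
    ∑' k, (if k = 0 then 0 else c * ν.real (S ⁻¹' {k})) • g k = c * ∫ x, g (S x) ∂ν := by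
  rw [integral_comp_nat_eq_tsum hS hg, ← tsum_mul_left]
  congr with k
  by_cases hk : k = 0
  · simp [hk, hg0]
  · simp only [hk, if_false, Complex.real_smul]
    push_cast
    ring

end Law

/-! ### Visits and multipliers -/

namespace RandomSystem

section Visits

variable {Ω M : Type*} [MeasurableSpace Ω] [MeasurableSpace M] (R : RandomSystem Ω M)

open Classical in
/-- The indicator function of the target `H n`. -/
noncomputable def hit (n : ℕ) (p : Bundle R.J) : ℂ := if p ∈ R.H n then 1 else 0

/-- The function `e^{i s S_{n,k}}` on the bundle. -/
noncomputable def expS (n k : ℕ) (s : ℝ) (p : Bundle R.J) : ℂ :=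
  Complex.exp (Complex.I * s * (R.visits n k p : ℂ))

/-- The factor `1 - e^{is}`. -/
noncomputable def _root_.oneSubExp (s : ℝ) : ℂ := 1 - Complex.exp (Complex.I * s)

theorem _root_.norm_oneSubExp_le (s : ℝ) : ‖oneSubExp s‖ ≤ 2 := by
  simpa [oneSubExp] using Complex.norm_one_sub_exp_I_mul_real_mul_nat_le s 1

theorem norm_hit_le (n : ℕ) (p : Bundle R.J) : ‖R.hit n p‖ ≤ 1 := by
  unfold hit; split_ifs <;> simp

theorem norm_expS (n k : ℕ) (s : ℝ) (p : Bundle R.J) : ‖R.expS n k s p‖ = 1 :=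
  Complex.norm_exp_I_mul_real_mul_nat s _

theorem visits_zero (n : ℕ) (p : Bundle R.J) : R.visits n 0 p = 0 := by simp [visits]

theorem visits_succ' (n k : ℕ) (p : Bundle R.J) :
    R.visits n (k + 1) p = R.visits n k (R.skew p) + R.visits n 1 p := by
  simp only [visits, Finset.sum_range_succ', Function.iterate_succ_apply, Finset.range_zero,
    Finset.sum_empty, zero_add, Function.iterate_zero, id_eq]
  rfl

theorem visits_le (n k : ℕ) (p : Bundle R.J) : R.visits n k p ≤ k := by
  classical
  refine (Finset.sum_le_card_nsmul _ _ 1 fun j _ => ?_).trans (by simp)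
  split_ifs <;> simp

theorem cast_visits (n k : ℕ) (p : Bundle R.J) :
    (R.visits n k p : ℂ) = ∑ j ∈ Finset.range k, R.hit n (R.skew^[j] p) := by
  simp [visits, hit]

theorem expS_zero (n : ℕ) (s : ℝ) (p : Bundle R.J) : R.expS n 0 s p = 1 := by
  simp [expS, visits_zero]

/-- On an indicator, `e^{is·1_H} = 1 - (1 - e^{is}) 1_H`; this linearises the exponential one visit
at a time. -/
theorem expS_succ (n k : ℕ) (s : ℝ) (p : Bundle R.J) :
    R.expS n (k + 1) s p = R.expS n k s p * (1 - oneSubExp s * R.hit n (R.skew^[k] p)) := by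
  unfold expS
  rw [cast_visits, Finset.sum_range_succ, ← cast_visits, mul_add, Complex.exp_add]
  congr 1
  unfold hit oneSubExp
  split_ifs <;> simp

theorem expS_one (n : ℕ) (s : ℝ) (p : Bundle R.J) :
    R.expS n 1 s p = 1 - oneSubExp s * R.hit n p := by
  rw [expS_succ, expS_zero]; simp

theorem expS_succ' (n k : ℕ) (s : ℝ) (p : Bundle R.J) :
    R.expS n (k + 1) s p = R.expS n 1 s p * R.expS n k s (R.skew p) := by
  unfold expS
  rw [visits_succ', ← Complex.exp_add]
  push_cast
  ring_nf

theorem norm_expS_sub_one_le (n k : ℕ) (s : ℝ) (p : Bundle R.J) :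
    ‖R.expS n k s p - 1‖ ≤ 2 * (R.visits n k p : ℝ) := by
  rcases Nat.eq_zero_or_pos (R.visits n k p) with h | h
  · simp [expS, h]
  · have h1 : (1 : ℝ) ≤ R.visits n k p := by exact_mod_cast h
    rw [norm_sub_rev]
    exact (Complex.norm_one_sub_exp_I_mul_real_mul_nat_le s _).trans (by linarith)

/-- `1 - e^{i s S_k}` telescopes along the orbit. -/
theorem one_sub_expS (n k : ℕ) (s : ℝ) (p : Bundle R.J) :
    1 - R.expS n k s p =
      ∑ j ∈ Finset.range k, oneSubExp s * (R.expS n j s p * R.hit n (R.skew^[j] p)) := by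
  induction k with
  | zero => simp [expS_zero]
  | succ k ih => rw [Finset.sum_range_succ, ← ih, expS_succ]; ring

/-- `1 - e^{i s S_N}` decomposed according to the last visits. -/
theorem one_sub_expS' (n N : ℕ) (s : ℝ) (p : Bundle R.J) :
    1 - R.expS n N s p = ∑ i ∈ Finset.range N, oneSubExp s *
      (R.hit n (R.skew^[N - 1 - i] p) * R.expS n i s (R.skew^[N - i] p)) := by
  induction N generalizing p with
  | zero => simp [expS_zero]
  | succ N ih =>
    -- The top summand `i = N` records a visit at time `0`; the others are the decomposition for the
    -- point `R.skew p`.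
    rw [Finset.sum_range_succ, expS_succ', expS_one]
    have h : ∀ i ∈ Finset.range N, oneSubExp s * (R.hit n (R.skew^[N + 1 - 1 - i] p) *
        R.expS n i s (R.skew^[N + 1 - i] p)) = oneSubExp s *
        (R.hit n (R.skew^[N - 1 - i] (R.skew p)) * R.expS n i s (R.skew^[N - i] (R.skew p))) := by
      intro i hi
      have := Finset.mem_range.1 hi
      rw [← Function.iterate_succ_apply, ← Function.iterate_succ_apply,
        show N + 1 - 1 - i = (N - 1 - i).succ by omega, show N + 1 - i = (N - i).succ by omega]
    rw [Finset.sum_congr rfl h, ← ih (R.skew p), show N + 1 - 1 - N = 0 by omega,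
      show N + 1 - N = 1 by omega]
    simp only [Function.iterate_zero, id_eq, Function.iterate_one]
    ring

/-- Multiplication by all `u ∘ T^j` preserves the Banach spaces. -/
def IsMult (u : Bundle R.J → ℂ) : Prop :=
  ∀ (j : ℕ) (ω : Ω), ∀ f ∈ (R.B ω).carrier,
    (fun x => f x * u (R.skew^[j] (Bundle.pt ω x))) ∈ (R.B ω).carrier

variable {R}

namespace IsMult

variable {u v : Bundle R.J → ℂ}

theorem mem (hu : R.IsMult u) {ω : Ω} {f : R.J ω → ℂ} (hf : f ∈ (R.B ω).carrier) :
    (fun x => f x * u (Bundle.pt ω x)) ∈ (R.B ω).carrier := hu 0 ω f hf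

theorem mul (hu : R.IsMult u) (hv : R.IsMult v) : R.IsMult fun p => u p * v p := by
  intro j ω f hf
  simpa only [mul_assoc] using hv j ω _ (hu j ω f hf)

theorem sub (hu : R.IsMult u) (hv : R.IsMult v) : R.IsMult fun p => u p - v p := by
  intro j ω f hf
  have := (R.B ω).carrier.sub_mem (hu j ω f hf) (hv j ω f hf)
  convert this using 1
  funext x
  simp only [Pi.sub_apply]
  ring

theorem const (c : ℂ) : R.IsMult fun _ => c := by
  intro j ω f hf
  have := (R.B ω).carrier.smul_mem c hf
  convert this using 1
  funext x
  simp only [Pi.smul_apply, smul_eq_mul]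
  ring

theorem comp_iterate (hu : R.IsMult u) (k : ℕ) : R.IsMult fun p => u (R.skew^[k] p) := by
  intro j ω f hf
  have := hu (k + j) ω f hf
  simpa only [Function.iterate_add_apply] using this

theorem comp_skew (hu : R.IsMult u) : R.IsMult fun p => u (R.skew p) := hu.comp_iterate 1

end IsMult

end Visits

end RandomSystem

/-! ### Target indicators as multipliers, and invariance of the fibre measures. -/

section Fibre

variable {Ω M : Type*} [MeasurableSpace Ω] [MeasurableSpace M] {m : Measure Ω}
  {R : RandomSystem Ω M}

namespace IsTargetFamily

open RandomSystem

/-- The spaces are only known to be stable under multiplication by `e^{isS_k}`. At `s = π` this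
factor is a sign, so `e^{iπS_{j+1}} e^{iπS_j} = 1 - 2 · 1_H ∘ T^j`, from which the indicator is
recovered linearly. -/
theorem isMult_hit (hT : IsTargetFamily m R) {n : ℕ} (hn : 1 ≤ n) : R.IsMult (R.hit n) := by
  intro j ω f hf
  have h1 := hT.expVisits_mem n hn j Real.pi ω _ (hT.expVisits_mem n hn (j + 1) Real.pi ω f hf)
  have hpi : oneSubExp Real.pi = 2 := by
    unfold oneSubExp
    rw [mul_comm, Complex.exp_pi_mul_I]
    norm_num
  have hsq : ∀ p, R.expS n j Real.pi p * R.expS n j Real.pi p = 1 := by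
    intro p
    unfold expS
    rw [← Complex.exp_add, ← Complex.exp_nat_mul_two_pi_mul_I (R.visits n j p)]
    congr 1
    ring
  have h2 := (R.B ω).carrier.smul_mem (1 / 2 : ℂ) ((R.B ω).carrier.sub_mem hf h1)
  convert h2 using 1
  funext x
  change f x * R.hit n _ = (1 / 2 : ℂ) * (f x - f x * R.expS n (j + 1) Real.pi (Bundle.pt ω x) *
    R.expS n j Real.pi (Bundle.pt ω x))
  rw [expS_succ, hpi]
  linear_combination (-(1 / 2) * f x * (1 - 2 * R.hit n (R.skew^[j] (Bundle.pt ω x)))) *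
    (-hsq (Bundle.pt ω x))

theorem isMult_expS (hT : IsTargetFamily m R) {n : ℕ} (hn : 1 ≤ n) (k : ℕ) (s : ℝ) :
    R.IsMult (R.expS n k s) := by
  induction k with
  | zero =>
    have : R.expS n 0 s = fun _ => 1 := funext fun p => R.expS_zero n s p
    rw [this]
    exact IsMult.const 1
  | succ k ih =>
    have : R.expS n (k + 1) s = fun p => R.expS n k s p *
        (1 - oneSubExp s * R.hit n (R.skew^[k] p)) := funext fun p => R.expS_succ n k s p
    rw [this]
    exact ih.mul ((IsMult.const 1).sub ((IsMult.const _).mul ((hT.isMult_hit hn).comp_iterate k)))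

end IsTargetFamily

/-! ### Identities for integrals over the fibres -/

theorem measurable_bundle_pt {J : Ω → Set M} (ω : Ω) :
    Measurable (Bundle.pt (J := J) ω) :=
  (measurable_const.prodMk measurable_subtype_coe).subtype_mk

namespace RandomSystem

/-- The properties of the unperturbed system over a typical `ω`. -/
structure GoodFibre (R : RandomSystem Ω M) (C₃ : ℝ) (ω : Ω) : Prop where
  prob : IsProbabilityMeasure (R.ν ω)
  prob_μ : IsProbabilityMeasure (R.μ ω)
  integrable : ∀ f ∈ (R.B ω).carrier, Integrable f (R.ν ω)
  eigenfunction : R.transfer ω (R.phi0C ω) = fun x => (R.lam0 ω : ℂ) * R.phi0C (R.σ ω) x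
  conformal : ∀ f ∈ (R.B ω).carrier,
    ∫ x, R.transfer ω f x ∂(R.ν (R.σ ω)) = (R.lam0 ω : ℂ) * ∫ x, f x ∂(R.ν ω)
  lower : ∀ x, C₃⁻¹ ≤ Bundle.fib R.phi0 ω x

/-- The properties of the perturbed system over a typical `ω`. -/
structure PerturbedFibre (D : SpectralData R) (n : ℕ) (s : ℝ) (ω : Ω) : Prop where
  eigenfunction : R.perturbed n s ω (Bundle.fib (D.phi n s) ω) =
      fun x => D.lam n s ω * Bundle.fib (D.phi n s) (R.σ ω) x
  normalised : ∫ x, Bundle.fib (D.phi n s) ω x ∂(R.ν ω) = 1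
  decomposition : ∀ (f : R.Fn ω) (x : R.J (R.σ ω)),
    (D.lam n s ω)⁻¹ * R.perturbed n s ω f.1 x =
      D.nu n s ω f * Bundle.fib (D.phi n s) (R.σ ω) x + (D.Q n s ω f).1 x
  kernel : ∀ f : R.Fn ω, D.nu n s (R.σ ω) (D.Q n s ω f) = 0

/-- A function of `T y` is constant on the preimages of a point and leaves the sum. -/
theorem transfer_mul_comp (ω : Ω) (f : R.J ω → ℂ) (u : R.J (R.σ ω) → ℂ) :
    R.transfer ω (fun x => f x * u (R.T ω x)) = fun y => R.transfer ω f y * u y := by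
  funext y
  unfold transfer
  rw [← tsum_mul_right]
  refine tsum_congr fun z => ?_
  simp only [z.2]
  ring

/-- Duality between composition and transfer. Conformality holds only on `B ω`, which is why `u` has
to be a multiplier. -/
theorem GoodFibre.integral_mul_comp_skew {C₃ : ℝ} {ω : Ω} (hG : R.GoodFibre C₃ ω)
    (hl : R.lam0 ω ≠ 0) {u : Bundle R.J → ℂ} (hu : R.IsMult u) {f : R.J ω → ℂ}
    (hf : f ∈ (R.B ω).carrier) :
    ∫ x, f x * u (R.skew (Bundle.pt ω x)) ∂(R.ν ω) =
      (R.lam0 ω : ℂ)⁻¹ * ∫ x, R.transfer ω f x * u (Bundle.pt (R.σ ω) x) ∂(R.ν (R.σ ω)) := by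
  have h := hG.conformal _ (hu.comp_skew.mem hf)
  have h1 := R.transfer_mul_comp ω f (fun y => u (Bundle.pt (R.σ ω) y))
  change R.transfer ω (fun x => f x * u (R.skew (Bundle.pt ω x))) = _ at h1
  rw [h1] at h
  rw [h, inv_mul_cancel_left₀ (by exact_mod_cast hl)]

theorem integral_μ (hφ : Measurable R.phi0) (hpos : ∀ p, 0 < R.phi0 p) (ω : Ω)
    (g : R.J ω → ℂ) : ∫ x, g x ∂(R.μ ω) = ∫ x, R.phi0C ω x * g x ∂(R.ν ω) := by
  have hm : Measurable fun x => (Bundle.fib R.phi0 ω x).toNNReal :=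
    (hφ.comp (measurable_bundle_pt ω)).real_toNNReal
  have h := integral_withDensity_eq_integral_smul (μ := R.ν ω) hm g
  refine h.trans (integral_congr_ae (Eventually.of_forall fun x => ?_))
  simp only [NNReal.smul_def, Complex.real_smul, phi0C]
  rw [Real.coe_toNNReal (Bundle.fib R.phi0 ω x) (hpos (Bundle.pt ω x)).le]

section Invariance

variable (hC : IsConformal m R) {C₃ : ℝ}
include hC

/-- Duality applied to `φ_0`, whose image under transfer is `λ_0 φ_0`: the measures `μ_ω` are
equivariant when tested on multipliers. -/
theorem GoodFibre.integral_comp_skew {ω : Ω} (hG : R.GoodFibre C₃ ω)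
    {u : Bundle R.J → ℂ} (hu : R.IsMult u) :
    ∫ x, u (R.skew (Bundle.pt ω x)) ∂(R.μ ω) =
      ∫ x, u (Bundle.pt (R.σ ω) x) ∂(R.μ (R.σ ω)) := by
  have hl := hC.lam0_ne_zero ω
  rw [integral_μ hC.measurable_phi0 hC.phi0_pos, integral_μ hC.measurable_phi0 hC.phi0_pos,
    hG.integral_mul_comp_skew hl hu (hC.phi0_mem ω), hG.eigenfunction]
  simp_rw [mul_assoc]
  rw [integral_const_mul, inv_mul_cancel_left₀ (by exact_mod_cast hl)]

theorem integral_comp_iterate_skew {ω : Ω} (hG : ∀ j : ℕ, R.GoodFibre C₃ (R.σ^[j] ω))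
    {u : Bundle R.J → ℂ} (hu : R.IsMult u) (N : ℕ) :
    ∫ x, u (R.skew^[N] (Bundle.pt ω x)) ∂(R.μ ω) =
      ∫ x, u (Bundle.pt (R.σ^[N] ω) x) ∂(R.μ (R.σ^[N] ω)) := by
  induction N generalizing ω with
  | zero => rfl
  | succ N ih =>
    have h1 := (hG 0).integral_comp_skew hC (hu.comp_iterate N)
    simp only [Function.iterate_succ_apply]
    exact h1.trans (ih fun j => hG (j + 1))

end Invariance

/-- The ratio `λ_{ω,n,s} / λ_{ω,0}`. -/
noncomputable def ratio (D : SpectralData R) (n : ℕ) (s : ℝ) (ω : Ω) : ℂ :=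
  D.lam n s ω / (R.lam0 ω : ℂ)

/-- The ratio `λ^N_{ω,n,s} / λ^N_{ω,0}`. -/
noncomputable def ratioProd (D : SpectralData R) (n : ℕ) (s : ℝ) (N : ℕ) (ω : Ω) : ℂ :=
  ∏ j ∈ Finset.range N, ratio D n s (R.σ^[j] ω)

theorem ratioProd_succ (D : SpectralData R) (n : ℕ) (s : ℝ) (N : ℕ) (ω : Ω) :
    ratioProd D n s (N + 1) ω = ratio D n s ω * ratioProd D n s N (R.σ ω) := by
  rw [ratioProd, Finset.prod_range_succ', mul_comm]
  rfl

/-- The integral of `f e^{i s S_{n,N}} (v ∘ T^N)` over the fibre of `ω`. -/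
noncomputable def twisted (R : RandomSystem Ω M) (v : Bundle R.J → ℂ) (n : ℕ) (s : ℝ) (N : ℕ)
    (ω : Ω) (f : R.J ω → ℂ) : ℂ :=
  ∫ x, f x * (R.expS n N s (Bundle.pt ω x) * v (R.skew^[N] (Bundle.pt ω x))) ∂(R.ν ω)

/-! ### Spectral splitting of the twisted integrals. -/

section Twisted

variable (hT : IsTargetFamily m R) (hlam0 : ∀ ω, R.lam0 ω ≠ 0)
  {C₃ : ℝ} {D : SpectralData R} {n : ℕ} (hn : 1 ≤ n) {s : ℝ}
  {v : Bundle R.J → ℂ} (hv : R.IsMult v)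
include hT hlam0 hn hv

/-- The first step of the orbit contributes `e^{is·1_H}`, which the perturbed operator absorbs; the
remaining factors are composed with `T` and pass through the transfer operator by duality. -/
theorem twisted_succ {ω : Ω} (hG : R.GoodFibre C₃ ω) (N : ℕ) {f : R.J ω → ℂ}
    (hf : f ∈ (R.B ω).carrier) :
    R.twisted v n s (N + 1) ω f =
      (R.lam0 ω : ℂ)⁻¹ * R.twisted v n s N (R.σ ω) (R.perturbed n s ω f) := by
  have hu : R.IsMult fun p => R.expS n N s p * v (R.skew^[N] p) :=
    (hT.isMult_expS hn N s).mul (hv.comp_iterate N)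
  have h := hG.integral_mul_comp_skew (hlam0 ω) hu ((hT.isMult_expS hn 1 s).mem hf)
  refine Eq.trans (integral_congr_ae (Eventually.of_forall fun x => ?_)) h
  simp only
  rw [expS_succ', Function.iterate_succ_apply]
  ring

theorem twisted_eigenfunction {ω : Ω} (hG : ∀ j : ℕ, R.GoodFibre C₃ (R.σ^[j] ω))
    (hP : ∀ j : ℕ, PerturbedFibre D n s (R.σ^[j] ω))
    (hphi : ∀ ω, Bundle.fib (D.phi n s) ω ∈ (R.B ω).carrier) (N : ℕ) :
    R.twisted v n s N ω (Bundle.fib (D.phi n s) ω) = ratioProd D n s N ω *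
      ∫ x, Bundle.fib (D.phi n s) (R.σ^[N] ω) x * v (Bundle.pt (R.σ^[N] ω) x)
        ∂(R.ν (R.σ^[N] ω)) := by
  induction N generalizing ω with
  | zero =>
    simp only [twisted, expS_zero, ratioProd, one_mul, Finset.range_zero, Finset.prod_empty]
    rfl
  | succ N ih =>
    have h1 := ih (ω := R.σ ω) (fun j => hG (j + 1)) (fun j => hP (j + 1))
    have hP0 : PerturbedFibre D n s ω := hP 0
    rw [twisted_succ hT hlam0 hn hv (ω := ω) (hG 0) N (hphi ω), hP0.eigenfunction, ratioProd_succ,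
      ratio, div_eq_inv_mul]
    change _ = _ * ∫ x, Bundle.fib (D.phi n s) (R.σ^[N] (R.σ ω)) x *
      v (Bundle.pt (R.σ^[N] (R.σ ω)) x) ∂(R.ν (R.σ^[N] (R.σ ω)))
    rw [mul_assoc _ _ (∫ x, _ ∂_), ← h1, mul_assoc]
    refine congrArg ((R.lam0 ω : ℂ)⁻¹ * ·) ?_
    unfold twisted
    rw [← integral_const_mul]
    simp_rw [mul_assoc]

variable (hlam : ∀ ω, D.lam n s ω ≠ 0)
include hlam

theorem twisted_succ_decomposition {ω : Ω} (hG : R.GoodFibre C₃ ω)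
    (hG' : R.GoodFibre C₃ (R.σ ω)) (hP : PerturbedFibre D n s ω)
    (hphi : ∀ ω, Bundle.fib (D.phi n s) ω ∈ (R.B ω).carrier) (N : ℕ) (f : R.Fn ω) :
    R.twisted v n s (N + 1) ω f.1 = ratio D n s ω *
      (D.nu n s ω f * R.twisted v n s N (R.σ ω) (Bundle.fib (D.phi n s) (R.σ ω)) +
        R.twisted v n s N (R.σ ω) (D.Q n s ω f).1) := by
  rw [twisted_succ hT hlam0 hn hv hG N f.2]
  have hu : R.IsMult fun p => R.expS n N s p * v (R.skew^[N] p) :=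
    (hT.isMult_expS hn N s).mul (hv.comp_iterate N)
  have h1 : R.perturbed n s ω f.1 = fun x => D.lam n s ω *
      (D.nu n s ω f * Bundle.fib (D.phi n s) (R.σ ω) x + (D.Q n s ω f).1 x) := by
    funext x
    rw [← hP.decomposition f x, mul_inv_cancel_left₀ (hlam ω)]
  rw [h1, ratio, div_eq_inv_mul, mul_assoc]
  congr 1
  unfold twisted
  rw [← integral_const_mul, ← integral_add, ← integral_const_mul]
  · refine integral_congr_ae (Eventually.of_forall fun x => ?_)
    simp only
    ring
  · exact (hG'.integrable _ (hu.mem (hphi _))).const_mul _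
  · exact hG'.integrable _ (hu.mem (D.Q n s ω f).2)

/-- The range of `Q` lies in the kernel of `ν_{n,s}`, so the leading term vanishes again at every
step and only the iterates of `Q` survive. -/
theorem twisted_of_nu_eq_zero {ω : Ω} (hG : ∀ j : ℕ, R.GoodFibre C₃ (R.σ^[j] ω))
    (hP : ∀ j : ℕ, PerturbedFibre D n s (R.σ^[j] ω))
    (hphi : ∀ ω, Bundle.fib (D.phi n s) ω ∈ (R.B ω).carrier) (N : ℕ) (f : R.Fn ω)
    (hf : D.nu n s ω f = 0) :
    R.twisted v n s N ω f.1 = ratioProd D n s N ω *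
      ∫ x, (R.iter (D.Q n s) N ω f).1 x * v (Bundle.pt (R.σ^[N] ω) x) ∂(R.ν (R.σ^[N] ω)) := by
  induction N generalizing ω with
  | zero =>
    simp only [twisted, expS_zero, ratioProd, one_mul, Finset.range_zero, Finset.prod_empty]
    rfl
  | succ N ih =>
    have h1 := ih (ω := R.σ ω) (fun j => hG (j + 1)) (fun j => hP (j + 1)) (D.Q n s ω f)
      ((hP 0).kernel f)
    rw [twisted_succ_decomposition hT hlam0 hn hv hlam (ω := ω) (hG 0) (hG 1) (hP 0) hphi, hf, zero_mul,
      zero_add, h1, ratioProd_succ, mul_assoc]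
    rfl

/-- The spectral decomposition of the twisted integrals. -/
theorem twisted_eq {ω : Ω} (hG : ∀ j : ℕ, R.GoodFibre C₃ (R.σ^[j] ω))
    (hP : ∀ j : ℕ, PerturbedFibre D n s (R.σ^[j] ω))
    (hphi : ∀ ω, Bundle.fib (D.phi n s) ω ∈ (R.B ω).carrier) {N : ℕ} (hN : 1 ≤ N)
    (f : R.Fn ω) :
    R.twisted v n s N ω f.1 = ratioProd D n s N ω *
      (D.nu n s ω f * ∫ x, Bundle.fib (D.phi n s) (R.σ^[N] ω) x * v (Bundle.pt (R.σ^[N] ω) x)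
        ∂(R.ν (R.σ^[N] ω)) +
      ∫ x, (R.iter (D.Q n s) N ω f).1 x * v (Bundle.pt (R.σ^[N] ω) x)
        ∂(R.ν (R.σ^[N] ω))) := by
  obtain ⟨N, rfl⟩ : ∃ k, N = k + 1 := ⟨N - 1, by omega⟩
  -- One step splits off the eigenfunction; the two parts then evolve separately, the first by the
  -- eigenvalues and the second under `Q`.
  rw [twisted_succ_decomposition hT hlam0 hn hv hlam (ω := ω) (hG 0) (hG 1) (hP 0) hphi,
    twisted_eigenfunction hT hlam0 hn hv (ω := R.σ ω) (fun j => hG (j + 1))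
      (fun j => hP (j + 1)) hphi,
    twisted_of_nu_eq_zero hT hlam0 hn hv hlam (ω := R.σ ω) (fun j => hG (j + 1))
      (fun j => hP (j + 1)) hphi N (D.Q n s ω f) ((hP 0).kernel f), ratioProd_succ]
  change _ = ratio D n s ω * ratioProd D n s N (R.σ ω) * (D.nu n s ω f *
    ∫ x, Bundle.fib (D.phi n s) (R.σ^[N] (R.σ ω)) x *
      v (Bundle.pt (R.σ^[N] (R.σ ω)) x) ∂(R.ν (R.σ^[N] (R.σ ω))) +
    ∫ x, (R.iter (D.Q n s) N (R.σ ω) (D.Q n s ω f)).1 x * v (Bundle.pt (R.σ^[N] (R.σ ω)) x)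
        ∂(R.ν (R.σ^[N] (R.σ ω))))
  ring

end Twisted

/-- Evaluate `ν_0(L_{n,s} φ_{n,s}) / λ_0` twice: the eigenvalue equation and the normalisation over
`σ ω` give the ratio, while conformality gives the integral of `φ_{n,s} e^{is·1_H}`, which the
normalisation over `ω` simplifies. -/
theorem ratio_eq (hT : IsTargetFamily m R) (hlam0 : ∀ ω, R.lam0 ω ≠ 0)
    {C₃ : ℝ} {D : SpectralData R} {n : ℕ} (hn : 1 ≤ n) {s : ℝ}
    (hphi : ∀ ω, Bundle.fib (D.phi n s) ω ∈ (R.B ω).carrier) {ω : Ω} (hG : R.GoodFibre C₃ ω)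
    (hP : PerturbedFibre D n s ω) (hP' : PerturbedFibre D n s (R.σ ω)) :
    ratio D n s ω = 1 - oneSubExp s *
      ∫ x, Bundle.fib (D.phi n s) ω x * R.hit n (Bundle.pt ω x) ∂(R.ν ω) := by
  have h := twisted_succ hT hlam0 hn (s := s) (v := fun _ => 1) (IsMult.const 1) hG 0 (hphi ω)
  rw [hP.eigenfunction] at h
  simp only [twisted, expS_zero, mul_one, expS_one, zero_add] at h
  rw [integral_const_mul, hP'.normalised, mul_one, ← div_eq_inv_mul] at h
  rw [ratio, ← h]
  have h1 : ∀ x, Bundle.fib (D.phi n s) ω x * (1 - oneSubExp s * R.hit n (Bundle.pt ω x)) =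
      Bundle.fib (D.phi n s) ω x -
        oneSubExp s * (Bundle.fib (D.phi n s) ω x * R.hit n (Bundle.pt ω x)) := fun x => by ring
  simp_rw [h1]
  rw [integral_sub (hG.integrable _ (hphi ω))
    ((hG.integrable _ ((hT.isMult_hit hn).mem (hphi ω))).const_mul _), hP.normalised,
    integral_const_mul]

end RandomSystem

end Fibre

/-! ### Limits over a typical fibre -/

section Limits

variable {Ω M : Type*} [MeasurableSpace Ω] [MeasurableSpace M] {m : Measure Ω}
  {R : RandomSystem Ω M}

namespace RandomSystem

/-- The conditions that do not involve a point of the base, for a fixed parameter `s` and with a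
fixed threshold `n₀`. -/
structure LimitSetting (m : Measure Ω) (R : RandomSystem Ω M) (D : SpectralData R) (s : ℝ)
    (C₂ C₃ : ℝ) (α : ℕ → ℝ) (n₀ : ℕ) : Prop where
  targets : IsTargetFamily m R
  conformal : IsConformal m R
  measurable_skew : Measurable R.skew
  one_mem : ∀ ω, (fun _ => (1 : ℂ)) ∈ (R.B ω).carrier
  one_le : 1 ≤ n₀
  lam_ne_zero : ∀ n ≥ n₀, ∀ ω, D.lam n s ω ≠ 0
  phi_mem : ∀ n ≥ n₀, ∀ ω, Bundle.fib (D.phi n s) ω ∈ (R.B ω).carrier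
  one_le_C₂ : 1 ≤ C₂
  one_le_C₃ : 1 ≤ C₃
  α_pos : ∀ N, 0 < α N
  α_summable : Summable α

/-- The conditions over a typical point of the base. -/
structure GoodAt (D : SpectralData R) (s : ℝ) (C₂ C₃ K : ℝ) (α : ℕ → ℝ) (n₀ : ℕ) (ω : Ω) :
    Prop where
  fibre : R.GoodFibre C₃ ω
  perturbed : ∀ n ≥ n₀, PerturbedFibre D n s ω
  iter_le : ∀ n ≥ n₀, ∀ N ≥ 1, ∀ f : R.Fn ω, ∀ᵐ x ∂(R.ν (R.σ^[N] ω)),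
    ‖(R.iter (D.Q n s) N ω f).1 x‖ ≤ α N * (R.B ω).nrm f
  nrm_phi0_le : ∀ f : R.Fn ω, f.1 = R.phi0C ω → (R.B ω).nrm f ≤ C₂
  phi_le : ∀ n ≥ n₀, ∀ᵐ x ∂(R.ν ω), ‖Bundle.fib (D.phi n s) ω x‖ ≤ C₂
  target_le : ∀ n : ℕ, 1 ≤ n → (n : ℝ) * (R.μ ω).real (R.target n ω) ≤ K

/-! ### Measurability and size of targets and visit counts. -/

theorem measurableSet_target (hT : IsTargetFamily m R) {n : ℕ} (hn : 1 ≤ n) (ω : Ω) :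
    MeasurableSet (R.target n ω) :=
  (measurable_bundle_pt ω) (hT.measurable_H n hn)

theorem measurable_hit (hT : IsTargetFamily m R) {n : ℕ} (hn : 1 ≤ n) : Measurable (R.hit n) :=
  Measurable.ite (hT.measurable_H n hn) measurable_const measurable_const

theorem measurable_visits (hT : IsTargetFamily m R) (hs : Measurable R.skew) {n : ℕ}
    (hn : 1 ≤ n) (k : ℕ) : Measurable (R.visits n k) := by
  classical
  refine Finset.measurable_sum _ fun j _ => ?_
  exact Measurable.ite ((hs.iterate j) (hT.measurable_H n hn)) measurable_const measurable_const

theorem hit_pt (n : ℕ) (ω : Ω) (x : R.J ω) :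
    R.hit n (Bundle.pt ω x) = (R.target n ω).indicator (fun _ => (1 : ℂ)) x := by
  classical
  rw [Set.indicator_apply]
  unfold hit target
  simp only [Set.mem_ofPred_eq]

theorem integral_hit (hT : IsTargetFamily m R) {n : ℕ} (hn : 1 ≤ n) (ω : Ω)
    (μ' : Measure (R.J ω)) :
    ∫ x, R.hit n (Bundle.pt ω x) ∂μ' = (μ'.real (R.target n ω) : ℂ) := by
  simp_rw [hit_pt]
  rw [integral_indicator (measurableSet_target hT hn ω), setIntegral_const]
  simp

theorem norm_integral_mul_hit_le (hT : IsTargetFamily m R) {n : ℕ} (hn : 1 ≤ n) {ω : Ω}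
    {ν' : Measure (R.J ω)} [IsFiniteMeasure ν'] {f : R.J ω → ℂ} {C : ℝ}
    (hf : ∀ᵐ x ∂ν', ‖f x‖ ≤ C) :
    ‖∫ x, f x * R.hit n (Bundle.pt ω x) ∂ν'‖ ≤ C * ν'.real (R.target n ω) := by
  have h1 : ∀ x, f x * R.hit n (Bundle.pt ω x) = (R.target n ω).indicator f x := by
    intro x
    rw [hit_pt]
    by_cases hx : x ∈ R.target n ω <;> simp [hx]
  simp_rw [h1]
  rw [integral_indicator (measurableSet_target hT hn ω)]
  exact norm_setIntegral_le_of_norm_le_const_ae (measure_lt_top _ _)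
    (ae_restrict_of_ae (hf.mono fun x hx => hx))

/-- The lower bound on `φ_0` in (C7) transfers every `O(1/n)` estimate from `μ`, where scaling and
invariance hold, to `ν`. -/
theorem GoodFibre.ν_le {C₃ : ℝ} (hφ : Measurable R.phi0) (h3 : 1 ≤ C₃) {ω : Ω}
    (hG : R.GoodFibre C₃ ω) : R.ν ω ≤ ENNReal.ofReal C₃ • R.μ ω := by
  have hm : Measurable fun x => ENNReal.ofReal (Bundle.fib R.phi0 ω x) :=
    (hφ.comp (measurable_bundle_pt ω)).ennreal_ofReal
  have h1 : R.ν ω = (R.ν ω).withDensity 1 := withDensity_one.symm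
  rw [μ, ← withDensity_smul _ hm]
  nth_rw 1 [h1]
  refine withDensity_mono (Eventually.of_forall fun x => ?_)
  simp only [Pi.one_apply, Pi.smul_apply, smul_eq_mul]
  rw [← ENNReal.ofReal_mul (by linarith), ← ENNReal.ofReal_one]
  refine ENNReal.ofReal_le_ofReal ?_
  have := mul_le_mul_of_nonneg_left (hG.lower x) (show (0 : ℝ) ≤ C₃ by linarith)
  rwa [mul_inv_cancel₀ (by linarith)] at this

theorem GoodFibre.integral_ν_le {C₃ : ℝ} (hφ : Measurable R.phi0) (h3 : 1 ≤ C₃) {ω : Ω}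
    (hG : R.GoodFibre C₃ ω) {g : R.J ω → ℝ} (hg0 : ∀ x, 0 ≤ g x) (hg : Integrable g (R.μ ω)) :
    ∫ x, g x ∂(R.ν ω) ≤ C₃ * ∫ x, g x ∂(R.μ ω) := by
  have h := integral_mono_measure (hG.ν_le hφ h3) (Eventually.of_forall hg0)
    (hg.smul_measure ENNReal.ofReal_ne_top)
  rwa [integral_smul_measure, ENNReal.toReal_ofReal (by linarith), smul_eq_mul] at h

theorem integrable_visits (hT : IsTargetFamily m R) (hs : Measurable R.skew) {n : ℕ}
    (hn : 1 ≤ n) (k : ℕ) (ω : Ω) (ν' : Measure (R.J ω)) [IsFiniteMeasure ν'] :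
    Integrable (fun x => (R.visits n k (Bundle.pt ω x) : ℝ)) ν' := by
  refine (integrable_const (k : ℝ)).mono' ?_ (Eventually.of_forall fun x => ?_)
  · exact ((measurable_of_countable (Nat.cast : ℕ → ℝ)).comp
      ((measurable_visits hT hs hn k).comp (measurable_bundle_pt ω))).aestronglyMeasurable
  · rw [Real.norm_of_nonneg (Nat.cast_nonneg _)]
    exact_mod_cast R.visits_le n k _

theorem integrable_of_norm_le {ω : Ω} (ν' : Measure (R.J ω)) [IsFiniteMeasure ν']
    {u : Bundle R.J → ℂ} (hu : Measurable u) {C : ℝ} (hC : ∀ p, ‖u p‖ ≤ C) :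
    Integrable (fun x => u (Bundle.pt ω x)) ν' :=
  (integrable_const C).mono' (hu.comp (measurable_bundle_pt ω)).aestronglyMeasurable
    (Eventually.of_forall fun _ => hC _)

section

variable {D : SpectralData R} {s C₂ C₃ K : ℝ} {α : ℕ → ℝ} {n₀ : ℕ}

theorem GoodAt.K_nonneg {ω : Ω} (hG : GoodAt D s C₂ C₃ K α n₀ ω) : 0 ≤ K := by
  have := hG.target_le 1 le_rfl
  exact le_trans (by positivity) this

theorem norm_integral_iter_le {ω : Ω}
    (hG : ∀ j : ℕ, GoodAt D s C₂ C₃ K α n₀ (R.σ^[j] ω)) {n : ℕ} (hn : n₀ ≤ n) {N : ℕ}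
    (hN : 1 ≤ N) (f : R.Fn ω) :
    ‖∫ x, (R.iter (D.Q n s) N ω f).1 x ∂(R.ν (R.σ^[N] ω))‖ ≤ α N * (R.B ω).nrm f := by
  have := (hG N).fibre.prob
  have hG0 : GoodAt D s C₂ C₃ K α n₀ ω := hG 0
  have h := norm_integral_le_of_norm_le_const (hG0.iter_le n hn N hN f)
  simpa using h

variable (hL : LimitSetting m R D s C₂ C₃ α n₀)
include hL

theorem LimitSetting.measurable_expS {n : ℕ} (hn : 1 ≤ n) (k : ℕ) (s : ℝ) :
    Measurable (R.expS n k s) :=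
  (measurable_of_countable fun z : ℕ => Complex.exp (Complex.I * s * (z : ℂ))).comp
    (measurable_visits hL.targets hL.measurable_skew hn k)

theorem GoodAt.ν_target_le {ω : Ω} (hG : GoodAt D s C₂ C₃ K α n₀ ω) {n : ℕ} (hn : 1 ≤ n) :
    (n : ℝ) * (R.ν ω).real (R.target n ω) ≤ C₃ * K := by
  have := hG.fibre.prob_μ
  have h3 : (0 : ℝ) ≤ C₃ := by linarith [hL.one_le_C₃]
  have h := hG.fibre.ν_le hL.conformal.measurable_phi0 hL.one_le_C₃ (R.target n ω)
  have h1 : (R.ν ω).real (R.target n ω) ≤ C₃ * (R.μ ω).real (R.target n ω) := by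
    have h2 := ENNReal.toReal_mono (by
      rw [Measure.smul_apply, smul_eq_mul]
      exact ENNReal.mul_ne_top ENNReal.ofReal_ne_top (measure_ne_top _ _)) h
    rwa [Measure.smul_apply, smul_eq_mul, ENNReal.toReal_mul, ENNReal.toReal_ofReal h3] at h2
  calc (n : ℝ) * (R.ν ω).real (R.target n ω)
      ≤ n * (C₃ * (R.μ ω).real (R.target n ω)) := by gcongr
    _ = C₃ * (n * (R.μ ω).real (R.target n ω)) := by ring
    _ ≤ C₃ * K := by gcongr; exact hG.target_le n hn

theorem LimitSetting.integral_visits {ω : Ω} (hG : ∀ j : ℕ, R.GoodFibre C₃ (R.σ^[j] ω))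
    {n : ℕ} (hn : 1 ≤ n) (k : ℕ) :
    ∫ x, (R.visits n k (Bundle.pt ω x) : ℝ) ∂(R.μ ω) =
      ∑ j ∈ Finset.range k, (R.μ (R.σ^[j] ω)).real (R.target n (R.σ^[j] ω)) := by
  have : IsProbabilityMeasure (R.μ ω) := (hG 0).prob_μ
  have h : ((∫ x, (R.visits n k (Bundle.pt ω x) : ℝ) ∂(R.μ ω) : ℝ) : ℂ) =
      ((∑ j ∈ Finset.range k, (R.μ (R.σ^[j] ω)).real (R.target n (R.σ^[j] ω)) : ℝ) : ℂ) := by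
    rw [← integral_complex_ofReal]
    simp only [Complex.ofReal_natCast, cast_visits]
    rw [integral_finsetSum]
    · push_cast
      refine Finset.sum_congr rfl fun j _ => ?_
      rw [integral_comp_iterate_skew hL.conformal hG (hL.targets.isMult_hit hn) j,
        integral_hit hL.targets hn]
    · exact fun j _ => integrable_of_norm_le _
        ((measurable_hit hL.targets hn).comp (hL.measurable_skew.iterate j))
        (fun p => R.norm_hit_le n _)
  exact_mod_cast h

theorem LimitSetting.mean_visits_le {ω : Ω} (hG : ∀ j : ℕ, GoodAt D s C₂ C₃ K α n₀ (R.σ^[j] ω))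
    {n : ℕ} (hn : 1 ≤ n) (k : ℕ) :
    (n : ℝ) * ∫ x, (R.visits n k (Bundle.pt ω x) : ℝ) ∂(R.μ ω) ≤ k * K := by
  rw [hL.integral_visits (fun j => (hG j).fibre) hn, Finset.mul_sum]
  exact (Finset.sum_le_sum fun j _ => (hG j).target_le n hn).trans (by simp)

theorem LimitSetting.mean_visits_ν_le {ω : Ω}
    (hG : ∀ j : ℕ, GoodAt D s C₂ C₃ K α n₀ (R.σ^[j] ω)) {n : ℕ} (hn : 1 ≤ n) (k : ℕ) :
    (n : ℝ) * ∫ x, (R.visits n k (Bundle.pt ω x) : ℝ) ∂(R.ν ω) ≤ C₃ * (k * K) := by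
  have : IsProbabilityMeasure (R.μ ω) := (hG 0).fibre.prob_μ
  have hG0 : R.GoodFibre C₃ ω := (hG 0).fibre
  have h := hG0.integral_ν_le hL.conformal.measurable_phi0 hL.one_le_C₃
    (g := fun x => (R.visits n k (Bundle.pt ω x) : ℝ)) (fun x => Nat.cast_nonneg _)
    (integrable_visits hL.targets hL.measurable_skew hn k ω (R.μ ω))
  have h3 : (0 : ℝ) ≤ C₃ := by linarith [hL.one_le_C₃]
  calc _ ≤ (n : ℝ) * (C₃ * ∫ x, (R.visits n k (Bundle.pt ω x) : ℝ) ∂(R.μ ω)) := by gcongr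
    _ = C₃ * (n * ∫ x, (R.visits n k (Bundle.pt ω x) : ℝ) ∂(R.μ ω)) := by ring
    _ ≤ _ := mul_le_mul_of_nonneg_left (hL.mean_visits_le hG hn k) h3

/-- For a fixed number of steps `k` the expected number of visits is `O(1/n)`, and it dominates the
distance of `e^{isS_k}` from `1`. -/
theorem LimitSetting.tendsto_integral_expS {ω : Ω} (ν' : Measure (R.J ω))
    [IsProbabilityMeasure ν'] {C : ℝ} (k : ℕ)
    (hC : ∀ n : ℕ, 1 ≤ n → (n : ℝ) * ∫ x, (R.visits n k (Bundle.pt ω x) : ℝ) ∂ν' ≤ C) :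
    Tendsto (fun n => ∫ x, R.expS n k s (Bundle.pt ω x) ∂ν') atTop (𝓝 1) := by
  rw [tendsto_iff_norm_sub_tendsto_zero]
  refine squeeze_zero' (Eventually.of_forall fun n => norm_nonneg _) ?_
    (tendsto_const_div_atTop_nhds_zero_nat (2 * C))
  filter_upwards [eventually_ge_atTop 1] with n hn
  have hn0 : (0 : ℝ) < n := by exact_mod_cast hn
  have hi := integrable_of_norm_le ν' (hL.measurable_expS hn k s)
    (fun p => (R.norm_expS n k s p).le)
  have h1 : ∫ x, R.expS n k s (Bundle.pt ω x) ∂ν' - 1 =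
      ∫ x, (R.expS n k s (Bundle.pt ω x) - 1) ∂ν' := by
    rw [integral_sub hi (integrable_const 1)]
    simp
  rw [h1, le_div_iff₀ hn0]
  have h2 := norm_integral_le_of_norm_le
    ((integrable_visits hL.targets hL.measurable_skew hn k ω ν').const_mul 2)
    (Eventually.of_forall fun x => R.norm_expS_sub_one_le n k s (Bundle.pt ω x))
  rw [integral_const_mul] at h2
  nlinarith [hC n hn, mul_le_mul_of_nonneg_right h2 hn0.le]

theorem LimitSetting.twisted_phi0 (v : Bundle R.J → ℂ) (n N : ℕ) (ω : Ω) :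
    R.twisted v n s N ω (R.phi0C ω) =
      ∫ x, R.expS n N s (Bundle.pt ω x) * v (R.skew^[N] (Bundle.pt ω x)) ∂(R.μ ω) := by
  rw [integral_μ hL.conformal.measurable_phi0 hL.conformal.phi0_pos]
  rfl

/-- `n` times the integral of `1_{H_n} φ_n`. -/
noncomputable def _root_.RandomSystem.scaledMass (D : SpectralData R) (s : ℝ) (n : ℕ) (ω : Ω) :
    ℂ :=
  n * ∫ x, Bundle.fib (D.phi n s) ω x * R.hit n (Bundle.pt ω x) ∂(R.ν ω)

theorem LimitSetting.norm_scaledMass_le {ω : Ω} (hG : GoodAt D s C₂ C₃ K α n₀ ω) {n : ℕ}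
    (hn : n₀ ≤ n) : ‖scaledMass D s n ω‖ ≤ C₂ * (C₃ * K) := by
  have := hG.fibre.prob
  have hn1 : 1 ≤ n := hL.one_le.trans hn
  have h2 : (0 : ℝ) ≤ C₂ := by linarith [hL.one_le_C₂]
  rw [scaledMass, norm_mul, Complex.norm_natCast]
  have h := norm_integral_mul_hit_le hL.targets hn1 (hG.phi_le n hn)
  calc _ ≤ (n : ℝ) * (C₂ * (R.ν ω).real (R.target n ω)) := by gcongr
    _ = C₂ * (n * (R.ν ω).real (R.target n ω)) := by ring
    _ ≤ _ := mul_le_mul_of_nonneg_left (hG.ν_target_le hL hn1) h2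

theorem LimitSetting.ratio_eq_scaledMass {ω : Ω} (hG : GoodAt D s C₂ C₃ K α n₀ ω)
    (hG' : GoodAt D s C₂ C₃ K α n₀ (R.σ ω)) {n : ℕ} (hn : n₀ ≤ n) :
    ratio D n s ω = 1 - oneSubExp s * scaledMass D s n ω / n := by
  have hn1 : 1 ≤ n := hL.one_le.trans hn
  have hn0 : (n : ℂ) ≠ 0 := by exact_mod_cast (by omega : n ≠ 0)
  rw [ratio_eq hL.targets hL.conformal.lam0_ne_zero hn1 (hL.phi_mem n hn) hG.fibre
    (hG.perturbed n hn) (hG'.perturbed n hn), scaledMass]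
  field_simp

theorem LimitSetting.tendsto_ratio {ω : Ω} (hG : GoodAt D s C₂ C₃ K α n₀ ω)
    (hG' : GoodAt D s C₂ C₃ K α n₀ (R.σ ω)) :
    Tendsto (fun n => ratio D n s ω) atTop (𝓝 1) := by
  rw [tendsto_iff_norm_sub_tendsto_zero]
  refine squeeze_zero' (Eventually.of_forall fun n => norm_nonneg _) ?_
    (tendsto_const_div_atTop_nhds_zero_nat (2 * (C₂ * (C₃ * K))))
  filter_upwards [eventually_ge_atTop n₀] with n hn
  rw [hL.ratio_eq_scaledMass hG hG' hn, sub_sub_cancel_left, norm_neg, norm_div, norm_mul,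
    Complex.norm_natCast]
  gcongr
  · exact norm_oneSubExp_le s
  · exact hL.norm_scaledMass_le hG hn

theorem LimitSetting.tendsto_ratioProd {ω : Ω}
    (hG : ∀ j : ℕ, GoodAt D s C₂ C₃ K α n₀ (R.σ^[j] ω)) (N : ℕ) :
    Tendsto (fun n => ratioProd D n s N ω) atTop (𝓝 1) := by
  have h := tendsto_finsetProd (Finset.range N) fun j _ =>
    hL.tendsto_ratio (hG j) (by simpa only [Function.iterate_succ_apply'] using hG (j + 1))
  simp only [Finset.prod_const_one] at h
  exact h

theorem LimitSetting.ratioProd_ne_zero {n : ℕ} (hn : n₀ ≤ n) (N : ℕ) (ω : Ω) :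
    ratioProd D n s N ω ≠ 0 :=
  Finset.prod_ne_zero_iff.2 fun _ _ => div_ne_zero (hL.lam_ne_zero n hn _)
    (by exact_mod_cast hL.conformal.lam0_ne_zero _)

theorem LimitSetting.twisted_one_eq {ω : Ω}
    (hG : ∀ j : ℕ, GoodAt D s C₂ C₃ K α n₀ (R.σ^[j] ω)) {n : ℕ} (hn : n₀ ≤ n) {N : ℕ}
    (hN : 1 ≤ N) (f : R.Fn ω) :
    R.twisted (fun _ => 1) n s N ω f.1 = ratioProd D n s N ω *
      (D.nu n s ω f + ∫ x, (R.iter (D.Q n s) N ω f).1 x ∂(R.ν (R.σ^[N] ω))) := by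
  have h := twisted_eq hL.targets hL.conformal.lam0_ne_zero (hL.one_le.trans hn)
    (v := fun _ => 1) (IsMult.const 1) (hL.lam_ne_zero n hn) (fun j => (hG j).fibre)
    (fun j => (hG j).perturbed n hn) (hL.phi_mem n hn) hN f
  simp only [mul_one] at h
  rw [h, ((hG N).perturbed n hn).normalised, mul_one]

/-- For fixed `N`, divide the splitting with `v = 1` by the product of ratios, which tends to `1`:
`ν_{n,s}(f)` differs from a quantity converging to `c` by at most `α(N)` times the norm of `f`. Then
`N` is taken large. This identifies the functionals in the limit by integrals over boundedly many
steps. -/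
theorem LimitSetting.tendsto_nu {ω : Ω}
    (hG : ∀ j : ℕ, GoodAt D s C₂ C₃ K α n₀ (R.σ^[j] ω)) (f : R.Fn ω) {c : ℂ}
    (hf : ∀ k, Tendsto (fun n => R.twisted (fun _ => 1) n s k ω f.1) atTop (𝓝 c)) :
    Tendsto (fun n => D.nu n s ω f) atTop (𝓝 c) := by
  rw [Metric.tendsto_nhds]
  intro ε hε
  have hα : Tendsto (fun N => α N * (R.B ω).nrm f) atTop (𝓝 0) := by
    simpa using hL.α_summable.tendsto_atTop_zero.mul_const ((R.B ω).nrm f)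
  obtain ⟨N, hN1, hN⟩ := ((eventually_ge_atTop 1).and
    (hα.eventually_lt_const (show 0 < ε / 2 by positivity))).exists
  have hq := (hf N).div (hL.tendsto_ratioProd hG N) one_ne_zero
  rw [div_one] at hq
  filter_upwards [Metric.tendsto_nhds.1 hq (ε / 2) (by positivity), eventually_ge_atTop n₀]
    with n hn hn0
  rw [Pi.div_apply, hL.twisted_one_eq hG hn0 hN1,
    mul_div_cancel_left₀ _ (hL.ratioProd_ne_zero hn0 N ω)] at hn
  have h1 := norm_integral_iter_le hG hn0 hN1 f
  set z := ∫ x, (R.iter (D.Q n s) N ω f).1 x ∂(R.ν (R.σ^[N] ω))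
  rw [dist_eq_norm] at hn ⊢
  calc ‖D.nu n s ω f - c‖ = ‖(D.nu n s ω f + z - c) - z‖ := by ring_nf
    _ ≤ ‖D.nu n s ω f + z - c‖ + ‖z‖ := norm_sub_le _ _
    _ < ε := by linarith

/-- The bound on `Q^N` is uniform in `n`, so the splitting may be used with `N = n`. -/
theorem LimitSetting.tendsto_twisted_diagonal {ω : Ω}
    (hG : ∀ j : ℕ, GoodAt D s C₂ C₃ K α n₀ (R.σ^[j] ω)) (f : R.Fn ω) {c e : ℂ}
    (hf : ∀ k, Tendsto (fun n => R.twisted (fun _ => 1) n s k ω f.1) atTop (𝓝 c))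
    (he : Tendsto (fun n => ratioProd D n s n ω) atTop (𝓝 e)) :
    Tendsto (fun n => R.twisted (fun _ => 1) n s n ω f.1) atTop (𝓝 (e * c)) := by
  have hQ : Tendsto (fun n => ∫ x, (R.iter (D.Q n s) n ω f).1 x ∂(R.ν (R.σ^[n] ω))) atTop
      (𝓝 0) := by
    refine squeeze_zero_norm' (a := fun n => α n * (R.B ω).nrm f) ?_ ?_
    · filter_upwards [eventually_ge_atTop n₀] with n hn
      exact norm_integral_iter_le hG hn (hL.one_le.trans hn) f
    · simpa using hL.α_summable.tendsto_atTop_zero.mul_const ((R.B ω).nrm f)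
  have h := he.mul ((hL.tendsto_nu hG f hf).add hQ)
  rw [add_zero] at h
  refine h.congr' ?_
  filter_upwards [eventually_ge_atTop n₀] with n hn
  rw [hL.twisted_one_eq hG hn (hL.one_le.trans hn)]

theorem LimitSetting.tendsto_twisted_phi0 {ω : Ω}
    (hG : ∀ j : ℕ, GoodAt D s C₂ C₃ K α n₀ (R.σ^[j] ω)) (k : ℕ) :
    Tendsto (fun n => R.twisted (fun _ => 1) n s k ω (R.phi0C ω)) atTop (𝓝 1) := by
  have : IsProbabilityMeasure (R.μ ω) := (hG 0).fibre.prob_μ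
  simp_rw [hL.twisted_phi0, mul_one]
  exact hL.tendsto_integral_expS (R.μ ω) k fun n hn => hL.mean_visits_le hG hn k

theorem LimitSetting.tendsto_twisted_one {ω : Ω}
    (hG : ∀ j : ℕ, GoodAt D s C₂ C₃ K α n₀ (R.σ^[j] ω)) (k : ℕ) :
    Tendsto (fun n => R.twisted (fun _ => 1) n s k ω (fun _ => 1)) atTop (𝓝 1) := by
  have : IsProbabilityMeasure (R.ν ω) := (hG 0).fibre.prob
  simp only [twisted, mul_one, one_mul]
  exact hL.tendsto_integral_expS (R.ν ω) k fun n hn => hL.mean_visits_ν_le hG hn k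

/-- `n` times the integral of `e^{i s S_N} 1_{H_n} ∘ T^N`. -/
noncomputable def _root_.RandomSystem.delayedMass (R : RandomSystem Ω M) (s : ℝ) (n N : ℕ)
    (ω : Ω) : ℂ :=
  n * ∫ x, R.expS n N s (Bundle.pt ω x) * R.hit n (R.skew^[N] (Bundle.pt ω x)) ∂(R.μ ω)

/-- Splitting with `f = φ_0` and `v = 1_{H_n}` gives `delayedMass = r (ν_{n,s}(φ_0) a_n + n q)`,
where `r` is the product of `N` ratios and `a_n` is `scaledMass` over `σ^N ω`. For fixed `N` both
`r` and `ν_{n,s}(φ_0)` tend to `1`. The first error is eventually below `α N`, which is positive,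
and the second is at most `2 |n q|` once `|r| < 2`. -/
theorem LimitSetting.eventually_norm_scaledMass_sub_le {ω : Ω}
    (hG : ∀ j : ℕ, GoodAt D s C₂ C₃ K α n₀ (R.σ^[j] ω)) {N : ℕ} (hN : 1 ≤ N) :
    ∀ᶠ n in atTop, ‖scaledMass D s n (R.σ^[N] ω) - R.delayedMass s n N ω‖ ≤
      α N * (1 + 2 * (C₂ * (C₃ * K))) := by
  set φ : R.Fn ω := ⟨R.phi0C ω, hL.conformal.phi0_mem ω⟩ with hφ
  have hG0 : GoodAt D s C₂ C₃ K α n₀ ω := hG 0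
  have hK : 0 ≤ K := hG0.K_nonneg
  have h2 : (0 : ℝ) ≤ C₂ := by linarith [hL.one_le_C₂]
  have h3 : (0 : ℝ) ≤ C₃ := by linarith [hL.one_le_C₃]
  set B := C₂ * (C₃ * K) with hB
  have hB0 : 0 ≤ B := by positivity
  have hα := hL.α_pos N
  have hr := hL.tendsto_ratioProd hG N
  have hν := hL.tendsto_nu hG φ (hL.tendsto_twisted_phi0 hG)
  have hrν : Tendsto (fun n => B * ‖1 - ratioProd D n s N ω * D.nu n s ω φ‖) atTop (𝓝 0) := by
    have := ((hr.mul hν).const_sub 1).norm.const_mul B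
    simpa using this
  have hr2 : ∀ᶠ n in atTop, ‖ratioProd D n s N ω‖ < 2 :=
    hr.norm.eventually_lt_const (by simp)
  filter_upwards [hrν.eventually_lt_const hα, hr2, eventually_ge_atTop n₀] with n hn1 hn2 hn
  have hn1' : 1 ≤ n := hL.one_le.trans hn
  have := (hG N).fibre.prob
  have heq := twisted_eq hL.targets hL.conformal.lam0_ne_zero hn1'
    (v := R.hit n) (hL.targets.isMult_hit hn1') (hL.lam_ne_zero n hn) (fun j => (hG j).fibre)
    (fun j => (hG j).perturbed n hn) (hL.phi_mem n hn) hN φ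
  have hQ := norm_integral_mul_hit_le hL.targets hn1' (hG0.iter_le n hn N hN φ)
  set q := ∫ x, (R.iter (D.Q n s) N ω φ).1 x * R.hit n (Bundle.pt (R.σ^[N] ω) x)
    ∂(R.ν (R.σ^[N] ω)) with hq
  -- The factor `n` is compensated by the measure of the target; this is where the decay of `Q^N` is
  -- needed in the supremum norm.
  have hQ' : ‖(n : ℂ) * q‖ ≤ α N * B := by
    rw [norm_mul, Complex.norm_natCast]
    calc (n : ℝ) * ‖q‖ ≤ n * (α N * C₂ * (R.ν (R.σ^[N] ω)).real (R.target n (R.σ^[N] ω))) := by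
          gcongr
          refine hQ.trans ?_
          gcongr
          exact hG0.nrm_phi0_le φ rfl
      _ = α N * (C₂ * (n * (R.ν (R.σ^[N] ω)).real (R.target n (R.σ^[N] ω)))) := by ring
      _ ≤ α N * (C₂ * (C₃ * K)) := mul_le_mul_of_nonneg_left
          (mul_le_mul_of_nonneg_left ((hG N).ν_target_le hL hn1') h2) hα.le
  have hE : R.delayedMass s n N ω = ratioProd D n s N ω *
      (D.nu n s ω φ * scaledMass D s n (R.σ^[N] ω) + n * q) := by
    rw [delayedMass, ← hL.twisted_phi0, scaledMass]
    change _ * R.twisted (R.hit n) n s N ω φ.1 = _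
    rw [heq]
    ring
  have hsm := hL.norm_scaledMass_le (hG N) hn
  rw [hE]
  have hsplit : scaledMass D s n (R.σ^[N] ω) - ratioProd D n s N ω *
      (D.nu n s ω φ * scaledMass D s n (R.σ^[N] ω) + n * q) =
      scaledMass D s n (R.σ^[N] ω) * (1 - ratioProd D n s N ω * D.nu n s ω φ) -
        ratioProd D n s N ω * (n * q) := by ring
  rw [hsplit]
  refine (norm_sub_le _ _).trans ?_
  rw [norm_mul, norm_mul]
  have e1 : ‖scaledMass D s n (R.σ^[N] ω)‖ * ‖1 - ratioProd D n s N ω * D.nu n s ω φ‖ ≤ α N :=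
    (mul_le_mul_of_nonneg_right hsm (norm_nonneg _)).trans hn1.le
  have e2 : ‖ratioProd D n s N ω‖ * ‖(n : ℂ) * q‖ ≤ 2 * (α N * B) := by gcongr
  linarith

theorem LimitSetting.norm_delayedMass_zero_le {ω : Ω} (hG : GoodAt D s C₂ C₃ K α n₀ ω) {n : ℕ}
    (hn : 1 ≤ n) : ‖R.delayedMass s n 0 ω‖ ≤ K := by
  have := hG.fibre.prob_μ
  simp only [delayedMass, expS_zero, one_mul, Function.iterate_zero, id_eq]
  rw [integral_hit hL.targets hn, norm_mul, Complex.norm_natCast, Complex.norm_real,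
    Real.norm_of_nonneg measureReal_nonneg]
  exact hG.target_le n hn

/-- A visit at time `N - 1 - k` followed by one at time `N` is a return after `k + 1` steps.
Invariance moves the orbit segment to start at the first of these visits, over `σ^{-(k+1)} ω'`,
where its integral is the numerator of `qhat`; `h0` allows the denominator to be cleared. -/
theorem LimitSetting.delayedMass_eq_qhat {ω ω' : Ω}
    (hG : ∀ j : ℕ, GoodAt D s C₂ C₃ K α n₀ (R.σ^[j] ω)) {n : ℕ} (hn : 1 ≤ n) {N : ℕ}
    (hω : R.σ^[N] ω = ω') (h0 : (R.μ ω').real (R.target n ω') ≠ 0) :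
    R.delayedMass s n N ω = (n * (R.μ ω').real (R.target n ω') : ℝ) *
      (1 - ∑ k ∈ Finset.range N, R.qhat n k s ω') := by
  subst hω
  have hprob : IsProbabilityMeasure (R.μ ω) := (hG 0).fibre.prob_μ
  have hGf := fun j => (hG j).fibre
  set u : ℕ → Bundle R.J → ℂ := fun k p =>
    R.hit n (R.skew^[k + 1] p) * R.expS n k s (R.skew p) * R.hit n p with hu
  have hum : ∀ k, R.IsMult (u k) := fun k =>
    (((hL.targets.isMult_hit hn).comp_iterate (k + 1)).mul
      (hL.targets.isMult_expS hn k s).comp_skew).mul (hL.targets.isMult_hit hn)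
  have hmh := measurable_hit hL.targets hn
  have humeas : ∀ k, Measurable (u k) := fun k =>
    ((hmh.comp (hL.measurable_skew.iterate _)).mul
      ((hL.measurable_expS hn k s).comp hL.measurable_skew)).mul hmh
  have hunorm : ∀ k p, ‖u k p‖ ≤ 1 := by
    intro k p
    simp only [hu, norm_mul, norm_expS, mul_one]
    exact mul_le_one₀ (R.norm_hit_le n _) (norm_nonneg _) (R.norm_hit_le n p)
  have hq : ∀ k ∈ Finset.range N, R.qhat n k s (R.σ^[N] ω) *
      ((R.μ (R.σ^[N] ω)).real (R.target n (R.σ^[N] ω)) : ℂ) =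
      oneSubExp s * ∫ x, u k (R.skew^[N - 1 - k] (Bundle.pt ω x)) ∂(R.μ ω) := by
    intro k hk
    have hkN := Finset.mem_range.1 hk
    have hpt : R.σ.symm^[k + 1] (R.σ^[N] ω) = R.σ^[N - 1 - k] ω := by
      have e : R.σ^[N] ω = R.σ^[k + 1] (R.σ^[N - 1 - k] ω) := by
        rw [← Function.iterate_add_apply, show k + 1 + (N - 1 - k) = N by omega]
      rw [e]
      exact Function.LeftInverse.iterate (f := R.σ) (g := R.σ.symm) R.σ.symm_apply_apply (k + 1) _
    rw [integral_comp_iterate_skew hL.conformal hGf (hum k), ← hpt, qhat,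
      div_mul_cancel₀ _ (by exact_mod_cast h0)]
    rfl
  -- Expanding from the end of the segment leaves the phase of the visits strictly between the two
  -- times, as in `qhat`; the forward telescoping would leave the phase of those before them.
  have hpoint : ∀ p, R.expS n N s p * R.hit n (R.skew^[N] p) = R.hit n (R.skew^[N] p) -
      ∑ k ∈ Finset.range N, oneSubExp s * u k (R.skew^[N - 1 - k] p) := by
    intro p
    have h1 : R.expS n N s p = 1 - (1 - R.expS n N s p) := by ring
    rw [h1, one_sub_expS', sub_mul, one_mul, Finset.sum_mul]
    congr 1
    refine Finset.sum_congr rfl fun k hk => ?_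
    have hkN := Finset.mem_range.1 hk
    simp only [hu]
    rw [← Function.iterate_add_apply, ← Function.iterate_succ_apply' R.skew,
      show k + 1 + (N - 1 - k) = N by omega, show (N - 1 - k).succ = N - k by omega]
    ring
  rw [delayedMass]
  simp_rw [hpoint]
  rw [integral_sub, integral_finsetSum]
  · simp_rw [integral_const_mul]
    rw [← Finset.sum_congr rfl hq, integral_comp_iterate_skew hL.conformal hGf
      (hL.targets.isMult_hit hn) N, integral_hit hL.targets hn, ← Finset.sum_mul]
    push_cast
    ring
  · exact fun k _ => (integrable_of_norm_le _
      ((humeas k).comp (hL.measurable_skew.iterate _)) fun p => hunorm k _).const_mul _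
  · exact integrable_of_norm_le _ (hmh.comp (hL.measurable_skew.iterate N))
      fun p => R.norm_hit_le n _
  · exact integrable_finsetSum _ fun k _ => (integrable_of_norm_le _
      ((humeas k).comp (hL.measurable_skew.iterate _)) fun p => hunorm k _).const_mul _

end

end RandomSystem

/-- The approximations for `N` and `N + 1` stay close to the same `h`, so their limits, which differ
by `t q_N`, are within `β N + β (N + 1)`. Summability of `q` therefore comes out of the error
bounds, and the limits in `n` and `N` can be exchanged. -/
theorem summable_and_tendsto_of_approximation {h q : ℕ → ℂ} {t : ℝ} (ht : 0 < t) {β : ℕ → ℝ}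
    (hβ : Summable β) (E : ℕ → ℕ → ℂ)
    (hE : ∀ N, Tendsto (fun n => E n N) atTop (𝓝 (t * (1 - ∑ k ∈ Finset.range N, q k))))
    (hh : ∀ N ≥ 1, ∀ᶠ n in atTop, ‖h n - E n N‖ ≤ β N) :
    Summable q ∧ Tendsto h atTop (𝓝 (t * (1 - ∑' k, q k))) := by
  have hstep : ∀ N ≥ 1, ‖q N‖ ≤ (β N + β (N + 1)) / t := by
    intro N hN
    rw [le_div_iff₀ ht]
    have h1 := (hE N).sub (hE (N + 1))
    rw [Finset.sum_range_succ] at h1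
    have h2 : (t : ℂ) * (1 - ∑ k ∈ Finset.range N, q k) -
        t * (1 - (∑ k ∈ Finset.range N, q k + q N)) = t * q N := by ring
    rw [h2] at h1
    have h3 := le_of_tendsto h1.norm (b := β N + β (N + 1)) (by
      filter_upwards [hh N hN, hh (N + 1) (by omega)] with n hn1 hn2
      have : E n N - E n (N + 1) = (h n - E n (N + 1)) - (h n - E n N) := by ring
      rw [this]
      exact (norm_sub_le _ _).trans (by linarith))
    rwa [norm_mul, Complex.norm_real, Real.norm_of_nonneg ht.le, mul_comm] at h3
  have hq : Summable q := by
    rw [← summable_nat_add_iff 1]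
    refine Summable.of_norm_bounded
      (((summable_nat_add_iff 1).2 hβ).add ((summable_nat_add_iff 2).2 hβ) |>.div_const t)
      fun N => ?_
    exact hstep (N + 1) (by omega)
  refine ⟨hq, ?_⟩
  rw [Metric.tendsto_nhds]
  intro ε hε
  have hlim : Tendsto (fun N => (t : ℂ) * (1 - ∑ k ∈ Finset.range N, q k)) atTop
      (𝓝 (t * (1 - ∑' k, q k))) := (hq.hasSum.tendsto_sum_nat.const_sub 1).const_mul _
  obtain ⟨N, hN1, hN2, hN3⟩ := ((eventually_ge_atTop 1).and
    ((Metric.tendsto_nhds.1 hlim (ε / 3) (by positivity)).and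
    (hβ.tendsto_atTop_zero.eventually_lt_const (show 0 < ε / 3 by positivity)))).exists
  filter_upwards [hh N hN1, Metric.tendsto_nhds.1 (hE N) (ε / 3) (by positivity)] with n hn1 hn2
  rw [← dist_eq_norm] at hn1
  have := dist_triangle4 (h n) (E n N) ((t : ℂ) * (1 - ∑ k ∈ Finset.range N, q k))
    ((t : ℂ) * (1 - ∑' k, q k))
  linarith

end Limits

/-! ### Quenched limits of the ratios and of the exponents. -/

section Quenched

variable {Ω M : Type*} [MeasurableSpace Ω] [MeasurableSpace M] {m : Measure Ω}
  {R : RandomSystem Ω M}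

namespace RandomSystem

/-- The limiting exponent `(1 - e^{is}) ∫ t θ(s) dm`. -/
noncomputable def exponent (m : Measure Ω) (R : RandomSystem Ω M) (t : Ω → ℝ) (s : ℝ) : ℂ :=
  oneSubExp s * ∫ ω, (t ω : ℂ) * R.theta s ω ∂m

theorem qhat_eq_zero {s : ℝ} (hs : oneSubExp s = 0) (n k : ℕ) (ω : Ω) : R.qhat n k s ω = 0 := by
  unfold oneSubExp at hs
  simp [qhat, hs]

theorem theta_eq_one {s : ℝ} (hs : oneSubExp s = 0) (ω : Ω) : R.theta s ω = 1 := by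
  have h : ∀ k, R.qhat0 k s ω = 0 := fun k => by
    unfold qhat0
    simp_rw [qhat_eq_zero hs]
    exact tendsto_const_nhds.limUnder_eq
  simp [theta, h]

section

variable {D : SpectralData R} {s C₂ C₃ K : ℝ} {α : ℕ → ℝ} {n₀ : ℕ} {t : Ω → ℝ}
  (hL : LimitSetting m R D s C₂ C₃ α n₀)
include hL

/-- The comparison of length `N` is started over `σ^{-N} ω`, so that for every `N` it ends over the
same point `ω`. -/
theorem LimitSetting.tendsto_scaledMass {ω : Ω}
    (hG : ∀ k j : ℕ, GoodAt D s C₂ C₃ K α n₀ (R.σ^[j] (R.σ.symm^[k] ω)))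
    (hC8 : ∀ k : ℕ, ∃ q : ℂ, Tendsto (fun n => R.qhat n k s ω) atTop (𝓝 q))
    (hμ : Tendsto (fun n : ℕ => (n : ℝ) * (R.μ ω).real (R.target n ω)) atTop (𝓝 (t ω)))
    (ht : 0 < t ω) :
    Summable (fun k => R.qhat0 k s ω) ∧
      Tendsto (fun n => scaledMass D s n ω) atTop (𝓝 (t ω * R.theta s ω)) := by
  have hq : ∀ k, Tendsto (fun n => R.qhat n k s ω) atTop (𝓝 (R.qhat0 k s ω)) := fun k =>
    tendsto_nhds_limUnder (hC8 k)
  have hσ : ∀ N, R.σ^[N] (R.σ.symm^[N] ω) = ω := fun N =>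
    Function.LeftInverse.iterate (f := R.σ.symm) (g := R.σ) R.σ.apply_symm_apply N ω
  refine summable_and_tendsto_of_approximation ht
    (β := fun N => α N * (1 + 2 * (C₂ * (C₃ * K)))) (hL.α_summable.mul_right _)
    (fun n N => R.delayedMass s n N (R.σ.symm^[N] ω)) (fun N => ?_) (fun N hN => ?_)
  · have h1 : Tendsto (fun n : ℕ => (((n : ℝ) * (R.μ ω).real (R.target n ω) : ℝ) : ℂ) *
        (1 - ∑ k ∈ Finset.range N, R.qhat n k s ω)) atTop
        (𝓝 (t ω * (1 - ∑ k ∈ Finset.range N, R.qhat0 k s ω))) :=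
      ((Complex.continuous_ofReal.tendsto _).comp hμ).mul
        ((tendsto_finsetSum _ fun k _ => hq k).const_sub 1)
    refine h1.congr' ?_
    filter_upwards [hμ.eventually_const_lt ht, eventually_ge_atTop 1] with n hn hn1
    rw [hL.delayedMass_eq_qhat (hG N) hn1 (hσ N)]
    exact fun h0 => by simp [h0] at hn
  · have := hL.eventually_norm_scaledMass_sub_le (hG N) hN
    rwa [hσ N] at this

/-- The approximate double limit of the exponents of the laws of `S_{n,M}`. -/
theorem LimitSetting.tendsto_curry {ω : Ω}
    (hG : ∀ j : ℕ, GoodAt D s C₂ C₃ K α n₀ (R.σ^[j] ω)) {a : Ω → ℂ} {ā : ℂ}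
    (ha : ∀ j : ℕ, Tendsto (fun n => scaledMass D s n (R.σ^[j] ω)) atTop (𝓝 (a (R.σ^[j] ω))))
    (hā : Tendsto (fun N : ℕ => (∑ j ∈ Finset.range N, a (R.σ^[j] ω)) / N) atTop (𝓝 ā)) :
    Tendsto (fun p : ℕ × ℕ => (((p.2 : ℝ) / p.1 : ℝ) : ℂ) *
      ∫ x, (1 - R.expS p.2 p.1 s (Bundle.pt ω x)) ∂(R.μ ω)) (Filter.curry atTop atTop)
      (𝓝 (oneSubExp s * ā)) := by
  have hprob : IsProbabilityMeasure (R.μ ω) := (hG 0).fibre.prob_μ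
  have hG0 : GoodAt D s C₂ C₃ K α n₀ ω := hG 0
  have hK : 0 ≤ K := hG0.K_nonneg
  have h2 : (0 : ℝ) ≤ C₂ := by linarith [hL.one_le_C₂]
  have h3 : (0 : ℝ) ≤ C₃ := by linarith [hL.one_le_C₃]
  set B := C₂ * (C₃ * K) with hB
  have hB0 : 0 ≤ B := by positivity
  set β : ℕ → ℝ := fun N => α N * (1 + 2 * B) with hβ
  have hβs : Summable β := hL.α_summable.mul_right _
  have hβ0 : ∀ N, 0 ≤ β N := fun N => mul_nonneg (hL.α_pos N).le (by positivity)
  -- `K + B` covers `N = 0`, where the splitting gives no comparison, the series covers `N ≥ 1`, and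
  -- `1` pays for replacing `scaledMass` by its limit.
  set A := K + B + ∑' N, β N + 1 with hA
  have hA0 : 0 ≤ A := by have : 0 ≤ ∑' N, β N := tsum_nonneg hβ0; positivity
  have htel : ∀ (n M' : ℕ), 1 ≤ n → (n : ℂ) * ∫ x, (1 - R.expS n M' s (Bundle.pt ω x)) ∂(R.μ ω) =
      oneSubExp s * ∑ N ∈ Finset.range M', R.delayedMass s n N ω := by
    intro n M' hn
    simp_rw [one_sub_expS]
    rw [integral_finsetSum]
    · simp_rw [integral_const_mul]
      rw [Finset.mul_sum, Finset.mul_sum]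
      refine Finset.sum_congr rfl fun N _ => ?_
      rw [delayedMass]
      ring
    · refine fun N _ => Integrable.const_mul ?_ _
      refine integrable_of_norm_le (u := fun p => R.expS n N s p * R.hit n (R.skew^[N] p))
        (R.μ ω) ((hL.measurable_expS hn N s).mul ((measurable_hit hL.targets hn).comp
        (hL.measurable_skew.iterate N))) (C := 1) fun p => ?_
      rw [norm_mul, norm_expS, one_mul]
      exact R.norm_hit_le n _
  -- The bound does not depend on `M'`, so after division by `M'` the average of `delayedMass` has
  -- the same iterated limit as the Birkhoff average of `a`.
  have hdiff : ∀ M', ∀ᶠ n in atTop, ‖∑ N ∈ Finset.range M', R.delayedMass s n N ω -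
      ∑ N ∈ Finset.range M', a (R.σ^[N] ω)‖ ≤ A := by
    intro M'
    have e1 : ∀ᶠ n in atTop, ∀ N ∈ Finset.range M',
        ‖R.delayedMass s n N ω - scaledMass D s n (R.σ^[N] ω)‖ ≤
          β N + if N = 0 then K + B else 0 := by
      refine (Finset.eventually_all _).2 fun N _ => ?_
      rcases Nat.eq_zero_or_pos N with rfl | hN
      · filter_upwards [eventually_ge_atTop n₀] with n hn
        have i1 := hL.norm_delayedMass_zero_le hG0 (hL.one_le.trans hn)
        have i2 := hL.norm_scaledMass_le hG0 hn
        simp only [Function.iterate_zero, id_eq, if_true]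
        exact (norm_sub_le _ _).trans (by linarith [hβ0 0])
      · filter_upwards [hL.eventually_norm_scaledMass_sub_le hG hN] with n hn
        rw [if_neg (by omega), add_zero, norm_sub_rev]
        exact hn
    have e2 : Tendsto (fun n => ∑ N ∈ Finset.range M', scaledMass D s n (R.σ^[N] ω)) atTop
        (𝓝 (∑ N ∈ Finset.range M', a (R.σ^[N] ω))) := tendsto_finsetSum _ fun N _ => ha N
    filter_upwards [e1, Metric.tendsto_nhds.1 e2 1 one_pos] with n hn1 hn2
    rw [dist_eq_norm] at hn2
    have e3 : ‖∑ N ∈ Finset.range M', R.delayedMass s n N ω -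
        ∑ N ∈ Finset.range M', scaledMass D s n (R.σ^[N] ω)‖ ≤ ∑' N, β N + (K + B) := by
      rw [← Finset.sum_sub_distrib]
      refine (norm_sum_le_of_le _ hn1).trans ?_
      rw [Finset.sum_add_distrib]
      refine add_le_add (hβs.sum_le_tsum _ fun N _ => hβ0 N) ?_
      rw [Finset.sum_ite_eq']
      split_ifs
      · exact le_rfl
      · positivity
    have e4 := norm_add_le (∑ N ∈ Finset.range M', R.delayedMass s n N ω -
        ∑ N ∈ Finset.range M', scaledMass D s n (R.σ^[N] ω))
        (∑ N ∈ Finset.range M', scaledMass D s n (R.σ^[N] ω) -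
          ∑ N ∈ Finset.range M', a (R.σ^[N] ω))
    rw [sub_add_sub_cancel] at e4
    linarith
  rw [Metric.tendsto_nhds]
  intro ε hε
  rw [Filter.eventually_curry_iff]
  have hM1 := Metric.tendsto_nhds.1 (hā.const_mul (oneSubExp s)) (ε / 2) (by positivity)
  have hM2 := (tendsto_const_div_atTop_nhds_zero_nat (2 * A)).eventually_lt_const
    (show 0 < ε / 2 by positivity)
  filter_upwards [hM1, hM2, eventually_ge_atTop 1] with M' hM1 hM2 hM3
  have hM0 : (0 : ℝ) < M' := by exact_mod_cast hM3
  filter_upwards [hdiff M', eventually_ge_atTop 1] with n hn hn1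
  refine lt_of_le_of_lt (dist_triangle _ _ _) (lt_of_lt_of_le (add_lt_add_of_le_of_lt ?_ hM1)
    (add_halves ε).le)
  refine le_trans ?_ hM2.le
  have e5 : (((n : ℝ) / M' : ℝ) : ℂ) * ∫ x, (1 - R.expS n M' s (Bundle.pt ω x)) ∂(R.μ ω) -
      oneSubExp s * ((∑ j ∈ Finset.range M', a (R.σ^[j] ω)) / M') =
      oneSubExp s * (∑ N ∈ Finset.range M', R.delayedMass s n N ω -
        ∑ N ∈ Finset.range M', a (R.σ^[N] ω)) / M' := by
    push_cast
    rw [div_mul_eq_mul_div, htel n M' hn1]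
    ring
  rw [dist_eq_norm, e5, norm_div, norm_mul, Complex.norm_natCast]
  gcongr
  exact norm_oneSubExp_le s

theorem LimitSetting.ae_tendsto_scaledMass (hσ : Ergodic R.σ m)
    (hG : ∀ᵐ ω ∂m, GoodAt D s C₂ C₃ K α n₀ ω)
    (hC8 : ∀ᵐ ω ∂m, ∀ k : ℕ, ∃ q : ℂ, Tendsto (fun n => R.qhat n k s ω) atTop (𝓝 q))
    (hμ : ∀ᵐ ω ∂m, Tendsto (fun n : ℕ => (n : ℝ) * (R.μ ω).real (R.target n ω)) atTop
      (𝓝 (t ω))) (ht : ∀ᵐ ω ∂m, 0 < t ω) :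
    ∀ᵐ ω ∂m, Summable (fun k => R.qhat0 k s ω) ∧
      Tendsto (fun n => scaledMass D s n ω) atTop (𝓝 (t ω * R.theta s ω)) := by
  have hσm := hσ.toMeasurePreserving
  have hGb := (hσm.symm R.σ).ae_forall_iterate (hσm.ae_forall_iterate hG)
  filter_upwards [hGb, hC8, hμ, ht] with ω h1 h2 h3 h4
  exact hL.tendsto_scaledMass h1 h2 h3 h4

/-- The sequence `n (1 - λ_{n,s} / λ_0)`, set to zero below the threshold `n₀`. -/
noncomputable def scaledDefect (D : SpectralData R) (s : ℝ) (n₀ n : ℕ) (ω : Ω) : ℂ :=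
  if n₀ ≤ n then n * (1 - ratio D n s ω) else 0

/-- Maker's theorem asks for measurability in `ω`. The multipliers have it by assumption, which is
the reason for averaging this sequence instead of the fibre integrals it equals almost everywhere,
up to the factor `1 - e^{is}`. -/
theorem LimitSetting.measurable_scaledDefect (hlam : ∀ n ≥ n₀, Measurable (D.lam n s)) (n : ℕ) :
    Measurable (scaledDefect D s n₀ n) := by
  unfold scaledDefect
  by_cases hn : n₀ ≤ n
  · simp only [hn, if_true]
    exact (((hlam n hn).div (Complex.measurable_ofReal.comp
      hL.conformal.measurable_lam0)).const_sub 1).const_mul _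
  · simp only [hn, if_false]
    exact measurable_const

theorem LimitSetting.scaledDefect_eq {ω : Ω} (hG : GoodAt D s C₂ C₃ K α n₀ ω)
    (hG' : GoodAt D s C₂ C₃ K α n₀ (R.σ ω)) {n : ℕ} (hn : n₀ ≤ n) :
    scaledDefect D s n₀ n ω = oneSubExp s * scaledMass D s n ω := by
  have hn0 : (n : ℂ) ≠ 0 := by
    have := hL.one_le
    exact_mod_cast (by omega : n ≠ 0)
  rw [scaledDefect, if_pos hn, hL.ratio_eq_scaledMass hG hG' hn, sub_sub_cancel,
    mul_div_cancel₀ _ hn0]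

theorem LimitSetting.norm_scaledDefect_le {ω : Ω} (hG : GoodAt D s C₂ C₃ K α n₀ ω)
    (hG' : GoodAt D s C₂ C₃ K α n₀ (R.σ ω)) (n : ℕ) :
    ‖scaledDefect D s n₀ n ω‖ ≤ 2 * (C₂ * (C₃ * K)) := by
  by_cases hn : n₀ ≤ n
  · rw [hL.scaledDefect_eq hG hG' hn, norm_mul]
    exact mul_le_mul (norm_oneSubExp_le s) (hL.norm_scaledMass_le hG hn) (norm_nonneg _)
      zero_le_two
  · rw [scaledDefect, if_neg hn, norm_zero]
    have h1 := hG.K_nonneg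
    have h2 := hL.one_le_C₂
    have h3 := hL.one_le_C₃
    positivity

theorem LimitSetting.ratio_eq_scaledDefect {n : ℕ} (hn : n₀ ≤ n) (ω : Ω) :
    1 - scaledDefect D s n₀ n ω / n = ratio D n s ω := by
  have hn0 : (n : ℂ) ≠ 0 := by
    have := hL.one_le
    exact_mod_cast (by omega : n ≠ 0)
  rw [scaledDefect, if_pos hn, mul_div_cancel_left₀ _ hn0, sub_sub_cancel]

variable [IsProbabilityMeasure m]

theorem LimitSetting.integrable_and_ae_tendsto_ratioProd (hσ : Ergodic R.σ m)
    (hG : ∀ᵐ ω ∂m, GoodAt D s C₂ C₃ K α n₀ ω) (hlam : ∀ n ≥ n₀, Measurable (D.lam n s))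
    (hlim : ∀ᵐ ω ∂m, Tendsto (fun n => scaledMass D s n ω) atTop (𝓝 (t ω * R.theta s ω)))
    (hti : Integrable t m) :
    Integrable (fun ω => (t ω : ℂ) * R.theta s ω) m ∧
    ∀ᵐ ω ∂m, Tendsto (fun n => ratioProd D n s n ω) atTop
      (𝓝 (Complex.exp (-exponent m R t s))) := by
  have hσm := hσ.toMeasurePreserving
  have hGf := hσm.ae_forall_iterate hG
  have hbC : ∀ᵐ ω ∂m, ∀ n, ‖scaledDefect D s n₀ n ω‖ ≤ 2 * (C₂ * (C₃ * K)) := by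
    filter_upwards [hGf] with ω hω n
    exact hL.norm_scaledDefect_le (ω := ω) (hω 0) (hω 1) n
  have hblim : ∀ᵐ ω ∂m, Tendsto (fun n => scaledDefect D s n₀ n ω) atTop
      (𝓝 (oneSubExp s * (t ω * R.theta s ω))) := by
    filter_upwards [hlim, hGf] with ω h1 h2
    refine (h1.const_mul (oneSubExp s)).congr' ?_
    filter_upwards [eventually_ge_atTop n₀] with n hn
    exact (hL.scaledDefect_eq (ω := ω) (h2 0) (h2 1) hn).symm
  obtain ⟨hint, havg⟩ := hσ.ae_tendsto_average_of_tendsto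
    (hL.measurable_scaledDefect hlam) hbC hblim
  refine ⟨?_, ?_⟩
  -- Averaging yields integrability of `(1 - e^{is}) t θ`. If the factor vanishes, then `θ = 1` and
  -- integrability of `t` suffices.
  · by_cases hs : oneSubExp s = 0
    · simp_rw [theta_eq_one hs, mul_one]
      exact hti.ofReal
    · refine (hint.const_mul (oneSubExp s)⁻¹).congr (Eventually.of_forall fun ω => ?_)
      exact inv_mul_cancel_left₀ hs _
  · filter_upwards [havg, hσm.ae_forall_iterate hbC] with ω h3 h4
    rw [integral_const_mul] at h3
    have hprod := tendsto_prod_one_sub_div (b := fun n j => scaledDefect D s n₀ n (R.σ^[j] ω))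
      (Eventually.of_forall fun n j => h4 j n) h3
    refine hprod.congr' ?_
    filter_upwards [eventually_ge_atTop n₀] with n hn
    exact Finset.prod_congr rfl fun j _ => hL.ratio_eq_scaledDefect hn _

theorem LimitSetting.integrable_and_ae_tendsto (hσ : Ergodic R.σ m)
    (hG : ∀ᵐ ω ∂m, GoodAt D s C₂ C₃ K α n₀ ω) (hlam : ∀ n ≥ n₀, Measurable (D.lam n s))
    (hC8 : ∀ᵐ ω ∂m, ∀ k : ℕ, ∃ q : ℂ, Tendsto (fun n => R.qhat n k s ω) atTop (𝓝 q))
    (hμ : ∀ᵐ ω ∂m, Tendsto (fun n : ℕ => (n : ℝ) * (R.μ ω).real (R.target n ω)) atTop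
      (𝓝 (t ω))) (ht : ∀ᵐ ω ∂m, 0 < t ω) (hti : Integrable t m) :
    Integrable (fun ω => (t ω : ℂ) * R.theta s ω) m ∧
    ∀ᵐ ω ∂m, (∀ j : ℕ, GoodAt D s C₂ C₃ K α n₀ (R.σ^[j] ω)) ∧
      Summable (fun k => R.qhat0 k s ω) ∧
      Tendsto (fun n => ratioProd D n s n ω) atTop (𝓝 (Complex.exp (-exponent m R t s))) ∧
      Tendsto (fun p : ℕ × ℕ => (((p.2 : ℝ) / p.1 : ℝ) : ℂ) *
        ∫ x, (1 - R.expS p.2 p.1 s (Bundle.pt ω x)) ∂(R.μ ω)) (Filter.curry atTop atTop)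
        (𝓝 (exponent m R t s)) := by
  have hσm := hσ.toMeasurePreserving
  have hlim := hL.ae_tendsto_scaledMass hσ hG hC8 hμ ht
  have hlim' := hlim.mono fun ω h => h.2
  obtain ⟨hint, hprod⟩ := hL.integrable_and_ae_tendsto_ratioProd hσ hG hlam hlim' hti
  refine ⟨hint, ?_⟩
  filter_upwards [hσm.ae_forall_iterate hG, hlim, hprod, hσm.ae_forall_iterate hlim',
    hσ.ae_tendsto_birkhoffAverage_complex hint] with ω h1 h2 h3 h4 h5
  exact ⟨h1, h2.1, h3, hL.tendsto_curry (a := fun ω => t ω * R.theta s ω) h1 h4 h5⟩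

end

end RandomSystem

end Quenched

/-! ### From the stated hypotheses to uniform constants at typical points. -/

section Assembly

open RandomSystem

variable {Ω M : Type*} [MeasurableSpace Ω] [MeasurableSpace M]
  {m : Measure Ω} {R : RandomSystem Ω M} {D : SpectralData R} {t : Ω → ℝ}

theorem SatisfiesScaling.ae_tendsto (hS : SatisfiesScaling m R t) :
    ∀ᵐ ω ∂m, Tendsto (fun n : ℕ => (n : ℝ) * (R.μ ω).real (R.target n ω)) atTop
      (𝓝 (t ω)) := by
  obtain ⟨ξ, W, -, h1, h2, -⟩ := hS.scaling
  filter_upwards [h1, h2] with ω hω1 hω2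
  have h := hω2.const_add (t ω)
  rw [add_zero] at h
  refine h.congr' ?_
  filter_upwards [eventually_ge_atTop 1] with n hn
  have hn0 : (n : ℝ) ≠ 0 := by positivity
  rw [hω1 n hn, mul_div_cancel₀ _ hn0]

theorem SatisfiesScaling.exists_bound (hS : SatisfiesScaling m R t) :
    ∃ K : ℝ, ∀ᵐ ω ∂m, ∀ n : ℕ, 1 ≤ n → (n : ℝ) * (R.μ ω).real (R.target n ω) ≤ K := by
  obtain ⟨ξ, W, -, h1, -, h3⟩ := hS.scaling
  have htop : eLpNormEssSup t m ≠ ∞ := by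
    rw [← eLpNorm_exponent_top]
    exact hS.memLp_t.eLpNorm_ne_top
  refine ⟨(eLpNormEssSup t m).toReal + W, ?_⟩
  filter_upwards [h1, h3, enorm_ae_le_eLpNormEssSup t m] with ω hω1 hω3 hω2 n hn
  have hn0 : (n : ℝ) ≠ 0 := by positivity
  rw [hω1 n hn, mul_div_cancel₀ _ hn0]
  have h4 := ENNReal.toReal_mono htop hω2
  rw [toReal_enorm, Real.norm_eq_abs] at h4
  exact add_le_add ((le_abs_self _).trans h4) ((le_abs_self _).trans (hω3 n hn))

/-- Finitely many conditions holding eventually in `n` share one threshold, and countably many `n`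
share one null set. `C₃` and `K` are fixed before `s`, so the bounds on mean visits are common to
all `s`. -/
theorem IsRandomPerturbedSystem.exists_limitSetting {M : Type*} [MetricSpace M]
    [MeasurableSpace M] {R : RandomSystem Ω M} {D : SpectralData R}
    (hR : IsRandomPerturbedSystem m R D) {K : ℝ}
    (hK : ∀ᵐ ω ∂m, ∀ n : ℕ, 1 ≤ n → (n : ℝ) * (R.μ ω).real (R.target n ω) ≤ K) :
    ∃ C₃ : ℝ, 1 ≤ C₃ ∧ ∀ s : ℝ, ∃ C₂ α n₀, LimitSetting m R D s C₂ C₃ α n₀ ∧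
      (∀ n ≥ n₀, Measurable (D.lam n s)) ∧ ∀ᵐ ω ∂m, GoodAt D s C₂ C₃ K α n₀ ω := by
  obtain ⟨C₃, hC₃, h7⟩ := hR.spectral.C7
  refine ⟨C₃, hC₃, fun s => ?_⟩
  have hC := hR.conformal
  have hSp := hR.spectral
  obtain ⟨C, hC0, α, hα, hαs, -, h4⟩ := hSp.C4 s
  obtain ⟨C₂, hC₂, h5, h5'⟩ := hSp.C5 s
  obtain ⟨n₁, hn₁⟩ := eventually_atTop.1 ((hSp.C2_lam s).and ((hSp.C2_phi s).and
    ((hSp.C2_eigenfunction s).and ((hSp.C2_normalised s).and ((hSp.C3_perturbed s).and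
    ((hSp.C3_perturbed_kernel s).and (h4.and h5')))))))
  -- The constant of (C4) is absorbed into `α`.
  refine ⟨C₂, fun N => C * α N, max n₁ 1, ⟨hR.targets, hC, hR.dynamics.M1, hR.dynamics.one_mem,
    le_max_right _ _, fun n hn ω => ?_, fun n hn ω => ?_, hC₂, hC₃, fun N => mul_pos hC0 (hα N),
    hαs.mul_left C⟩, fun n hn => ?_, ?_⟩
  · exact (hn₁ n (le_of_max_le_left hn)).1.2.1 ω
  · exact (hn₁ n (le_of_max_le_left hn)).2.1.2 ω
  · exact (hn₁ n (le_of_max_le_left hn)).1.1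
  · have hall : ∀ᵐ ω ∂m, ∀ n ≥ n₁, PerturbedFibre D n s ω ∧
        (∀ N ≥ 1, ∀ f : R.Fn ω, ∀ᵐ x ∂(R.ν (R.σ^[N] ω)),
          ‖(R.iter (D.Q n s) N ω f).1 x‖ ≤ C * α N * (R.B ω).nrm f) ∧
        ∀ᵐ x ∂(R.ν ω), ‖Bundle.fib (D.phi n s) ω x‖ ≤ C₂ := by
      refine ae_all_iff.2 fun n => ae_all_iff.2 fun hn => ?_
      obtain ⟨-, -, e1, e2, e3, e4, e5, e6⟩ := hn₁ n hn
      filter_upwards [e1, e2, e3, e4, e5, e6] with ω w1 w2 w3 w4 w5 w6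
      exact ⟨⟨w1, w2, w3, fun f => (w4 f).2⟩, w5, w6⟩
    filter_upwards [hall, hC.isProbability, hC.μ_isProbability, hC.integrable, hC.eigenfunction,
      hC.conformal, h7, h5, hK] with ω w1 w2 w3 w4 w5 w6 w7 w8 w9
    exact ⟨⟨w2, w3, w4, w5, w6, w7⟩, fun n hn => (w1 n (le_of_max_le_left hn)).1,
      fun n hn => (w1 n (le_of_max_le_left hn)).2.1, w8,
      fun n hn => (w1 n (le_of_max_le_left hn)).2.2, w9⟩

end Assembly

/-! ### Typical points and the compound Poisson limit -/

section Typical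

open RandomSystem

variable {Ω M : Type*} [MeasurableSpace Ω] [MeasurableSpace M]
  {m : Measure Ω} {R : RandomSystem Ω M} {D : SpectralData R} {t : Ω → ℝ} {C K s : ℝ} {ω : Ω}

/-- The quenched limits and bounds over a typical point of the base, for the parameter `s`. -/
structure IsTypical (m : Measure Ω) (R : RandomSystem Ω M) (D : SpectralData R) (t : Ω → ℝ)
    (C K s : ℝ) (ω : Ω) : Prop where
  prob_ν : IsProbabilityMeasure (R.ν ω)
  prob_μ : IsProbabilityMeasure (R.μ ω)
  summable : Summable fun k => R.qhat0 k s ω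
  mean_μ : ∀ n : ℕ, 1 ≤ n → ∀ k : ℕ,
    (n : ℝ) * ∫ x, (R.visits n k (Bundle.pt ω x) : ℝ) ∂(R.μ ω) ≤ k * K
  mean_ν : ∀ n : ℕ, 1 ≤ n → ∀ k : ℕ,
    (n : ℝ) * ∫ x, (R.visits n k (Bundle.pt ω x) : ℝ) ∂(R.ν ω) ≤ k * C
  tendsto_ν : Tendsto (fun n : ℕ => ∫ x, R.expVisits n n s ω x ∂(R.ν ω)) atTop
    (𝓝 (Complex.exp (-exponent m R t s)))
  tendsto_μ : Tendsto (fun n : ℕ => ∫ x, R.expVisits n n s ω x ∂(R.μ ω)) atTop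
    (𝓝 (Complex.exp (-exponent m R t s)))
  tendsto_ratioProd : Tendsto (fun n => ratioProd D n s n ω) atTop
    (𝓝 (Complex.exp (-exponent m R t s)))
  tendsto_curry : Tendsto (fun p : ℕ × ℕ => (((p.2 : ℝ) / p.1 : ℝ) : ℂ) *
    ∫ x, (1 - R.expS p.2 p.1 s (Bundle.pt ω x)) ∂(R.μ ω)) (Filter.curry atTop atTop)
    (𝓝 (exponent m R t s))

theorem IsRandomPerturbedSystem.exists_ae_isTypical {M : Type*} [MetricSpace M]
    [MeasurableSpace M] {R : RandomSystem Ω M} {D : SpectralData R} [IsProbabilityMeasure m]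
    (hR : IsRandomPerturbedSystem m R D) (hC8 : SatisfiesC8 m R)
    (hS : SatisfiesScaling m R t) :
    ∃ C K, ∀ s : ℝ, Integrable (fun ω => (t ω : ℂ) * R.theta s ω) m ∧
      ∀ᵐ ω ∂m, IsTypical m R D t C K s ω := by
  obtain ⟨K, hK⟩ := hS.exists_bound
  obtain ⟨C₃, hC₃, h⟩ := hR.exists_limitSetting hK
  refine ⟨C₃ * K, K, fun s => ?_⟩
  obtain ⟨C₂, α, n₀, hL, hlam, hG⟩ := h s
  obtain ⟨hint, hae⟩ := hL.integrable_and_ae_tendsto hR.dynamics.ergodic hG hlam (hC8 s)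
    hS.ae_tendsto hS.t_pos (hS.memLp_t.integrable le_top)
  refine ⟨hint, ?_⟩
  filter_upwards [hae] with ω ⟨h1, h2, h3, h4⟩
  have e1 := hL.tendsto_twisted_diagonal h1 ⟨fun _ => 1, hL.one_mem ω⟩
    (hL.tendsto_twisted_one h1) h3
  have e2 := hL.tendsto_twisted_diagonal h1 ⟨R.phi0C ω, hL.conformal.phi0_mem ω⟩
    (hL.tendsto_twisted_phi0 h1) h3
  simp only [twisted, mul_one, one_mul] at e1
  simp only [hL.twisted_phi0, mul_one] at e2
  exact ⟨(h1 0).fibre.prob, (h1 0).fibre.prob_μ, h2, fun n hn k => hL.mean_visits_le h1 hn k,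
    fun n hn k => (hL.mean_visits_ν_le h1 hn k).trans_eq (by ring), e1, e2, h3, h4⟩

variable (hT : IsTargetFamily m R) (hs : Measurable R.skew)
include hT hs

theorem measurable_visits_pt {n : ℕ} (hn : 1 ≤ n) (k : ℕ) (ω : Ω) :
    Measurable fun x : R.J ω => R.visits n k (Bundle.pt ω x) :=
  (measurable_visits hT hs hn k).comp (measurable_bundle_pt ω)

/-- The exponent is the exponent of a compound Poisson law, on every countable set of
parameters. -/
theorem exists_boundedMean_exponent_eq [IsProbabilityMeasure m]
    (h : ∀ s : ℝ, ∀ᵐ ω ∂m, IsTypical m R D t C K s ω) {A : Set ℝ} (hA : A.Countable) :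
    ∃ ρ, BoundedMean (2 * K) ρ ∧ ∀ s ∈ A, exponent m R t s =
      ∑' k : ℕ, ρ k • (1 - Complex.exp (Complex.I * s * k)) := by
  -- The exponent does not involve `ω`, so one point that is typical for all `s ∈ A` suffices;
  -- countability of `A` provides it.
  obtain ⟨ω, hω0, hω⟩ := ((h 0).and ((ae_ball_iff hA).2 fun s _ => h s)).exists
  have hμ := hω0.prob_μ
  have hev : ∀ᶠ p : ℕ × ℕ in Filter.curry atTop atTop, 1 ≤ p.1 ∧ 1 ≤ p.2 := by
    rw [Filter.eventually_curry_iff]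
    filter_upwards [eventually_ge_atTop 1] with a ha
    filter_upwards [eventually_ge_atTop 1] with b hb using ⟨ha, hb⟩
  have : (Filter.curry (atTop : Filter ℕ) (atTop : Filter ℕ)).NeBot :=
    ⟨fun hbot => by
      have := Filter.eventually_curry_iff (l := (atTop : Filter ℕ)) (m := (atTop : Filter ℕ))
        (p := fun _ => False)
      simp only [hbot, eventually_bot, eventually_const, true_iff] at this⟩
  -- The mass functions are `n / M` times the laws of `S_{n,M}` off `0`, with `p = (M, n)`. Their
  -- means are at most `K` by invariance and scaling, hence the constant `2 * K`.
  refine exists_boundedMean_of_tendsto (F := Filter.curry atTop atTop)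
    (r := fun (p : ℕ × ℕ) k => if k = 0 then 0 else ((p.2 : ℝ) / p.1) *
      (R.μ ω).real ((fun x => R.visits p.2 p.1 (Bundle.pt ω x)) ⁻¹' {k})) ?_ fun s hsA => ?_
  · filter_upwards [hev] with p ⟨hp1, hp2⟩
    refine boundedMean_scaled_law (measurable_visits_pt hT hs hp2 p.1 ω)
      (integrable_visits hT hs hp2 p.1 ω _) (by positivity) ?_
    have h1 := hω0.mean_μ p.2 hp2 p.1
    have hp : (0 : ℝ) < p.1 := by exact_mod_cast hp1
    rw [div_mul_eq_mul_div]
    gcongr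
    rw [div_le_iff₀ hp]
    linarith
  · refine (hω s hsA).tendsto_curry.congr' ?_
    filter_upwards [hev] with p ⟨hp1, hp2⟩
    exact (tsum_scaled_law (measurable_visits_pt hT hs hp2 p.1 ω)
      (g := fun k : ℕ => 1 - Complex.exp (Complex.I * s * k))
      (Complex.norm_one_sub_exp_I_mul_real_mul_nat_le s) (by simp)).symm

theorem exists_isCompoundPoisson_exponent [IsProbabilityMeasure m]
    (h : ∀ s : ℝ, ∀ᵐ ω ∂m, IsTypical m R D t C K s ω) :
    ∃ P : Measure ℕ, IsProbabilityMeasure P ∧ IsCompoundPoisson P ∧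
      ∀ s : ℝ, ∫ z, Complex.exp (Complex.I * s * (z : ℂ)) ∂P =
        Complex.exp (-exponent m R t s) := by
  have hQ : (Set.range ((↑) : ℚ → ℝ)).Countable := Set.countable_range _
  obtain ⟨ρ, hρ, hρe⟩ := exists_boundedMean_exponent_eq hT hs h hQ
  obtain ⟨P, hP1, hP2, hP3⟩ := exists_isCompoundPoisson hρ
  refine ⟨P, hP1, hP2, fun s => ?_⟩
  -- A second mass function is adapted to the given `s`. Both sums are continuous and agree on `ℚ`,
  -- hence everywhere, so `ρ` also represents the exponent at `s`.
  obtain ⟨ρ', hρ', hρe'⟩ := exists_boundedMean_exponent_eq hT hs h (hQ.insert s)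
  have heq := Continuous.ext_on Rat.denseRange_cast (continuous_tsum_smul_one_sub_exp hρ)
    (continuous_tsum_smul_one_sub_exp hρ') fun x hx =>
      (hρe x hx).symm.trans (hρe' x (Set.mem_insert_of_mem _ hx))
  rw [hP3, hρe' s (Set.mem_insert _ _), ← congrFun heq s]

/-- The mean of `S_{n,n}` is at most `K`, so the laws are tight (total mass plus mean is at most `1
+ K`), and the rational parameters identify the limit. -/
theorem tendsto_integral_visits {P : Measure ℕ} [IsProbabilityMeasure P]
    (hP : ∀ s : ℝ, ∫ z, Complex.exp (Complex.I * s * (z : ℂ)) ∂P =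
      Complex.exp (-exponent m R t s)) {ν' : Measure (R.J ω)} [IsProbabilityMeasure ν']
    (hm : ∀ n : ℕ, 1 ≤ n → ∀ k : ℕ,
      (n : ℝ) * ∫ x, (R.visits n k (Bundle.pt ω x) : ℝ) ∂ν' ≤ k * K)
    (hlim : ∀ q : ℚ, Tendsto (fun n : ℕ => ∫ x, R.expVisits n n q ω x ∂ν') atTop
      (𝓝 (Complex.exp (-exponent m R t q)))) (f : ℝ →ᵇ ℝ) :
    Tendsto (fun n : ℕ => ∫ x, f (R.visits n n (Bundle.pt ω x) : ℝ) ∂ν') atTop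
      (𝓝 (∫ z, f (z : ℝ) ∂P)) := by
  have hf : ∀ k : ℕ, ‖f (k : ℝ)‖ ≤ ‖f‖ := fun k => f.norm_coe_le_norm _
  have hr : ∀ᶠ n : ℕ in atTop, BoundedMean (1 + K)
      fun k => ν'.real ((fun x => R.visits n n (Bundle.pt ω x)) ⁻¹' {k}) := by
    filter_upwards [eventually_ge_atTop 1] with n hn
    refine boundedMean_law (measurable_visits_pt hT hs hn n ω)
      (integrable_visits hT hs hn n ω _) ?_
    have hn0 : (0 : ℝ) < n := by exact_mod_cast hn
    have := le_of_mul_le_mul_left (hm n hn n) hn0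
    simpa using this
  have hmain := tendsto_tsum_of_tendsto_exp (P := P) hr (fun q => ?_) hf
  · refine hmain.congr' ?_
    filter_upwards [eventually_ge_atTop 1] with n hn
    exact (integral_comp_nat_eq_tsum (measurable_visits_pt hT hs hn n ω) hf).symm
  · rw [hP]
    refine (hlim q).congr' ?_
    filter_upwards [eventually_ge_atTop 1] with n hn
    exact integral_comp_nat_eq_tsum (measurable_visits_pt hT hs hn n ω)
      (g := fun k : ℕ => Complex.exp (Complex.I * (q : ℝ) * k))
      fun k => (Complex.norm_exp_I_mul_real_mul_nat q k).le

end Typical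

theorem mainTheorem1 {Ω M : Type*} [MeasurableSpace Ω] [MetricSpace M] [CompleteSpace M]
    [MeasurableSpace M] [BorelSpace M] (m : Measure Ω) [IsProbabilityMeasure m]
    (R : RandomSystem Ω M) (D : SpectralData R) (t : Ω → ℝ)
    (hR : IsRandomPerturbedSystem m R D) (hC8 : SatisfiesC8 m R)
    (hS : SatisfiesScaling m R t) :
    (∀ s : ℝ,
      (∀ᵐ ω ∂m, Summable fun k => R.qhat0 k s ω) ∧
      Integrable (fun ω => (t ω : ℂ) * R.theta s ω) m ∧
      ∀ᵐ ω ∂m,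
        Tendsto (fun n : ℕ => ∫ x, R.expVisits n n s ω x ∂(R.ν ω)) atTop
          (𝓝 (Complex.exp (-(1 - Complex.exp (Complex.I * s)) *
            ∫ ω', (t ω' : ℂ) * R.theta s ω' ∂m))) ∧
        Tendsto (fun n : ℕ => ∫ x, R.expVisits n n s ω x ∂(R.μ ω)) atTop
          (𝓝 (Complex.exp (-(1 - Complex.exp (Complex.I * s)) *
            ∫ ω', (t ω' : ℂ) * R.theta s ω' ∂m))) ∧
        Tendsto (fun n : ℕ => (∏ j ∈ Finset.range n, D.lam n s (R.σ^[j] ω)) /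
            ∏ j ∈ Finset.range n, (R.lam0 (R.σ^[j] ω) : ℂ)) atTop
          (𝓝 (Complex.exp (-(1 - Complex.exp (Complex.I * s)) *
            ∫ ω', (t ω' : ℂ) * R.theta s ω' ∂m)))) ∧
    ∃ P : Measure ℕ, IsCompoundPoisson P ∧
      (∀ s : ℝ, ∫ z, Complex.exp (Complex.I * s * (z : ℂ)) ∂P =
        Complex.exp (-(1 - Complex.exp (Complex.I * s)) *
          ∫ ω', (t ω' : ℂ) * R.theta s ω' ∂m)) ∧
      ∀ᵐ ω ∂m, ∀ f : ℝ →ᵇ ℝ,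
        Tendsto (fun n : ℕ => ∫ x, f (R.visits n n (Bundle.pt ω x) : ℝ) ∂(R.ν ω)) atTop
          (𝓝 (∫ z, f (z : ℝ) ∂P)) ∧
        Tendsto (fun n : ℕ => ∫ x, f (R.visits n n (Bundle.pt ω x) : ℝ) ∂(R.μ ω)) atTop
          (𝓝 (∫ z, f (z : ℝ) ∂P)) := by
  have hexp : ∀ s : ℝ, Complex.exp (-(1 - Complex.exp (Complex.I * s)) *
      ∫ ω', (t ω' : ℂ) * R.theta s ω' ∂m) = Complex.exp (-R.exponent m t s) := fun s => by
    rw [RandomSystem.exponent, oneSubExp, neg_mul]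
  obtain ⟨C, K, h⟩ := hR.exists_ae_isTypical hC8 hS
  have hT := hR.targets
  have hs := hR.dynamics.M1
  refine ⟨fun s => ?_, ?_⟩
  · rw [hexp]
    refine ⟨(h s).2.mono fun ω hω => hω.summable, (h s).1, (h s).2.mono fun ω hω =>
      ⟨hω.tendsto_ν, hω.tendsto_μ, ?_⟩⟩
    simpa only [RandomSystem.ratioProd, RandomSystem.ratio, Finset.prod_div_distrib] using
      hω.tendsto_ratioProd
  · obtain ⟨P, hP1, hP2, hP3⟩ := exists_isCompoundPoisson_exponent hT hs fun s => (h s).2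
    refine ⟨P, hP2, fun s => (hP3 s).trans (hexp s).symm, ?_⟩
    -- Only rational parameters enter, so one null set serves all test functions `f`.
    filter_upwards [ae_all_iff.2 fun q : ℚ => (h q).2] with ω hω f
    have := (hω 0).prob_ν
    have := (hω 0).prob_μ
    exact ⟨tendsto_integral_visits hT hs hP3 (hω 0).mean_ν (fun q => (hω q).tendsto_ν) f,
      tendsto_integral_visits hT hs hP3 (hω 0).mean_μ (fun q => (hω q).tendsto_μ) f⟩
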